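/- **Setting.** Let $A=(a_{ij})_{i,j\in I}$ be a generalized Cartan matrix ($I$ finite), and let $\mathfrak h_{\mathbb R}$ be a finite-dimensional real vector space with linearly independent coroots $h_i\in\mathfrak h_{\mathbb R}$ and linearly independent roots $\alpha_i\in\mathfrak h_{\mathbb R}^*$, $\alpha_j(h_i)=a_{ij}$. Let $\mathcal W$ be the Weyl group, generated by the simple reflections $\sigma_i$, with length function $l$. Let $\mathcal W_J$ ($J\subseteq I$) be its standard parabolic subgroups, let $\mathcal W^J$ (resp. ${}^K\mathcal W$) be the set of minimal length representatives of $\mathcal W/\mathcal W_J$ (resp. $\mathcal W_K\backslash\mathcal W$), put ${}^K\mathcal W^J={}^K\mathcal W\cap\mathcal W^J$ and $(\mathcal W_L)^K=\mathcal W_L\cap\mathcal W^K$ for $K\subseteq L$, and let $red(\sigma)\subseteq I$ be the set of indices occurring in a reduced expression of $\sigma$. For $J\subseteq I$ let $J^0$ and $J^\infty$ be the unions of the connected components of $J$ of finite and of non-finite type, respectively, and $J^\perp=\{i\in I\mid a_{ij}=0\ \forall j\in J\}$. A set $\Theta\subseteq I$ is special if $\Theta=\Theta^\infty$. Let $\overline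 C=\{\lambda\in\mathfrak h_{\mathbb R}^*\mid\lambda(h_i)\ge 0\ \forall i\in I\}$, let $X=\mathcal W\,\overline C$ be the Tits cone in $\mathfrak h_{\mathbb R}^*$ (it is a convex cone), and for $\Theta$ special let $R(\Theta)=\mathcal W_{\Theta^\perp}\overline F_\Theta$, where $\overline F_\Theta=\{\lambda\in\overline C\mid\lambda(h_i)=0\ \forall i\in\Theta\}$; it is a face of $X$. The face monoid $\widehat{\mathcal W}$ consists of the classes $\sigma\varepsilon(R)$ of pairs $(\sigma,R)$, $\sigma\in\mathcal W$, $R$ a (nonempty) face of $X$, where $(\sigma,R)\sim(\sigma',R')$ iff $R=R'$ and $\sigma^{-1}\sigma'$ fixes $R$ pointwise, with product $\sigma\varepsilon(R)\cdot\tau\varepsilon(S)=\sigma\tau\,\varepsilon(\tau^{-1}R\cap S)$. Write $\varepsilon(R)=1\varepsilon(R)$ and identify $\sigma$ with $\sigma\varepsilon(X)$. Every element of $\widehat{\mathcal W}$ has the form $\sigma_1\varepsilon(R(\Theta))\sigma_2$ with $\Theta$ special and $\sigma_1,\sigma_2\in\mathcal W$. Let $\widehat{\mathcal W}_J=\{\sigma\varepsilon(R)\mid\sigma\in\mathcal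 W_J,\ R\supseteq R(J^\infty)\}$. Let $\mathcal C=\{\sigma\mathcal W_J\mid\sigma\in\mathcal W,\ J\subseteq I\}$ be the Coxeter complex, ordered by reverse inclusion. An action of $\widehat{\mathcal W}$ on $\mathcal C$ is called good if it extends the action of $\mathcal W$ by left multiplication, the stabilizer of $\mathcal W_J$ is $\widehat{\mathcal W}_J$ for all $J\subseteq I$, and every element acts order preservingly. **Theorem (Good action 2).** There is a faithful, good action $\triangleleft$ of $\widehat{\mathcal W}$ on $\mathcal C$ given as follows. Let $\sigma_1\varepsilon(R(\Theta))\sigma_2\in\widehat{\mathcal W}$ and $\tau\mathcal W_J\in\mathcal C$. It is possible to decompose $$\sigma_2\tau=a_1a_2xc_1c_2$$ with $a_1\in\mathcal W_{\Theta^\perp}$, $a_2\in\mathcal W_\Theta$, $x\in{}^{\Theta\cup\Theta^\perp}\mathcal W^{J^\infty\cup(J^\infty)^\perp}$, $c_1\in(\mathcal W_{(J^\infty)^\perp})^{J^0}$, $c_2\in\mathcal W_J$ and $xc_1\in{}^{\Theta\cup\Theta^\perp}\mathcal W^J$. For every such decomposition, with $\Xi:=\Theta\cup J^\infty\cup red(x)$,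 $$\sigma_1\varepsilon(R(\Theta))\sigma_2\triangleleft\tau\mathcal W_J=\sigma_1a_1\mathcal W_{\Xi\cup(\Xi^\perp\cap c_1J^0)},$$ where $c_1J^0$ stands for the set of $i\in I$ with $\alpha_i=c_1\alpha_j$ for some $j\in J^0$. *The action is induced by the action on Looijenga's cone.* For a face $R=\sigma R(\Theta)$ of $X$ ($\Theta$ special) let $\mathfrak h_R=\sigma\,\mathrm{span}\{h_i\mid i\in\Theta\}$ and let $p_R:\mathfrak h_{\mathbb R}\to\mathfrak h_{\mathbb R}/\mathfrak h_R$ be the projection. Let $X^\vee$ be the Tits cone in $\mathfrak h_{\mathbb R}$, i.e. the union of the $\mathcal W$-translates of $\{v\mid\alpha_i(v)\ge0\ \forall i\in I\}$, let $(X^\vee)^\circ$ be its interior, and let $X^\vee_{Loo}$ be the disjoint union of the sets $p_R((X^\vee)^\circ)$ over all faces $R$ of $X$. Then $\sigma\varepsilon(R)\,p_T(v)=p_{\sigma(R\cap T)}(\sigma v)$ defines an action of $\widehat{\mathcal W}$ on $X^\vee_{Loo}$. For $J\subseteq I$ put $$F^\vee_{J^0}(J^\infty)=\{p_{R(J^\infty)}(v)\mid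 v\in(X^\vee)^\circ,\ \alpha_i(v)=0\ (i\in J^0),\ \alpha_i(v)>0\ (i\in(J^\infty)^\perp\setminus J^0)\}.$$ The sets $\tau F^\vee_{J^0}(J^\infty)$ ($\tau\in\mathcal W$, $J\subseteq I$) form a partition of $X^\vee_{Loo}$ into nonempty sets, and $\tau F^\vee_{J^0}(J^\infty)\mapsto\tau\mathcal W_J$ is a well-defined bijection from this partition onto $\mathcal C$. If $m\in\widehat{\mathcal W}$ and $m\triangleleft\tau\mathcal W_J=\tau'\mathcal W_{J'}$, then $m\,\tau F^\vee_{J^0}(J^\infty)\subseteq\tau'F^\vee_{J'^0}(J'^\infty)$. *Comparison with good action 1.* Good action 1 is the action $\triangleright$ of $\widehat{\mathcal W}$ on $\mathcal C$ with $\sigma_1\varepsilon(R(\Theta))\sigma_2\triangleright\tau\mathcal W_J=\sigma_1a_1\mathcal W_{\Theta\cup J\cup red(y)}$ whenever $\sigma_2\tau=a_1a_2yc$ with $a_1\in\mathcal W_{\Theta^\perp}$, $a_2\in\mathcal W_\Theta$, $y\in{}^{\Theta\cup\Theta^\perp}\mathcal W^J$, $c\in\mathcal W_J$. If $\Theta$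 is special and $i\in I\setminus(\Theta\cup\Theta^\perp)$, then $$\varepsilon(R(\Theta))\triangleright\sigma_i\mathcal W_\emptyset=\mathcal W_{\Theta\cup\{i\}}\ne\mathcal W_\Theta=\varepsilon(R(\Theta))\triangleleft\sigma_i\mathcal W_\emptyset .$$ In particular, good actions 1 and 2 are different whenever $A$ is indecomposable and there is a special set $\Theta$ with $\emptyset\ne\Theta\ne I$. They are different for some generalized Cartan matrix of size $3\times3$. -/

import Mathlib

noncomputable section

/-- A generalized Cartan matrix `A` together with a free realization over `ℝ`:
linearly independent coroots `h i` in a real vector space `V` (the space `𝔥_ℝ`) and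
linearly independent roots `α i` in its dual, with `α j (h i) = a i j`. -/
structure KMDatum (I V : Type*) [Fintype I] [NormedAddCommGroup V] [NormedSpace ℝ V] where
  A : Matrix I I ℤ
  diag : ∀ i, A i i = 2
  offDiag : ∀ i j, i ≠ j → A i j ≤ 0
  zero_symm : ∀ i j, A i j = 0 → A j i = 0
  h : I → V
  α : I → Module.Dual ℝ V
  h_indep : LinearIndependent ℝ h
  α_indep : LinearIndependent ℝ α
  pairing : ∀ i j, α j (h i) = (A i j : ℝ)

namespace KMDatum

variable {I V : Type*} [Fintype I] [NormedAddCommGroup V] [NormedSpace ℝ V]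

/-! ### Subsets of the index set -/

/-- The `i`-th entry of `A_K v`, where `A_K` is the principal submatrix of `A` indexed by `K`
(only the entries `v j` with `j ∈ K` matter). -/
def subMul (D : KMDatum I V) (K : Set I) (v : I → ℝ) (i : I) : ℝ :=
  ∑ j, K.indicator (fun j => (D.A i j : ℝ) * v j) j

/-- The (indecomposable) generalized Cartan submatrix `A_K` is of finite type: `det A_K ≠ 0`
(that is, `A_K` has trivial kernel), there is `u > 0` with `A_K u > 0`, and `A_K v ≥ 0` implies
`v > 0` or `v = 0`. -/
def IsFiniteType (D : KMDatum I V) (K : Set I) : Prop :=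
  (∀ v : I → ℝ, (∀ i ∈ K, D.subMul K v i = 0) → ∀ i ∈ K, v i = 0) ∧
  (∃ u : I → ℝ, (∀ i ∈ K, 0 < u i) ∧ ∀ i ∈ K, 0 < D.subMul K u i) ∧
  (∀ v : I → ℝ, (∀ i ∈ K, 0 ≤ D.subMul K v i) → (∀ i ∈ K, 0 < v i) ∨ ∀ i ∈ K, v i = 0)

/-- For `i ∈ Θ`: the connected component of `i` in the Dynkin diagram of `A_Θ`. -/
def comp (D : KMDatum I V) (Θ : Set I) (i : I) : Set I :=
  {j | Relation.ReflTransGen (fun a b => a ∈ Θ ∧ b ∈ Θ ∧ D.A a b ≠ 0) i j}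

/-- `A` is indecomposable. -/
def IsIndecomposable (D : KMDatum I V) : Prop :=
  Nonempty I ∧ ∀ i, D.comp Set.univ i = Set.univ

/-- `Θ⁰`: the union of the components of `Θ` of finite type. -/
def fin (D : KMDatum I V) (Θ : Set I) : Set I := {i ∈ Θ | D.IsFiniteType (D.comp Θ i)}

/-- `Θ^∞`: the union of the components of `Θ` of non-finite type. -/
def inf (D : KMDatum I V) (Θ : Set I) : Set I := {i ∈ Θ | ¬ D.IsFiniteType (D.comp Θ i)}

/-- `Θ` is special if `Θ = Θ^∞`. -/
def IsSpecial (D : KMDatum I V) (Θ : Set I) : Prop := Θ = D.inf Θ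

/-- `J^⊥ = {i | a i j = 0 for all j ∈ J}`. -/
def perp (D : KMDatum I V) (J : Set I) : Set I := {i | ∀ j ∈ J, D.A i j = 0}

/-! ### The Weyl group -/

theorem pairing_self (D : KMDatum I V) (i : I) : D.α i (D.h i) = 2 := by
  rw [D.pairing, D.diag]; norm_num

/-- The simple reflection `v ↦ v - α i (v) • h i`. -/
def refl (D : KMDatum I V) (i : I) : V ≃ₗ[ℝ] V := Module.reflection (D.pairing_self i)

/-- The Weyl group, acting on `V`. -/
abbrev W (D : KMDatum I V) : Type _ := ↥(Subgroup.closure (Set.range D.refl))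

/-- The simple reflections as elements of the Weyl group. -/
def s (D : KMDatum I V) (i : I) : D.W := ⟨D.refl i, Subgroup.subset_closure ⟨i, rfl⟩⟩

/-- The contragredient action of the Weyl group on the dual space: `(w λ)(v) = λ(w⁻¹ v)`. -/
def dact (D : KMDatum I V) (w : D.W) : Module.Dual ℝ V ≃ₗ[ℝ] Module.Dual ℝ V :=
  ((w⁻¹).1).dualMap

theorem dact_apply (D : KMDatum I V) (w : D.W) (l : Module.Dual ℝ V) (v : V) :
    D.dact w l v = l ((w⁻¹).1 v) := rfl

theorem dact_one (D : KMDatum I V) (l : Module.Dual ℝ V) : D.dact 1 l = l := by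
  ext v; simp [dact_apply]

theorem dact_mul (D : KMDatum I V) (w u : D.W) (l : Module.Dual ℝ V) :
    D.dact (w * u) l = D.dact w (D.dact u l) := by
  ext v; simp [dact_apply, mul_inv_rev]

theorem dact_inv_dact (D : KMDatum I V) (w : D.W) (l : Module.Dual ℝ V) :
    D.dact w⁻¹ (D.dact w l) = l := by
  rw [← dact_mul, inv_mul_cancel, dact_one]

theorem dact_dact_inv (D : KMDatum I V) (w : D.W) (l : Module.Dual ℝ V) :
    D.dact w (D.dact w⁻¹ l) = l := by
  rw [← dact_mul, mul_inv_cancel, dact_one]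

/-- `l` is a word in the simple reflections for `w`. -/
def IsWord (D : KMDatum I V) (w : D.W) (l : List I) : Prop := (l.map D.s).prod = w

/-- The length of a Weyl group element with respect to the simple reflections. -/
def len (D : KMDatum I V) (w : D.W) : ℕ := sInf {n | ∃ l : List I, D.IsWord w l ∧ l.length = n}

/-- `red w`: the indices that occur in a reduced expression for `w`
(it does not matter in which one). -/
def red (D : KMDatum I V) (w : D.W) : Set I :=
  {i | ∃ l : List I, D.IsWord w l ∧ l.length = D.len w ∧ i ∈ l}

/-- The standard parabolic subgroup `W_J`. -/
def par (D : KMDatum I V) (J : Set I) : Subgroup D.W := Subgroup.closure (D.s '' J)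

/-- `W^J`: the minimal coset representatives of `W / W_J`. -/
def minR (D : KMDatum I V) (J : Set I) : Set D.W := {w | ∀ u ∈ D.par J, D.len w ≤ D.len (w * u)}

/-- `^K W`: the minimal coset representatives of `W_K \ W`. -/
def minL (D : KMDatum I V) (K : Set I) : Set D.W := {w | ∀ u ∈ D.par K, D.len w ≤ D.len (u * w)}

/-! ### The Tits cone and its faces -/

/-- The closed fundamental chamber in the dual space. -/
def chamber (D : KMDatum I V) : Set (Module.Dual ℝ V) := {l | ∀ i, 0 ≤ l (D.h i)}

/-- The closed facet of the fundamental chamber of type `J`. -/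
def closedFacet (D : KMDatum I V) (J : Set I) : Set (Module.Dual ℝ V) :=
  {l | (∀ i ∈ J, l (D.h i) = 0) ∧ ∀ i ∉ J, 0 ≤ l (D.h i)}

/-- `W_J · S`. -/
def parOrbit (D : KMDatum I V) (J : Set I) (S : Set (Module.Dual ℝ V)) :
    Set (Module.Dual ℝ V) := {l | ∃ w ∈ D.par J, ∃ m ∈ S, l = D.dact w m}

/-- `W · S`. -/
def orbit (D : KMDatum I V) (S : Set (Module.Dual ℝ V)) : Set (Module.Dual ℝ V) :=
  {l | ∃ w : D.W, ∃ m ∈ S, l = D.dact w m}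

/-- The Tits cone `X` in the dual space, as a convex cone. It is defined as the convex cone
generated by the translates of the closed chamber; as a set it is the union of these translates
(this is part of the conclusion of the main theorem). -/
def tits (D : KMDatum I V) : PointedCone ℝ (Module.Dual ℝ V) :=
  PointedCone.hull ℝ (D.orbit D.chamber)

/-- The faces of the Tits cone. -/
def Face (D : KMDatum I V) : Type _ :=
  {F : PointedCone ℝ (Module.Dual ℝ V) // F.IsFaceOf D.tits}

theorem Face.ext {D : KMDatum I V} {F G : D.Face} (hFG : ∀ l, l ∈ F.1 ↔ l ∈ G.1) : F = G :=
  Subtype.ext (SetLike.ext hFG)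

theorem tits_map (D : KMDatum I V) (w : D.W) :
    D.tits.map (D.dact w : Module.Dual ℝ V →ₗ[ℝ] Module.Dual ℝ V) = D.tits := by
  have key : ∀ w : D.W,
      D.tits.map (D.dact w : Module.Dual ℝ V →ₗ[ℝ] Module.Dual ℝ V) ≤ D.tits := by
    intro w
    rintro _ ⟨x, hx, rfl⟩
    have hx' : x ∈ PointedCone.hull ℝ (D.orbit D.chamber) := hx
    refine Submodule.span_induction (p := fun x _ => D.dact w x ∈ D.tits) ?_ ?_ ?_ ?_ hx'
    · rintro x ⟨u, m, hm, rfl⟩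
      exact PointedCone.subset_hull ⟨w * u, m, hm, (D.dact_mul w u m).symm⟩
    · simp
    · intro x y _ _ h1 h2
      rw [map_add]; exact add_mem h1 h2
    · intro a x _ h1
      have : D.dact w (a • x) = a • D.dact w x := (D.dact w).map_smul (a : ℝ) x
      rw [this]; exact Submodule.smul_mem _ a h1
  refine le_antisymm (key w) fun x hx => ?_
  exact PointedCone.mem_map.2
    ⟨D.dact w⁻¹ x, key w⁻¹ (PointedCone.mem_map.2 ⟨x, hx, rfl⟩), D.dact_dact_inv w x⟩

/-- The action of the Weyl group on faces. -/
def Face.smul {D : KMDatum I V} (w : D.W) (F : D.Face) : D.Face :=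
  ⟨F.1.map (D.dact w : Module.Dual ℝ V →ₗ[ℝ] Module.Dual ℝ V), by
    have := F.2.map_equiv (D.dact w)
    rwa [tits_map] at this⟩

/-- The intersection of faces. -/
def Face.inter {D : KMDatum I V} (F G : D.Face) : D.Face := ⟨F.1 ⊓ G.1, F.2.inf_left G.2⟩

/-- The Tits cone as a face of itself. -/
def Face.full (D : KMDatum I V) : D.Face := ⟨D.tits, .rfl⟩

theorem Face.mem_smul {D : KMDatum I V} (w : D.W) (F : D.Face) (l : Module.Dual ℝ V) :
    l ∈ (F.smul w).1 ↔ D.dact w⁻¹ l ∈ F.1 := by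
  constructor
  · intro hl
    obtain ⟨x, hx, rfl⟩ := PointedCone.mem_map.1 hl
    have : D.dact w⁻¹ (D.dact w x) = x := D.dact_inv_dact w x
    simpa [this] using hx
  · intro hl
    exact PointedCone.mem_map.2 ⟨_, hl, D.dact_dact_inv w l⟩

theorem Face.mem_inter {D : KMDatum I V} (F G : D.Face) (l : Module.Dual ℝ V) :
    l ∈ (F.inter G).1 ↔ l ∈ F.1 ∧ l ∈ G.1 := Iff.rfl

theorem Face.mem_full {D : KMDatum I V} (l : Module.Dual ℝ V) :
    l ∈ (Face.full D).1 ↔ l ∈ D.tits := Iff.rfl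

/-- The set `R(Θ) = W_{Θ^⊥} F̄_Θ`. -/
def specialFace (D : KMDatum I V) (Θ : Set I) : Set (Module.Dual ℝ V) :=
  D.parOrbit (D.perp Θ) (D.closedFacet Θ)

/-- The face `R` is the set `R(Θ)`. -/
def Face.IsSpecialFace {D : KMDatum I V} (R : D.Face) (Θ : Set I) : Prop :=
  (R.1 : Set (Module.Dual ℝ V)) = D.specialFace Θ

/-! ### The face monoid of the Weyl group -/

/-- The underlying set of the semidirect product of the Weyl group and the monoid of faces
(under intersection). -/
@[ext] structure PreMonoid (D : KMDatum I V) where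
  w : D.W
  R : D.Face

/-- `(σ, R) (τ, S) = (σ τ, τ⁻¹ R ∩ S)`. -/
instance (D : KMDatum I V) : Monoid D.PreMonoid where
  one := ⟨1, Face.full D⟩
  mul a b := ⟨a.w * b.w, (a.R.smul b.w⁻¹).inter b.R⟩
  mul_assoc a b c := by
    refine PreMonoid.ext (mul_assoc _ _ _) (Face.ext fun l => ?_)
    change l ∈ (Face.inter (Face.smul c.w⁻¹ (Face.inter (Face.smul b.w⁻¹ a.R) b.R)) c.R).1 ↔
      l ∈ (Face.inter (Face.smul (b.w * c.w)⁻¹ a.R) (Face.inter (Face.smul c.w⁻¹ b.R) c.R)).1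
    simp only [Face.mem_inter, Face.mem_smul, inv_inv, dact_mul]
    tauto
  one_mul a := by
    refine PreMonoid.ext (one_mul _) (Face.ext fun l => ?_)
    change l ∈ (Face.inter (Face.smul a.w⁻¹ (Face.full D)) a.R).1 ↔ _
    simp only [Face.mem_inter, Face.mem_smul, inv_inv, Face.mem_full]
    refine ⟨fun h => h.2, fun h => ⟨?_, h⟩⟩
    have h1 : D.dact a.w l ∈
        D.tits.map (D.dact a.w : Module.Dual ℝ V →ₗ[ℝ] Module.Dual ℝ V) :=
      PointedCone.mem_map.2 ⟨l, a.R.2.le h, rfl⟩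
    rwa [tits_map] at h1
  mul_one a := by
    refine PreMonoid.ext (mul_one _) (Face.ext fun l => ?_)
    change l ∈ (Face.inter (Face.smul (1 : D.W)⁻¹ a.R) (Face.full D)).1 ↔ _
    simp only [Face.mem_inter, Face.mem_smul, inv_inv, Face.mem_full, dact_one]
    exact ⟨fun h => h.1, fun h => ⟨h, a.R.2.le h⟩⟩

theorem PreMonoid.mul_w {D : KMDatum I V} (a b : D.PreMonoid) : (a * b).w = a.w * b.w := rfl

theorem PreMonoid.mul_R {D : KMDatum I V} (a b : D.PreMonoid) :
    (a * b).R = (a.R.smul b.w⁻¹).inter b.R := rfl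

/-- The pointwise stabilizer `Z_W(R)` of a face. -/
def Face.stab {D : KMDatum I V} (R : D.Face) : Set D.W := {w | ∀ l ∈ R.1, D.dact w l = l}

theorem Face.inv_mul_mem_stab {D : KMDatum I V} (R : D.Face) (w u : D.W) :
    w⁻¹ * u ∈ R.stab ↔ ∀ l ∈ R.1, D.dact u l = D.dact w l := by
  refine forall₂_congr fun l _ => ?_
  rw [dact_mul]
  constructor
  · intro h
    rw [← D.dact_dact_inv w (D.dact u l), h]
  · intro h
    rw [h, dact_inv_dact]

/-- The congruence `(σ, R) ∼ (σ', R') ↔ R = R' ∧ σ⁻¹ σ' ∈ Z_W(R)`. -/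
def faceCon (D : KMDatum I V) : Con D.PreMonoid where
  r a b := a.R = b.R ∧ a.w⁻¹ * b.w ∈ a.R.stab
  iseqv := by
    refine ⟨fun a => ⟨rfl, ?_⟩, ?_, ?_⟩
    · rw [Face.inv_mul_mem_stab]; exact fun l _ => rfl
    · rintro a b ⟨h1, h2⟩
      rw [Face.inv_mul_mem_stab] at h2
      refine ⟨h1.symm, ?_⟩
      rw [Face.inv_mul_mem_stab, ← h1]
      exact fun l hl => (h2 l hl).symm
    · rintro a b c ⟨h1, h2⟩ ⟨h3, h4⟩
      rw [Face.inv_mul_mem_stab] at h2 h4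
      refine ⟨h1.trans h3, ?_⟩
      rw [Face.inv_mul_mem_stab]
      rw [← h1] at h4
      exact fun l hl => (h4 l hl).trans (h2 l hl)
  mul' := by
    rintro a b c d ⟨h1, h2⟩ ⟨h3, h4⟩
    rw [Face.inv_mul_mem_stab] at h2 h4
    constructor
    · refine Face.ext fun l => ?_
      simp only [PreMonoid.mul_R, Face.mem_inter, Face.mem_smul, inv_inv, ← h1, ← h3]
      constructor
      · rintro ⟨h5, h6⟩
        exact ⟨by rwa [h4 l h6], h6⟩
      · rintro ⟨h5, h6⟩
        exact ⟨by rwa [← h4 l h6], h6⟩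
    · rw [Face.inv_mul_mem_stab]
      intro l hl
      simp only [PreMonoid.mul_R, Face.mem_inter, Face.mem_smul, inv_inv] at hl
      rw [PreMonoid.mul_w, PreMonoid.mul_w, dact_mul, dact_mul, h4 l hl.2, h2 _ hl.1]

/-- The face monoid `Ŵ` associated to the Weyl group. -/
abbrev FaceMonoid (D : KMDatum I V) : Type _ := D.faceCon.Quotient

/-- The element `σ ε(R)`. -/
def wε (D : KMDatum I V) (σ : D.W) (R : D.Face) : D.FaceMonoid :=
  ((⟨σ, R⟩ : D.PreMonoid) : D.faceCon.Quotient)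

/-- The idempotent `ε(R) = 1 ε(R)`. -/
def ε (D : KMDatum I V) (R : D.Face) : D.FaceMonoid := D.wε 1 R

/-- The embedding `σ ↦ σ ε(X)` of the Weyl group into its face monoid. -/
def ofW (D : KMDatum I V) (σ : D.W) : D.FaceMonoid := D.wε σ (Face.full D)

/-- The standard parabolic submonoid `Ŵ_J = W_J E_J`, where `E_J` consists of the `ε(R)`
with `R ⊇ R(J^∞)`. -/
def parMonoid (D : KMDatum I V) (J : Set I) : Set D.FaceMonoid :=
  {m | ∃ σ ∈ D.par J, ∃ R : D.Face,
    D.specialFace (D.inf J) ⊆ (R.1 : Set (Module.Dual ℝ V)) ∧ m = D.ofW σ * D.ε R}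

/-! ### The Coxeter complex and actions on it -/

/-- The coset `σ W_J`. -/
def cosetSet (D : KMDatum I V) (σ : D.W) (J : Set I) : Set D.W := {w | ∃ u ∈ D.par J, w = σ * u}

/-- The Coxeter complex: the set of all cosets `σ W_J`. -/
def Cox (D : KMDatum I V) : Type _ := {S : Set D.W // ∃ σ J, S = D.cosetSet σ J}

/-- The Coxeter complex is ordered by reverse inclusion. -/
instance (D : KMDatum I V) : PartialOrder D.Cox where
  le a b := b.1 ⊆ a.1
  le_refl _ := subset_rfl
  le_trans _ _ _ h1 h2 := subset_trans h2 h1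
  le_antisymm _ _ h1 h2 := Subtype.ext (subset_antisymm h2 h1)

/-- The coset `σ W_J` as an element of the Coxeter complex. -/
def coset (D : KMDatum I V) (σ : D.W) (J : Set I) : D.Cox := ⟨D.cosetSet σ J, σ, J, rfl⟩

/-- Good actions: actions of `Ŵ` on the Coxeter complex that extend the action of `W`, for which
the stabilizer of `W_J` is `Ŵ_J`, and which preserve the order. -/
structure IsGood (D : KMDatum I V) (act : D.FaceMonoid →* Function.End D.Cox) : Prop where
  extends_W : ∀ σ τ J, act (D.ofW σ) (D.coset τ J) = D.coset (σ * τ) J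
  stabilizer : ∀ J, {m | act m (D.coset 1 J) = D.coset 1 J} = D.parMonoid J
  order : ∀ m, Monotone (act m)

/-- The decomposition `w = a₁ a₂ y c`. -/
structure Decomp1 (D : KMDatum I V) (Θ J : Set I) (w a₁ a₂ y c : D.W) : Prop where
  eq : w = a₁ * a₂ * y * c
  a₁_mem : a₁ ∈ D.par (D.perp Θ)
  a₂_mem : a₂ ∈ D.par Θ
  y_mem : y ∈ D.minL (Θ ∪ D.perp Θ) ∩ D.minR J
  c_mem : c ∈ D.par J

/-- `act` is good action 1: `σ₁ ε(R(Θ)) σ₂` maps `τ W_J` to `σ₁ a₁ W_{Θ ∪ J ∪ red y}`, where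
`σ₂ τ = a₁ a₂ y c`. -/
def IsAction1 (D : KMDatum I V) (act : D.FaceMonoid →* Function.End D.Cox) : Prop :=
  ∀ Θ, D.IsSpecial Θ → ∀ R : D.Face, R.IsSpecialFace Θ → ∀ (σ₁ σ₂ τ : D.W) (J : Set I)
    (a₁ a₂ y c : D.W), D.Decomp1 Θ J (σ₂ * τ) a₁ a₂ y c →
    act (D.ofW σ₁ * D.ε R * D.ofW σ₂) (D.coset τ J) = D.coset (σ₁ * a₁) (Θ ∪ J ∪ D.red y)

/-- The decomposition `w = a₁ a₂ x c₁ c₂`. -/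
structure Decomp2 (D : KMDatum I V) (Θ J : Set I) (w a₁ a₂ x c₁ c₂ : D.W) : Prop where
  eq : w = a₁ * a₂ * x * c₁ * c₂
  a₁_mem : a₁ ∈ D.par (D.perp Θ)
  a₂_mem : a₂ ∈ D.par Θ
  x_mem : x ∈ D.minL (Θ ∪ D.perp Θ) ∩ D.minR (D.inf J ∪ D.perp (D.inf J))
  c₁_mem : c₁ ∈ (D.par (D.perp (D.inf J)) : Set D.W) ∩ D.minR (D.fin J)
  c₂_mem : c₂ ∈ D.par J
  xc₁_mem : x * c₁ ∈ D.minL (Θ ∪ D.perp Θ) ∩ D.minR J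

/-- The set `Ξ = Θ ∪ J^∞ ∪ red x`. -/
def Xi (D : KMDatum I V) (Θ J : Set I) (x : D.W) : Set I := Θ ∪ D.inf J ∪ D.red x

/-- The set `c J` of (indices of) simple roots of the form `c α_j` with `j ∈ J`. -/
def simpleImage (D : KMDatum I V) (c : D.W) (J : Set I) : Set I :=
  {i | ∃ j ∈ J, D.α i = D.dact c (D.α j)}

/-- `act` is good action 2: `σ₁ ε(R(Θ)) σ₂` maps `τ W_J` to
`σ₁ a₁ W_{Ξ ∪ (Ξ^⊥ ∩ c₁ J⁰)}`, where `σ₂ τ = a₁ a₂ x c₁ c₂` and `Ξ = Θ ∪ J^∞ ∪ red x`. -/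
def IsAction2 (D : KMDatum I V) (act : D.FaceMonoid →* Function.End D.Cox) : Prop :=
  ∀ Θ, D.IsSpecial Θ → ∀ R : D.Face, R.IsSpecialFace Θ → ∀ (σ₁ σ₂ τ : D.W) (J : Set I)
    (a₁ a₂ x c₁ c₂ : D.W), D.Decomp2 Θ J (σ₂ * τ) a₁ a₂ x c₁ c₂ →
    act (D.ofW σ₁ * D.ε R * D.ofW σ₂) (D.coset τ J) =
      D.coset (σ₁ * a₁) (D.Xi Θ J x ∪ (D.perp (D.Xi Θ J x) ∩ D.simpleImage c₁ (D.fin J)))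

/-! ### Looijenga's cone -/

/-- The Tits cone `X^∨` in `V`. -/
def cotits (D : KMDatum I V) : Set V := {v | ∃ w : D.W, ∃ u, (∀ i, 0 ≤ D.α i u) ∧ v = w.1 u}

/-- The subspace `𝔥_R` of `V`: for `R = σ R(Θ)` with `Θ` special, this is `σ span {h i | i ∈ Θ}`. -/
def faceSub (D : KMDatum I V) (R : D.Face) : Submodule ℝ V :=
  ⨆ (σ : D.W) (Θ : Set I) (_ : D.IsSpecial Θ ∧
      (R.1 : Set (Module.Dual ℝ V)) = D.dact σ '' D.specialFace Θ),
    (Submodule.span ℝ (D.h '' Θ)).map (σ.1 : V →ₗ[ℝ] V)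

/-- The disjoint union of the quotients `V / 𝔥_R` over all faces `R`. -/
def HHat (D : KMDatum I V) : Type _ := Σ R : D.Face, V ⧸ D.faceSub R

/-- The projection `p_R : V → V / 𝔥_R`. -/
def proj (D : KMDatum I V) (R : D.Face) (v : V) : D.HHat := ⟨R, Submodule.Quotient.mk v⟩

/-- Looijenga's cone: the disjoint union of the images `p_R((X^∨)°)`. -/
def Loo (D : KMDatum I V) : Set D.HHat := {p | ∃ R, ∃ v ∈ interior D.cotits, p = D.proj R v}

/-- `act` is the action of `Ŵ` on Looijenga's cone:
`σ ε(R)` maps `p_T(v)` to `p_{σ (R ∩ T)}(σ v)`. -/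
def IsLooAction (D : KMDatum I V) (act : D.FaceMonoid →* Function.End D.Loo) : Prop :=
  ∀ (σ : D.W) (R T : D.Face) (v : V) (hv : v ∈ interior D.cotits),
    (act (D.wε σ R) ⟨D.proj T v, T, v, hv, rfl⟩ : D.HHat) =
      D.proj ((R.inter T).smul σ) (σ.1 v)

/-- The facet `τ F_K^∨(Θ)` of Looijenga's cone, where `F_K^∨(Θ)` consists of the elements
`p_{R(Θ)}(v)` with `v ∈ (X^∨)°` such that `α i (v) = 0` for `i ∈ K` and
`α i (v) > 0` for `i ∈ Θ^⊥ \ K`. -/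
def facetSet (D : KMDatum I V) (τ : D.W) (Θ K : Set I) : Set D.HHat :=
  {p | ∃ R : D.Face, R.IsSpecialFace Θ ∧ ∃ v ∈ interior D.cotits,
    (∀ i ∈ K, D.α i v = 0) ∧ (∀ i ∈ D.perp Θ \ K, 0 < D.α i v) ∧
    p = D.proj (R.smul τ) (τ.1 v)}

/-- The facet `τ F_{J⁰}^∨(J^∞)` of Looijenga's cone. -/
def looFacet (D : KMDatum I V) (τ : D.W) (J : Set I) : Set D.HHat :=
  D.facetSet τ (D.inf J) (D.fin J)

/-- The sets `τ F_{J⁰}^∨(J^∞)` form a partition of Looijenga's cone which is parametrized by the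
elements `τ W_J` of the Coxeter complex. -/
structure FacetsPartition (D : KMDatum I V) : Prop where
  nonempty : ∀ τ J, (D.looFacet τ J).Nonempty
  subset : ∀ τ J, D.looFacet τ J ⊆ D.Loo
  eq_iff : ∀ τ J τ' J', D.looFacet τ J = D.looFacet τ' J' ↔ D.coset τ J = D.coset τ' J'
  disjoint : ∀ τ J τ' J', D.looFacet τ J ≠ D.looFacet τ' J' →
    Disjoint (D.looFacet τ J) (D.looFacet τ' J')
  cover : ∀ p ∈ D.Loo, ∃ τ J, p ∈ D.looFacet τ J

/-- The action on the Coxeter complex is induced by the action on Looijenga's cone: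
if `m` maps `τ W_J` to `τ' W_{J'}`, then it maps the facet belonging to `τ W_J` into the facet
belonging to `τ' W_{J'}`. -/
def IsInducedBy (D : KMDatum I V) (act : D.FaceMonoid →* Function.End D.Cox)
    (actLoo : D.FaceMonoid →* Function.End D.Loo) : Prop :=
  ∀ m τ J τ' J', act m (D.coset τ J) = D.coset τ' J' →
    ∀ p : D.Loo, p.1 ∈ D.looFacet τ J → (actLoo m p).1 ∈ D.looFacet τ' J'

end KMDatum

end

/-! ### The Weyl group as a group generated by the simple reflections. -/

namespace KMDatum

open Finset

variable {I V : Type*} [Fintype I] [NormedAddCommGroup V] [NormedSpace ℝ V]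
variable {D : KMDatum I V}

/-! ### Words and length -/

/-! Both good actions are shadows of geometric ones. On Looijenga's cone the rule `σ ε(R) p_T(v) =
p_{σ(R ∩ T)}(σ v)` visibly is an action (`looAct`). The facets partition this cone and correspond to
the Coxeter complex (`facetsPartition`). Once every element of the monoid is known to map each facet
into a single facet, it induces a map on the Coxeter complex, and the axioms of an action come for
free. So the formula has to be checked only for one idempotent `ε(R(Θ))` and one facet of type `J`
translated by `a₁ a₂ x c₁ c₂`. There `R(Θ) ∩ x R(J^∞) = R(Ξ)` (`Rf_inter`), and `x c₁ v`, read
modulo the span of the `h i` with `i ∈ Ξ`, is dominant for `Ξ^⊥`, the simple roots of `Ξ^⊥`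
vanishing on it being those in `c₁ J⁰` (`Decomp2.isFacetPt`).

Faces are controlled by coroots. The special sets are precisely the supports of nonnegative `c` with
`∑ c i • h i` antidominant (`exists_isAnti`, `IsAnti.isSpecial`). Such a vector is nonnegative on
the Tits cone `X`, and `R(Θ)` is its zero set in `X` (`IsAnti.mem_specialFace`). Hence `R(Θ)` is a
face, and an intersection of two such faces is the zero set of a sum. A minimality argument shows
that every face is a translate of some `R(Θ)` (`exists_eq_smul_Rf`).

Facets are separated by dominance: a point has a dominant translate when only finitely many positive
roots are negative on it (`RootRep.exists_dominant`), and this translate is unique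
(`RootRep.ν_eq_self_of_dom`). A set of simple roots vanishing at an interior point of the Tits cone
in `V` is of finite type (`fin_eq_of_mem_interior`). The link between finite type and finite
parabolic subgroups is the sum of the positive roots in one direction and a positive definite
invariant form in the other.

An element `σ ε(R)` preserves the type of a facet exactly when `R` contains the face of that facet
(`cellAct_wε_eq`). This yields the stabilizers and the faithfulness. Preservation of the order is a
comparison of index sets (`Decomp2.actIndex_subset`).

Good action 1 arises in the same way from the closed facets of `X` and `S ↦ σ(R ∩ S)`. The two
actions already differ on a chamber `s i W_∅`: in the first formula `s i` is the factor `y` and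
enlarges the type, in the second it is absorbed into `c₁`.

The Coxeter group theory underneath rests on the fact that the image of a simple root is positive or
negative according to length (`RootRep.pos_of_len_le`). It is proved once for roots and coroots
together, by means of `RootRep`. -/

theorem s_apply (i : I) (v : V) : (D.s i).1 v = v - D.α i v • D.h i := rfl

theorem W_mul_apply (w u : D.W) (v : V) : (w * u).1 v = w.1 (u.1 v) := rfl

theorem W_one_apply (v : V) : (1 : D.W).1 v = v := rfl

theorem W_inv_apply_self (w : D.W) (v : V) : (w⁻¹).1 (w.1 v) = v := by
  rw [← W_mul_apply, inv_mul_cancel, W_one_apply]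

theorem W_apply_inv_self (w : D.W) (v : V) : w.1 ((w⁻¹).1 v) = v := by
  rw [← W_mul_apply, mul_inv_cancel, W_one_apply]

theorem W_ext {w u : D.W} (h : ∀ v, w.1 v = u.1 v) : w = u :=
  Subtype.ext (LinearEquiv.ext h)

theorem s_mul_s (i : I) : D.s i * D.s i = 1 := by
  refine W_ext fun v => ?_
  rw [W_mul_apply, s_apply, s_apply, W_one_apply, map_sub, map_smul, pairing_self]
  module

theorem s_inv (i : I) : (D.s i)⁻¹ = D.s i := inv_eq_of_mul_eq_one_left (s_mul_s i)

theorem mul_s_mul_s (w : D.W) (i : I) : w * D.s i * D.s i = w := by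
  rw [mul_assoc, s_mul_s, mul_one]

theorem s_mul_s_mul (w : D.W) (i : I) : D.s i * (D.s i * w) = w := by
  rw [← mul_assoc, s_mul_s, one_mul]

theorem prod_reverse_word (l : List I) : (l.reverse.map D.s).prod = ((l.map D.s).prod)⁻¹ := by
  induction l with
  | nil => simp
  | cons i l ih =>
    rw [List.reverse_cons, List.map_append, List.prod_append, ih]
    simp [s_inv]

theorem exists_word_of_mem_par {J : Set I} {w : D.W} (hw : w ∈ D.par J) :
    ∃ l : List I, (∀ i ∈ l, i ∈ J) ∧ D.IsWord w l := by
  induction hw using Subgroup.closure_induction with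
  | mem x hx =>
    obtain ⟨i, hi, rfl⟩ := hx
    exact ⟨[i], by simpa using hi, by simp [IsWord]⟩
  | one => exact ⟨[], by simp, by simp [IsWord]⟩
  | mul x y _ _ hx hy =>
    obtain ⟨l, hl, hl'⟩ := hx
    obtain ⟨k, hk, hk'⟩ := hy
    refine ⟨l ++ k, fun i hi => ?_, ?_⟩
    · rcases List.mem_append.1 hi with h | h
      exacts [hl i h, hk i h]
    · unfold IsWord at *
      rw [List.map_append, List.prod_append, hl', hk']
  | inv x _ hx =>
    obtain ⟨l, hl, hl'⟩ := hx
    refine ⟨l.reverse, fun i hi => hl i (List.mem_reverse.1 hi), ?_⟩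
    unfold IsWord at *
    rw [prod_reverse_word, hl']

theorem s_mem_par {J : Set I} {i : I} (hi : i ∈ J) : D.s i ∈ D.par J :=
  Subgroup.subset_closure ⟨i, hi, rfl⟩

theorem word_mem_par {J : Set I} {w : D.W} {l : List I} (hl : D.IsWord w l)
    (h : ∀ i ∈ l, i ∈ J) : w ∈ D.par J := by
  rw [← hl]
  refine Subgroup.list_prod_mem _ fun x hx => ?_
  obtain ⟨i, hi, rfl⟩ := List.mem_map.1 hx
  exact s_mem_par (h i hi)

theorem par_mono {J K : Set I} (h : J ⊆ K) : D.par J ≤ D.par K :=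
  Subgroup.closure_mono (Set.image_mono h)

theorem exists_word (w : D.W) : ∃ l : List I, D.IsWord w l := by
  obtain ⟨w, hw⟩ := w
  have : ∃ l : List I, ((l.map D.s).prod : D.W).1 = w := by
    induction hw using Subgroup.closure_induction with
    | mem x hx =>
      obtain ⟨i, rfl⟩ := hx
      exact ⟨[i], by simp [s]⟩
    | one => exact ⟨[], by simp⟩
    | mul x y _ _ hx hy =>
      obtain ⟨l, rfl⟩ := hx
      obtain ⟨k, rfl⟩ := hy
      exact ⟨l ++ k, by simp⟩
    | inv x _ hx =>
      obtain ⟨l, rfl⟩ := hx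
      exact ⟨l.reverse, by rw [prod_reverse_word]; rfl⟩
  obtain ⟨l, hl⟩ := this
  exact ⟨l, Subtype.ext hl⟩

theorem par_univ : D.par Set.univ = ⊤ := by
  refine eq_top_iff.2 fun w _ => ?_
  obtain ⟨l, hl⟩ := exists_word w
  exact word_mem_par hl fun _ _ => trivial

theorem exists_reduced (w : D.W) : ∃ l : List I, D.IsWord w l ∧ l.length = D.len w := by
  obtain ⟨l, hl⟩ := exists_word w
  exact Nat.sInf_mem (s := {n | ∃ l : List I, D.IsWord w l ∧ l.length = n}) ⟨_, l, hl, rfl⟩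

theorem len_le {w : D.W} {l : List I} (hl : D.IsWord w l) : D.len w ≤ l.length :=
  Nat.sInf_le ⟨l, hl, rfl⟩

theorem len_one : D.len 1 = 0 := Nat.le_zero.1 (len_le (l := []) (by simp [IsWord]))

theorem len_s_le (i : I) : D.len (D.s i) ≤ 1 := len_le (l := [i]) (by simp [IsWord])

theorem eq_one_of_len {w : D.W} (h : D.len w = 0) : w = 1 := by
  obtain ⟨l, hl, hl'⟩ := exists_reduced w
  rw [h] at hl'
  rw [List.length_eq_zero_iff.1 hl'] at hl
  simpa [IsWord] using hl.symm

theorem len_mul_le (w u : D.W) : D.len (w * u) ≤ D.len w + D.len u := by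
  obtain ⟨l, hl, hl'⟩ := exists_reduced w
  obtain ⟨k, hk, hk'⟩ := exists_reduced u
  rw [← hl', ← hk', ← List.length_append]
  refine len_le ?_
  unfold IsWord at *
  rw [List.map_append, List.prod_append, hl, hk]

theorem len_inv_le (w : D.W) : D.len w⁻¹ ≤ D.len w := by
  obtain ⟨l, hl, hl'⟩ := exists_reduced w
  rw [← hl', ← List.length_reverse]
  refine len_le ?_
  unfold IsWord at *
  rw [prod_reverse_word, hl]

theorem len_inv (w : D.W) : D.len w⁻¹ = D.len w :=
  le_antisymm (len_inv_le w) (by simpa using len_inv_le w⁻¹)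

theorem len_mul_s_le (w : D.W) (i : I) : D.len (w * D.s i) ≤ D.len w + 1 :=
  (len_mul_le _ _).trans (Nat.add_le_add_left (len_s_le i) _)

theorem len_le_mul_s (w : D.W) (i : I) : D.len w ≤ D.len (w * D.s i) + 1 := by
  simpa [mul_s_mul_s] using len_mul_s_le (w * D.s i) i

theorem exists_eq_mul_s {w : D.W} (hw : w ≠ 1) :
    ∃ u i, w = u * D.s i ∧ D.len w = D.len u + 1 := by
  obtain ⟨l, hl, hl'⟩ := exists_reduced w
  obtain rfl | ⟨k, i, rfl⟩ := List.eq_nil_or_concat l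
  · exact absurd (by simpa [IsWord] using hl.symm) hw
  refine ⟨(k.map D.s).prod, i, ?_, ?_⟩
  · rw [← hl]; simp
  · have h1 := len_le (D := D) (l := k) rfl
    have h2 := len_mul_s_le (k.map D.s).prod i
    have h3 : (k.map D.s).prod * D.s i = w := by rw [← hl]; simp
    rw [h3] at h2
    simp at hl'
    omega

theorem mem_minL_iff_inv {K : Set I} {w : D.W} : w ∈ D.minL K ↔ w⁻¹ ∈ D.minR K := by
  constructor
  · intro h u hu
    have := h u⁻¹ (inv_mem hu)
    rwa [← len_inv (u⁻¹ * w), mul_inv_rev, inv_inv, ← len_inv w] at this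
  · intro h u hu
    have := h u⁻¹ (inv_mem hu)
    rwa [← mul_inv_rev, len_inv, len_inv] at this

/-! ### Alternating products of two simple reflections -/

/-- The alternating product `⋯ s i * s j` with `n` factors. -/
def alt (D : KMDatum I V) (i j : I) : ℕ → D.W
  | 0 => 1
  | n + 1 => (if Even n then D.s j else D.s i) * D.alt i j n

theorem alt_succ (i j : I) (n : ℕ) :
    D.alt i j (n + 1) = (if Even n then D.s j else D.s i) * D.alt i j n := rfl

theorem alt_succ_right (i j : I) (n : ℕ) : D.alt i j (n + 1) = D.alt j i n * D.s j := by
  induction n with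
  | zero => simp [alt]
  | succ n ih =>
    rw [alt_succ, ih, alt_succ, mul_assoc]
    congr 1
    simp only [Nat.even_add_one]
    split_ifs <;> rfl

theorem len_alt_le (i j : I) (n : ℕ) : D.len (D.alt i j n) ≤ n := by
  induction n generalizing i j with
  | zero => simp [alt, len_one]
  | succ n ih =>
    rw [alt_succ_right]
    exact (len_mul_s_le _ _).trans (Nat.succ_le_succ (ih j i))

theorem alt_add (i j : I) (m n : ℕ) : ∃ x, D.len x ≤ n ∧ D.alt i j (m + n) = x * D.alt i j m := by
  induction n with
  | zero => exact ⟨1, by simp [len_one], by simp⟩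
  | succ n ih =>
    obtain ⟨x, hx, h⟩ := ih
    rw [← add_assoc, alt_succ, h]
    refine ⟨(if Even (m + n) then D.s j else D.s i) * x, ?_, (mul_assoc _ _ _).symm⟩
    refine (len_mul_le _ _).trans ?_
    have : D.len (if Even (m + n) then D.s j else D.s i) ≤ 1 := by
      split_ifs <;> exact len_s_le _
    omega

/-- The rightmost `m` letters can be replaced by the alternating word that ends in `s i`, which then
cancels. -/
theorem len_alt_mul_s {i j : I} {m n : ℕ} (hm : D.alt i j m = D.alt j i m) (h1 : 1 ≤ m)
    (hn : m ≤ n) : D.len (D.alt i j n * D.s i) + 1 ≤ n := by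
  obtain ⟨k, rfl⟩ := Nat.exists_eq_add_of_le hn
  obtain ⟨x, hx, h⟩ := D.alt_add i j m k
  obtain ⟨m, rfl⟩ := Nat.exists_eq_add_of_le' h1
  rw [h, hm, alt_succ_right, mul_assoc, mul_s_mul_s]
  have := len_mul_le x (D.alt i j m)
  have := D.len_alt_le i j m
  omega

theorem A_eq_zero_iff (i j : I) : D.A i j = 0 ↔ D.A j i = 0 :=
  ⟨D.zero_symm i j, D.zero_symm j i⟩

theorem offDiag_cases {i j : I} (hij : i ≠ j) (h : D.A i j * D.A j i < 4) :
    (D.A i j = 0 ∧ D.A j i = 0) ∨ (D.A i j = -1 ∧ D.A j i = -1) ∨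
    (D.A i j = -1 ∧ D.A j i = -2) ∨ (D.A i j = -2 ∧ D.A j i = -1) ∨
    (D.A i j = -1 ∧ D.A j i = -3) ∨ (D.A i j = -3 ∧ D.A j i = -1) := by
  have h1 := D.offDiag i j hij
  have h2 := D.offDiag j i hij.symm
  have h3 := D.A_eq_zero_iff i j
  generalize D.A i j = x at *
  generalize D.A j i = y at *
  rcases eq_or_ne x 0 with rfl | hx
  · simp_all
  have hy : y ≠ 0 := fun h => hx (h3.2 h)
  have hx1 : x ≤ -1 := by omega
  have hy1 : y ≤ -1 := by omega
  have : -3 ≤ x := by nlinarith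
  have : -3 ≤ y := by nlinarith
  interval_cases x <;> interval_cases y <;> simp_all

/-- The number `m` with `(s i * s j) ^ m = 1`, in the cases where it is finite. -/
def braid (D : KMDatum I V) (i j : I) : ℕ :=
  if D.A i j * D.A j i = 0 then 2 else if D.A i j * D.A j i = 1 then 3
  -- The value `6` is meant for the product `3`. For products of at least `4` it is a junk value,
  -- and the braid relation is used only below `4`.
  else if D.A i j * D.A j i = 2 then 4 else 6

theorem one_le_braid (i j : I) : 1 ≤ D.braid i j := by
  unfold braid; split_ifs <;> omega

/-- A direct calculation in each of the six possible rank two cases: both sides send `v` to the same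
combination of `v`, `h i` and `h j`. -/
theorem alt_braid {i j : I} (hij : i ≠ j) (h : D.A i j * D.A j i < 4) :
    D.alt i j (D.braid i j) = D.alt j i (D.braid i j) := by
  refine W_ext fun v => ?_
  have hi := D.pairing_self i
  have hj := D.pairing_self j
  have h1 := D.pairing i j
  have h2 := D.pairing j i
  rcases offDiag_cases hij h with ⟨ha, hb⟩ | ⟨ha, hb⟩ | ⟨ha, hb⟩ | ⟨ha, hb⟩ | ⟨ha, hb⟩ | ⟨ha, hb⟩ <;>
  · simp only [braid, ha, hb]
    rw [ha] at h1
    rw [hb] at h2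
    norm_num at h1 h2
    norm_num [alt, Nat.even_iff, W_mul_apply, s_apply, h1, h2, hi, hj]
    try module

end KMDatum

/-! ### Positivity of roots and coroots. -/

namespace KMDatum

open Finset

variable {I V : Type*} [Fintype I] [NormedAddCommGroup V] [NormedSpace ℝ V]
variable {D : KMDatum I V}

/-! ### Root representations -/

/-- A pair of contragredient representations of the Weyl group on spaces `M`, `N` in which the
simple reflections act as reflections given by simple roots `a i` in `M` and simple coroots
`b i` in `N`. Both `(V^*, V)` and `(V, V^*)` are of this form. -/
structure RootRep (D : KMDatum I V) (M N : Type*) [AddCommGroup M] [Module ℝ M]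
    [AddCommGroup N] [Module ℝ N] where
  B : I → I → ℤ
  pair : M →ₗ[ℝ] N →ₗ[ℝ] ℝ
  ρ : D.W →* Module.End ℝ M
  ν : D.W →* Module.End ℝ N
  a : I → M
  b : I → N
  a_indep : LinearIndependent ℝ a
  pair_ab : ∀ i j, pair (a j) (b i) = B i j
  ρ_s : ∀ i m, ρ (D.s i) m = m - pair m (b i) • a i
  ν_s : ∀ i n, ν (D.s i) n = n - pair (a i) n • b i
  B_diag : ∀ i, B i i = 2
  B_offDiag : ∀ i j, i ≠ j → B i j ≤ 0
  -- This is needed only in rank two, where nonnegativity of coefficients is compared with the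
  -- entries of `A`. The finite list of cases there is stable under transposition.
  B_cases : (∀ i j, B i j = D.A i j) ∨ ∀ i j, B i j = D.A j i

/-- The Weyl group as a group of endomorphisms of `V`. -/
def Vrep (D : KMDatum I V) : D.W →* Module.End ℝ V where
  toFun w := (w.1 : V →ₗ[ℝ] V)
  map_one' := rfl
  map_mul' _ _ := rfl

/-- The Weyl group as a group of endomorphisms of the dual of `V`. -/
def dualRep (D : KMDatum I V) : D.W →* Module.End ℝ (Module.Dual ℝ V) where
  toFun w := (D.dact w : Module.Dual ℝ V →ₗ[ℝ] Module.Dual ℝ V)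
  map_one' := LinearMap.ext fun l => D.dact_one l
  map_mul' w u := LinearMap.ext fun l => D.dact_mul w u l

theorem dact_s (i : I) (l : Module.Dual ℝ V) :
    D.dact (D.s i) l = l - l (D.h i) • D.α i := by
  ext v
  rw [dact_apply, s_inv, s_apply, map_sub, map_smul]
  simp [mul_comm]

/-- The roots in the dual of `V`, acting on points of `V`. -/
def roots (D : KMDatum I V) : RootRep D (Module.Dual ℝ V) V where
  B := D.A
  pair := LinearMap.id
  ρ := D.dualRep
  ν := D.Vrep
  a := D.α
  b := D.h
  a_indep := D.α_indep
  pair_ab := D.pairing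
  ρ_s := dact_s
  ν_s := s_apply
  B_diag := D.diag
  B_offDiag := D.offDiag
  B_cases := Or.inl fun _ _ => rfl

/-- The coroots in `V`, acting on points of the dual of `V`. -/
def coroots (D : KMDatum I V) : RootRep D V (Module.Dual ℝ V) where
  B i j := D.A j i
  pair := Module.Dual.eval ℝ V
  ρ := D.Vrep
  ν := D.dualRep
  a := D.h
  b := D.α
  a_indep := D.h_indep
  pair_ab i j := D.pairing j i
  ρ_s := s_apply
  ν_s := dact_s
  B_diag := D.diag
  B_offDiag i j hij := D.offDiag j i hij.symm
  B_cases := Or.inr fun _ _ => rfl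

namespace RootRep

variable {M N : Type*} [AddCommGroup M] [Module ℝ M] [AddCommGroup N] [Module ℝ N]
variable (P : RootRep D M N)

theorem ρ_mul (w u : D.W) (m : M) : P.ρ (w * u) m = P.ρ w (P.ρ u m) := by
  rw [map_mul]; rfl

theorem ν_mul (w u : D.W) (n : N) : P.ν (w * u) n = P.ν w (P.ν u n) := by
  rw [map_mul]; rfl

theorem ρ_one (m : M) : P.ρ 1 m = m := by rw [map_one]; rfl

theorem ν_one (n : N) : P.ν 1 n = n := by rw [map_one]; rfl

theorem ρ_inv_self (w : D.W) (m : M) : P.ρ w⁻¹ (P.ρ w m) = m := by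
  rw [← ρ_mul, inv_mul_cancel, ρ_one]

theorem ρ_self_inv (w : D.W) (m : M) : P.ρ w (P.ρ w⁻¹ m) = m := by
  rw [← ρ_mul, mul_inv_cancel, ρ_one]

theorem ν_inv_self (w : D.W) (n : N) : P.ν w⁻¹ (P.ν w n) = n := by
  rw [← ν_mul, inv_mul_cancel, ν_one]

theorem ν_self_inv (w : D.W) (n : N) : P.ν w (P.ν w⁻¹ n) = n := by
  rw [← ν_mul, mul_inv_cancel, ν_one]

theorem ρ_s_a (i j : I) : P.ρ (D.s i) (P.a j) = P.a j - (P.B i j : ℝ) • P.a i := by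
  rw [ρ_s, pair_ab]

theorem ρ_s_a_self (i : I) : P.ρ (D.s i) (P.a i) = -P.a i := by
  rw [ρ_s_a, B_diag]; push_cast; module

theorem pair_s (i : I) (m : M) (n : N) :
    P.pair (P.ρ (D.s i) m) (P.ν (D.s i) n) = P.pair m n := by
  have := P.pair_ab i i
  rw [B_diag] at this
  simp only [ρ_s, ν_s, map_sub, map_smul, LinearMap.sub_apply, LinearMap.smul_apply, this,
    smul_eq_mul]
  push_cast
  ring

theorem pair_ρ_ν (w : D.W) (m : M) (n : N) : P.pair (P.ρ w m) (P.ν w n) = P.pair m n := by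
  obtain ⟨l, rfl⟩ := exists_word w
  induction l with
  | nil => simp
  | cons i l ih => rw [List.map_cons, List.prod_cons, ρ_mul, ν_mul, pair_s, ih]

theorem pair_ν (w : D.W) (m : M) (n : N) : P.pair m (P.ν w n) = P.pair (P.ρ w⁻¹ m) n := by
  rw [← P.pair_ρ_ν w (P.ρ w⁻¹ m), ρ_self_inv]

/-! ### Positivity -/

/-- Nonnegative integral combinations of the simple roots `a i` with `i ∈ J`. -/
def PosOn (J : Set I) (m : M) : Prop :=
  ∃ c : I → ℕ, (∀ i ∉ J, c i = 0) ∧ m = ∑ i, (c i : ℝ) • P.a i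

/-- Nonnegative integral combinations of the simple roots. -/
abbrev Pos (m : M) : Prop := P.PosOn Set.univ m

variable {P}

theorem PosOn.add {J : Set I} {m n : M} (hm : P.PosOn J m) (hn : P.PosOn J n) :
    P.PosOn J (m + n) := by
  obtain ⟨c, h1, rfl⟩ := hm
  obtain ⟨d, h3, rfl⟩ := hn
  refine ⟨c + d, fun i hi => by simp [h1 i hi, h3 i hi], ?_⟩
  simp [add_smul, sum_add_distrib]

theorem PosOn.nsmul {J : Set I} {m : M} (hm : P.PosOn J m) (k : ℕ) :
    P.PosOn J ((k : ℝ) • m) := by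
  obtain ⟨c, h1, rfl⟩ := hm
  refine ⟨k • c, fun i hi => by simp [h1 i hi], ?_⟩
  simp [smul_sum, mul_smul]

variable (P) in
theorem posOn_a {J : Set I} {i : I} (hi : i ∈ J) : P.PosOn J (P.a i) := by
  classical
  refine ⟨Pi.single i 1, fun j hj => ?_, ?_⟩
  · rw [Pi.single_eq_of_ne]; rintro rfl; exact hj hi
  · rw [sum_eq_single i] <;> simp +contextual

variable (P) in
theorem coeff_unique {c d : I → ℝ} (h : ∑ i, c i • P.a i = ∑ i, d i • P.a i) : c = d := by
  have := Fintype.linearIndependent_iff.1 P.a_indep (fun i => c i - d i)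
    (by simp [sub_smul, sum_sub_distrib, h])
  exact funext fun i => sub_eq_zero.1 (this i)

variable (P) in
theorem sum_eq_zero_coeff {c : I → ℝ} (h : ∑ i, c i • P.a i = 0) : c = 0 :=
  P.coeff_unique (by simpa using h)

theorem Pos.eq_zero {m : M} (h : P.Pos m) (h' : P.Pos (-m)) : m = 0 := by
  obtain ⟨c, -, rfl⟩ := h
  obtain ⟨d, -, h⟩ := h'
  have h1 : ∑ i, ((c i : ℝ) + d i) • P.a i = 0 := by
    simp only [add_smul, sum_add_distrib, ← h]; simp
  have h2 := P.sum_eq_zero_coeff h1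
  refine sum_eq_zero fun i _ => ?_
  have := congrFun h2 i
  have : (c i : ℝ) = 0 := by
    have h3 : (0 : ℝ) ≤ c i := Nat.cast_nonneg _
    have h4 : (0 : ℝ) ≤ d i := Nat.cast_nonneg _
    have h5 : (c i : ℝ) + d i = 0 := this
    linarith
  simp [this]

variable (P)

theorem a_ne_zero (i : I) : P.a i ≠ 0 := P.a_indep.ne_zero i

theorem ρ_injective (w : D.W) : Function.Injective (P.ρ w) :=
  Function.LeftInverse.injective (P.ρ_inv_self w)

theorem ρ_a_ne_zero (w : D.W) (i : I) : P.ρ w (P.a i) ≠ 0 := fun h =>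
  P.a_ne_zero i (P.ρ_injective w (by rw [h, map_zero]))

/-- The coefficients of the images of a simple root under alternating products. -/
def altCoeff (x y : ℤ) : ℕ → ℤ × ℤ
  | 0 => (1, 0)
  | n + 1 =>
    if n % 2 = 0 then ((altCoeff x y n).1, -y * (altCoeff x y n).1 - (altCoeff x y n).2)
    else (-x * (altCoeff x y n).2 - (altCoeff x y n).1, (altCoeff x y n).2)

theorem ρ_alt_a (i j : I) (n : ℕ) :
    P.ρ (D.alt i j n) (P.a i) = ((altCoeff (P.B i j) (P.B j i) n).1 : ℝ) • P.a i +
      ((altCoeff (P.B i j) (P.B j i) n).2 : ℝ) • P.a j := by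
  induction n with
  | zero => simp [alt, altCoeff]
  | succ n ih =>
    rw [alt_succ, ρ_mul, ih, altCoeff]
    simp only [Nat.even_iff]
    split_ifs
    · rw [map_add, map_smul, map_smul, ρ_s_a_self, ρ_s_a]
      push_cast
      module
    · rw [map_add, map_smul, map_smul, ρ_s_a_self, ρ_s_a]
      push_cast
      module

/-- The third conjunct strengthens the induction: the coefficient about to be changed is at most
half of the term from which it is subtracted. The new coefficient is then at least the other half,
and `x * y ≥ 4` turns this into the same bound for the next step. -/
theorem altCoeff_nonneg_of_le {x y : ℤ} (hx : x ≤ 0) (hy : y ≤ 0) (h : 4 ≤ x * y) (n : ℕ) :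
    0 ≤ (altCoeff x y n).1 ∧ 0 ≤ (altCoeff x y n).2 ∧
      if n % 2 = 0 then 2 * (altCoeff x y n).2 ≤ -y * (altCoeff x y n).1
      else 2 * (altCoeff x y n).1 ≤ -x * (altCoeff x y n).2 := by
  induction n with
  | zero => simpa [altCoeff] using hy
  | succ n ih =>
    obtain ⟨hp, hq, h2⟩ := ih
    rw [altCoeff]
    rcases Nat.mod_two_eq_zero_or_one n with hn | hn
    · simp only [hn, if_true, Nat.succ_mod_two_eq_zero_iff, zero_ne_one, if_false] at h2 ⊢
      exact ⟨hp, by linarith, by nlinarith⟩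
    · simp only [hn, if_true, Nat.succ_mod_two_eq_zero_iff, one_ne_zero, if_false] at h2 ⊢
      exact ⟨by linarith, hq, by nlinarith⟩

theorem altCoeff_nonneg (i j : I) (hij : i ≠ j) {n : ℕ}
    (h : D.A i j * D.A j i < 4 → n < D.braid i j) :
    0 ≤ (altCoeff (P.B i j) (P.B j i) n).1 ∧ 0 ≤ (altCoeff (P.B i j) (P.B j i) n).2 := by
  by_cases h4 : D.A i j * D.A j i < 4
  · have hn := h h4
    have key : (P.B i j = D.A i j ∧ P.B j i = D.A j i) ∨
        (P.B i j = D.A j i ∧ P.B j i = D.A i j) := by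
      rcases P.B_cases with h | h
      · exact Or.inl ⟨h _ _, h _ _⟩
      · exact Or.inr ⟨h _ _, h _ _⟩
    rcases offDiag_cases hij h4 with
        ⟨ha, hb⟩ | ⟨ha, hb⟩ | ⟨ha, hb⟩ | ⟨ha, hb⟩ | ⟨ha, hb⟩ | ⟨ha, hb⟩ <;>
      rw [ha, hb] at key <;> norm_num [braid, ha, hb] at hn <;>
      rcases key with ⟨hx, hy⟩ | ⟨hx, hy⟩ <;> rw [hx, hy] <;> interval_cases n <;> decide
  · have h' : 4 ≤ P.B i j * P.B j i := by
      rcases P.B_cases with h | h <;> rw [h, h]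
      · exact not_lt.1 h4
      · rw [mul_comm]; exact not_lt.1 h4
    have := altCoeff_nonneg_of_le (P.B_offDiag i j hij) (P.B_offDiag j i hij.symm) h' n
    exact ⟨this.1, this.2.1⟩

/-- If `w` is not shortened by `s i` on the right then `w` maps the simple root `a i` to a
positive root. -/
theorem pos_of_len_le {w : D.W} {i : I} (h : D.len w ≤ D.len (w * D.s i)) :
    P.Pos (P.ρ w (P.a i)) := by
  classical
  induction hn : D.len w using Nat.strong_induction_on generalizing w i with
  | _ N ih =>
  subst hn
  rcases eq_or_ne w 1 with rfl | hw
  · rw [ρ_one]; exact P.posOn_a trivial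
  obtain ⟨u, j, rfl, hu⟩ := exists_eq_mul_s hw
  have hij : i ≠ j := by
    rintro rfl
    rw [mul_s_mul_s] at h
    omega
  set w := u * D.s j with hwdef
  -- Split off from the right of `w` the longest alternating word in `s i`, `s j` for which lengths
  -- add. The remaining factor `v` is shorter than `w`, and the question is reduced to rank two.
  let S : ℕ → Prop := fun n => ∃ v, w = v * D.alt i j n ∧ D.len v + n = D.len w
  have hS1 : S 1 := ⟨u, by simp [alt, hwdef], hu.symm⟩
  obtain ⟨n, hn, hmax⟩ : ∃ n, S n ∧ ∀ m, S m → m ≤ n := by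
    have hb : ∀ m, S m → m ≤ D.len w := by
      rintro m ⟨v, -, h⟩; omega
    exact ⟨Nat.findGreatest S (D.len w), Nat.findGreatest_spec (hb 1 hS1) hS1,
      fun m hm => Nat.le_findGreatest (hb m hm) hm⟩
  have hn1 := hmax 1 hS1
  obtain ⟨v, hv, hvl⟩ := hn
  obtain ⟨n, rfl⟩ := Nat.exists_eq_add_of_le' hn1
  -- Suppose `s k` shortens `v`. If `k` is the first letter of the split-off word, cancelling it
  -- would make `w` too short. Otherwise `s k` prolongs the alternating word, against maximality.
  have hup : ∀ k, (k = i ∨ k = j) → D.len v ≤ D.len (v * D.s k) := by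
    intro k hk
    by_contra! hlt
    have hlt' := len_le_mul_s v k
    by_cases hk' : k = if Even n then j else i
    · have : w = v * D.s k * D.alt i j n := by
        rw [hv, alt_succ, mul_assoc, hk']
        split_ifs <;> rfl
      have h1 := len_mul_le (v * D.s k) (D.alt i j n)
      have h2 := D.len_alt_le i j n
      rw [← this] at h1
      omega
    · have : S (n + 2) := by
        refine ⟨v * D.s k, ?_, by omega⟩
        have : (if Even (n + 1) then D.s j else D.s i) = D.s k := by
          simp only [Nat.even_add_one]
          split_ifs at hk' ⊢ <;> rcases hk with rfl | rfl <;> simp_all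
        rw [alt_succ i j (n + 1), this, mul_assoc, s_mul_s_mul, hv]
      have := hmax _ this
      omega
  have hvi := ih (D.len v) (by omega) (hup i (Or.inl rfl)) rfl
  have hvj := ih (D.len v) (by omega) (hup j (Or.inr rfl)) rfl
  -- A split-off word as long as the braid relation would be shortened by `s i`, and with it `w`.
  have hlt : D.A i j * D.A j i < 4 → n + 1 < D.braid i j := by
    intro h4
    by_contra! hge
    have h1 := len_alt_mul_s (alt_braid hij h4) (one_le_braid i j) hge
    have h2 := len_mul_le v (D.alt i j (n + 1) * D.s i)
    rw [← mul_assoc, ← hv] at h2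
    omega
  obtain ⟨hp, hq⟩ := P.altCoeff_nonneg i j hij hlt
  have heq := P.ρ_alt_a i j (n + 1)
  generalize (altCoeff (P.B i j) (P.B j i) (n + 1)).1 = p at *
  generalize (altCoeff (P.B i j) (P.B j i) (n + 1)).2 = q at *
  lift p to ℕ using hp
  lift q to ℕ using hq
  rw [hv, ρ_mul, heq, map_add, map_smul, map_smul]
  exact (hvi.nsmul p).add (hvj.nsmul q)

theorem neg_of_len_lt {w : D.W} {i : I} (h : D.len (w * D.s i) < D.len w) :
    P.Pos (-P.ρ w (P.a i)) := by
  have := P.pos_of_len_le (w := w * D.s i) (i := i) (by rw [mul_s_mul_s]; exact h.le)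
  rwa [ρ_mul, ρ_s_a_self, map_neg] at this

theorem pos_or_neg (w : D.W) (i : I) : P.Pos (P.ρ w (P.a i)) ∨ P.Pos (-P.ρ w (P.a i)) := by
  rcases le_or_gt (D.len w) (D.len (w * D.s i)) with h | h
  · exact Or.inl (P.pos_of_len_le h)
  · exact Or.inr (P.neg_of_len_lt h)

theorem not_pos_and_neg {w : D.W} {i : I} (h : P.Pos (P.ρ w (P.a i)))
    (h' : P.Pos (-P.ρ w (P.a i))) : False := P.ρ_a_ne_zero w i (h.eq_zero h')

theorem len_le_iff_pos {w : D.W} {i : I} :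
    D.len w ≤ D.len (w * D.s i) ↔ P.Pos (P.ρ w (P.a i)) :=
  ⟨P.pos_of_len_le, fun h => by
    by_contra! hlt
    exact P.not_pos_and_neg h (P.neg_of_len_lt hlt)⟩

theorem len_lt_iff_neg {w : D.W} {i : I} :
    D.len (w * D.s i) < D.len w ↔ P.Pos (-P.ρ w (P.a i)) :=
  ⟨P.neg_of_len_lt, fun h => by
    by_contra! hlt
    exact P.not_pos_and_neg (P.pos_of_len_le hlt) h⟩

theorem len_mul_s_of_pos {w : D.W} {i : I} (h : P.Pos (P.ρ w (P.a i))) :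
    D.len (w * D.s i) = D.len w + 1 := by
  have h1 : D.len (w * D.s i * D.s i) < D.len (w * D.s i) := by
    rw [P.len_lt_iff_neg, ρ_mul, ρ_s_a_self, map_neg, neg_neg]
    exact h
  rw [mul_s_mul_s] at h1
  have := len_mul_s_le w i
  omega

theorem len_mul_s_of_neg {w : D.W} {i : I} (h : P.Pos (-P.ρ w (P.a i))) :
    D.len w = D.len (w * D.s i) + 1 := by
  have := (P.len_lt_iff_neg).2 h
  have := len_le_mul_s w i
  omega

theorem eq_one_of_pos {w : D.W} (h : ∀ i, P.Pos (P.ρ w (P.a i))) : w = 1 := by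
  by_contra hw
  obtain ⟨u, i, rfl, hu⟩ := exists_eq_mul_s hw
  have := P.len_mul_s_of_pos (h i)
  rw [mul_s_mul_s] at this
  omega

end RootRep

end KMDatum

/-! ### Exchange, parabolic subgroups and minimal coset representatives. -/

namespace KMDatum

open Finset

variable {I V : Type*} [Fintype I] [NormedAddCommGroup V] [NormedSpace ℝ V]
variable {D : KMDatum I V}

namespace RootRep

variable {M N : Type*} [AddCommGroup M] [Module ℝ M] [AddCommGroup N] [Module ℝ N]
variable (P : RootRep D M N)

/-! ### The exchange condition -/

/-- Roots have integral coefficients. Applying `w⁻¹` shows that `c` times such a coefficient is `1`.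
-/
theorem eq_one_of_smul {w : D.W} {i j : I} {c : ℕ} (h : P.ρ w (P.a j) = (c : ℝ) • P.a i) :
    c = 1 := by
  have h1 : P.a j = (c : ℝ) • P.ρ w⁻¹ (P.a i) := by
    rw [← map_smul, ← h, ρ_inv_self]
  have h2 : ∃ d : I → ℤ, P.ρ w⁻¹ (P.a i) = ∑ k, (d k : ℝ) • P.a k := by
    rcases P.pos_or_neg w⁻¹ i with ⟨d, -, hd⟩ | ⟨d, -, hd⟩
    · exact ⟨fun k => d k, by simpa using hd⟩
    · exact ⟨fun k => -d k, by rw [← neg_neg (P.ρ _ _), hd, ← sum_neg_distrib]; simp⟩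
  obtain ⟨d, hd⟩ := h2
  classical
  have h3 : ∑ k, (if k = j then (1 : ℝ) else 0) • P.a k = ∑ k, ((c : ℝ) * d k) • P.a k := by
    rw [hd] at h1
    simp only [smul_sum, smul_smul] at h1
    rw [← h1]; simp
  have h4 := congrFun (P.coeff_unique h3) j
  simp only [if_true] at h4
  have h5 : (c : ℤ) * d j = 1 := by exact_mod_cast h4.symm
  have := Int.eq_one_or_neg_one_of_mul_eq_one h5
  omega

/-- The reflection `s i` changes only the coefficient of `a i`. If the sign flips, all other
coefficients vanish, and the root is a multiple of `a i`, hence equal to it. -/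
theorem pos_s {w : D.W} {i j : I} (h : P.Pos (P.ρ w (P.a j))) (hne : P.ρ w (P.a j) ≠ P.a i) :
    P.Pos (P.ρ (D.s i) (P.ρ w (P.a j))) := by
  classical
  rw [← ρ_mul]
  refine (P.pos_or_neg _ _).resolve_right fun h' => hne ?_
  obtain ⟨c, -, hc⟩ := h
  obtain ⟨d, -, hd⟩ := h'
  rw [ρ_mul, ρ_s, hc] at hd
  set x := P.pair (∑ k, (c k : ℝ) • P.a k) (P.b i)
  have h1 : ∑ k, ((c k : ℝ) + d k) • P.a k = ∑ k, (if k = i then x else 0) • P.a k := by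
    simp only [add_smul, sum_add_distrib, ← hd]
    simp
  have h2 : ∀ k, k ≠ i → c k = 0 := by
    intro k hk
    have := congrFun (P.coeff_unique h1) k
    simp only [hk, if_false] at this
    have h3 : c k + d k = 0 := by exact_mod_cast this
    omega
  have h3 : P.ρ w (P.a j) = (c i : ℝ) • P.a i := by
    rw [hc, sum_eq_single i]
    · intro k _ hk; simp [h2 k hk]
    · simp
  rw [h3, P.eq_one_of_smul h3]
  simp

theorem pos_of_coeff {w : D.W} {i j : I} {c : I → ℝ} (h : P.ρ w (P.a i) = ∑ k, c k • P.a k)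
    (hj : 0 < c j) : P.Pos (P.ρ w (P.a i)) := by
  refine (P.pos_or_neg _ _).resolve_right fun ⟨d, _, hd⟩ => ?_
  have h1 : ∑ k, c k • P.a k = ∑ k, (-(d k : ℝ)) • P.a k := by
    rw [← h]; simp [← hd]
  have h2 := congrFun (P.coeff_unique h1) j
  have h3 : (0 : ℝ) ≤ d j := Nat.cast_nonneg _
  linarith

/-- The element `u s_j u⁻¹ s_i` fixes `a i` and changes every other `a k` by a multiple of `a i`
only. It therefore keeps all simple roots positive and must be trivial. -/
theorem mul_s_eq_s_mul {u : D.W} {i j : I} (h : P.ρ u (P.a j) = P.a i) :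
    u * D.s j = D.s i * u := by
  classical
  have key : u * D.s j * u⁻¹ * D.s i = 1 := by
    refine P.eq_one_of_pos fun k => ?_
    by_cases hk : k = i
    · subst hk
      have : P.ρ (u * D.s j * u⁻¹ * D.s k) (P.a k) = P.a k := by
        rw [ρ_mul, ρ_s_a_self, map_neg, ρ_mul, ← h, ρ_inv_self, ρ_mul, ρ_s_a_self]
        simp
      rw [this]
      exact P.posOn_a trivial
    · have : ∃ y : ℝ, P.ρ (u * D.s j * u⁻¹ * D.s i) (P.a k) = P.a k + y • P.a i := by
        rw [ρ_mul, ρ_mul, ρ_mul, P.ρ_s j, map_sub, map_smul, h, ρ_self_inv, ρ_s_a]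
        exact ⟨-(P.B i k : ℝ) - P.pair (P.ρ u⁻¹ (P.a k - (P.B i k : ℝ) • P.a i)) (P.b j),
          by module⟩
      obtain ⟨y, hy⟩ := this
      refine P.pos_of_coeff (j := k)
        (c := fun l => (if l = k then 1 else 0) + if l = i then y else 0) ?_ (by simp [hk])
      rw [hy]
      simp [add_smul, sum_add_distrib]
  have : u * D.s j * u⁻¹ = D.s i := by
    rw [← s_inv i]; exact eq_inv_of_mul_eq_one_left key
  rw [← this]; group

/-- Letting the letters act on `a i` from the right, the root turns negative at some letter `j`.
Just before, it equals `a j`, so `s i` can be carried up to that letter and cancels it. -/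
theorem exchange {l : List I} {i : I} (h : P.Pos (-P.ρ (l.map D.s).prod (P.a i))) :
    ∃ k : List I, k.Sublist l ∧ k.length + 1 = l.length ∧
      (l.map D.s).prod * D.s i = (k.map D.s).prod := by
  induction l with
  | nil =>
    exfalso
    refine P.not_pos_and_neg (w := 1) (i := i) ?_ (by simpa using h)
    rw [ρ_one]; exact P.posOn_a trivial
  | cons j l ih =>
    rcases P.pos_or_neg (l.map D.s).prod i with h1 | h1
    · refine ⟨l, List.sublist_cons_self _ _, rfl, ?_⟩
      have : P.ρ (l.map D.s).prod (P.a i) = P.a j := by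
        by_contra hne
        have := P.pos_s h1 hne
        rw [← ρ_mul] at this
        rw [List.map_cons, List.prod_cons] at h
        exact P.not_pos_and_neg this h
      rw [List.map_cons, List.prod_cons, mul_assoc, P.mul_s_eq_s_mul this, s_mul_s_mul]
    · obtain ⟨k, hk, hk', hk''⟩ := ih h1
      exact ⟨j :: k, hk.cons_cons j, by simp [hk'], by
        rw [List.map_cons, List.prod_cons, mul_assoc, hk'']; simp⟩

/-! ### Parabolic subgroups -/

theorem ρ_eq_add {J : Set I} {w : D.W} (hw : w ∈ D.par J) (m : M) :
    ∃ c : I → ℝ, (∀ i ∉ J, c i = 0) ∧ P.ρ w m = m + ∑ i, c i • P.a i := by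
  classical
  obtain ⟨l, hl, rfl⟩ := exists_word_of_mem_par hw
  clear hw
  induction l with
  | nil => exact ⟨0, by simp, by simp⟩
  | cons j l ih =>
    obtain ⟨c, hc, hc'⟩ := ih fun i hi => hl i (List.mem_cons_of_mem _ hi)
    rw [List.map_cons, List.prod_cons, ρ_mul, hc', ρ_s]
    set x := P.pair (m + ∑ i, c i • P.a i) (P.b j)
    refine ⟨fun i => c i - if i = j then x else 0, fun i hi => ?_, ?_⟩
    · have : i ≠ j := by rintro rfl; exact hi (hl i List.mem_cons_self)
      simp [hc i hi, this]
    · simp [sub_smul, sum_sub_distrib, add_sub_assoc]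

theorem Pos.posOn {J : Set I} {m : M} (h : P.Pos m) {c : I → ℝ} (hc : ∀ i ∉ J, c i = 0)
    (hm : m = ∑ i, c i • P.a i) : P.PosOn J m := by
  obtain ⟨d, -, hd⟩ := h
  refine ⟨d, fun i hi => ?_, hd⟩
  have := congrFun (P.coeff_unique (hd.symm.trans hm)) i
  rw [hc i hi] at this
  exact_mod_cast this

theorem posOn_of_mem_par {J : Set I} {w : D.W} (hw : w ∈ D.par J) {j : I} (hj : j ∈ J)
    (h : P.Pos (P.ρ w (P.a j))) : P.PosOn J (P.ρ w (P.a j)) := by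
  classical
  obtain ⟨c, hc, hc'⟩ := P.ρ_eq_add hw (P.a j)
  refine Pos.posOn P h (c := fun i => c i + if i = j then 1 else 0) (fun i hi => ?_) ?_
  · have : i ≠ j := by rintro rfl; exact hi hj
    simp [hc i hi, this]
  · rw [hc']; simp [add_smul, sum_add_distrib, add_comm]

theorem negOn_of_mem_par {J : Set I} {w : D.W} (hw : w ∈ D.par J) {j : I} (hj : j ∈ J)
    (h : P.Pos (-P.ρ w (P.a j))) : P.PosOn J (-P.ρ w (P.a j)) := by
  have h1 : P.ρ (w * D.s j) (P.a j) = -P.ρ w (P.a j) := by rw [ρ_mul, ρ_s_a_self, map_neg]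
  rw [← h1] at h ⊢
  exact P.posOn_of_mem_par (mul_mem hw (s_mem_par hj)) hj h

theorem pos_of_mem_par_of_notMem {J : Set I} {w : D.W} (hw : w ∈ D.par J) {i : I} (hi : i ∉ J) :
    P.Pos (P.ρ w (P.a i)) := by
  classical
  obtain ⟨c, hc, hc'⟩ := P.ρ_eq_add hw (P.a i)
  refine P.pos_of_coeff (j := i) (c := fun k => c k + if k = i then 1 else 0) ?_ ?_
  · rw [hc']; simp [add_smul, sum_add_distrib, add_comm]
  · simp [hc i hi]

end RootRep

/-- The deletion condition: reading the word letter by letter, a lengthening letter is kept, and a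
shortening one is dropped together with another letter by `RootRep.exchange`. -/
theorem exists_reduced_sublist (l : List I) :
    ∃ k : List I, k.Sublist l ∧ (k.map D.s).prod = (l.map D.s).prod ∧
      k.length = D.len (l.map D.s).prod := by
  induction l using List.reverseRecOn with
  | nil => exact ⟨[], by simp, rfl, by simp [len_one]⟩
  | append_singleton l i ih =>
    obtain ⟨k, hk, hk', hk''⟩ := ih
    rw [List.map_append, List.prod_append, List.map_singleton, List.prod_singleton]
    rcases D.roots.pos_or_neg (l.map D.s).prod i with h | h
    · refine ⟨k ++ [i], hk.append (List.Sublist.refl _), ?_, ?_⟩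
      · rw [List.map_append, List.prod_append, hk']; simp
      · rw [D.roots.len_mul_s_of_pos h, List.length_append, hk'']; rfl
    · rw [← hk'] at h
      obtain ⟨k', h1, h2, h3⟩ := D.roots.exchange h
      rw [hk'] at h h3
      refine ⟨k', (h1.trans hk).trans (List.sublist_append_left _ _), h3.symm, ?_⟩
      have := D.roots.len_mul_s_of_neg h
      omega

theorem exists_reduced_of_mem_par {J : Set I} {w : D.W} (hw : w ∈ D.par J) :
    ∃ l : List I, (∀ i ∈ l, i ∈ J) ∧ D.IsWord w l ∧ l.length = D.len w := by
  obtain ⟨l, hl, rfl⟩ := exists_word_of_mem_par hw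
  obtain ⟨k, hk, hk', hk''⟩ := exists_reduced_sublist (D := D) l
  exact ⟨k, fun i hi => hl i (hk.subset hi), hk', hk''⟩

/-- The last letter `j` of a reduced word makes `w` map the root of `j` to a negative root. Elements
of `W_J` do this only for `j ∈ J`. -/
theorem forall_mem_of_reduced {J : Set I} {w : D.W} (hw : w ∈ D.par J) {l : List I}
    (hl : D.IsWord w l) (hl' : l.length = D.len w) : ∀ i ∈ l, i ∈ J := by
  induction l using List.reverseRecOn generalizing w with
  | nil => simp
  | append_singleton l j ih =>
    have h1 : w * D.s j = (l.map D.s).prod := by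
      rw [← hl, List.map_append, List.prod_append]; simp [mul_s_mul_s]
    have h2 : D.len (w * D.s j) < D.len w := by
      rw [← hl', h1]
      refine (len_le (l := l) rfl).trans_lt ?_
      simp
    have hj : j ∈ J := by
      by_contra hj
      exact D.roots.not_pos_and_neg (D.roots.pos_of_mem_par_of_notMem hw hj)
        (D.roots.neg_of_len_lt h2)
    have h3 := D.roots.len_mul_s_of_neg (D.roots.neg_of_len_lt h2)
    intro i hi
    rcases List.mem_append.1 hi with h | h
    · refine ih (mul_mem hw (s_mem_par hj)) h1.symm ?_ i h
      simp at hl'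
      omega
    · rw [List.mem_singleton] at h
      rwa [h]

theorem red_subset_iff {J : Set I} {w : D.W} : D.red w ⊆ J ↔ w ∈ D.par J := by
  constructor
  · intro h
    obtain ⟨l, hl, hl'⟩ := exists_reduced w
    exact word_mem_par hl fun i hi => h ⟨l, hl, hl', hi⟩
  · rintro h i ⟨l, hl, hl', hi⟩
    exact forall_mem_of_reduced h hl hl' i hi

theorem mem_par_red (w : D.W) : w ∈ D.par (D.red w) := red_subset_iff.1 subset_rfl

theorem len_s (i : I) : D.len (D.s i) = 1 := by
  have := D.roots.len_mul_s_of_pos (w := 1) (i := i)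
    (by rw [RootRep.ρ_one]; exact D.roots.posOn_a trivial)
  rwa [one_mul, len_one] at this

theorem red_s (i : I) : D.red (D.s i) = {i} := by
  refine subset_antisymm (red_subset_iff.2 (s_mem_par rfl)) ?_
  rintro j rfl
  exact ⟨[j], by simp [IsWord], by simp [len_s], by simp⟩

theorem red_one : D.red 1 = ∅ :=
  Set.subset_empty_iff.1 (red_subset_iff.2 (one_mem _))

theorem s_mem_par_iff {J : Set I} {i : I} : D.s i ∈ D.par J ↔ i ∈ J := by
  rw [← red_subset_iff, red_s, Set.singleton_subset_iff]

theorem red_subset_mul_of_len {w u : D.W} (h : D.len (w * u) = D.len w + D.len u) :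
    D.red w ⊆ D.red (w * u) ∧ D.red u ⊆ D.red (w * u) := by
  constructor
  · rintro i ⟨l, hl, hl', hi⟩
    obtain ⟨k, hk, hk'⟩ := exists_reduced u
    refine ⟨l ++ k, ?_, by simp [h, hl', hk'], by simp [hi]⟩
    unfold IsWord at *
    rw [List.map_append, List.prod_append, hl, hk]
  · rintro i ⟨k, hk, hk', hi⟩
    obtain ⟨l, hl, hl'⟩ := exists_reduced w
    refine ⟨l ++ k, ?_, by simp [h, hl', hk'], by simp [hi]⟩
    unfold IsWord at *
    rw [List.map_append, List.prod_append, hl, hk]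

/-! ### Minimal coset representatives -/

namespace RootRep

variable {M N : Type*} [AddCommGroup M] [Module ℝ M] [AddCommGroup N] [Module ℝ N]
variable (P : RootRep D M N)

theorem pos_map {J : Set I} {w : D.W} (hw : ∀ j ∈ J, P.Pos (P.ρ w (P.a j))) {m : M}
    (hm : P.PosOn J m) : P.Pos (P.ρ w m) := by
  obtain ⟨c, hc, rfl⟩ := hm
  rw [map_sum]
  have : ∀ s : Finset I, P.Pos (∑ i ∈ s, P.ρ w ((c i : ℝ) • P.a i)) := by
    classical
    intro s
    induction s using Finset.induction_on with
    | empty => exact ⟨0, by simp, by simp⟩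
    | insert i s hi ih =>
      rw [sum_insert hi]
      refine PosOn.add ?_ ih
      by_cases hJ : i ∈ J
      · rw [map_smul]; exact (hw i hJ).nsmul _
      · rw [hc i hJ]; exact ⟨0, by simp, by simp⟩
  exact this univ

/-- Each new letter of a reduced word for `u` contributes a positive root supported on `J`. As `w`
keeps it positive, the length grows by one. -/
theorem len_mul_of_pos {J : Set I} {w : D.W} (hw : ∀ j ∈ J, P.Pos (P.ρ w (P.a j))) {u : D.W}
    (hu : u ∈ D.par J) : D.len (w * u) = D.len w + D.len u := by
  obtain ⟨l, hl, rfl, hl'⟩ := exists_reduced_of_mem_par hu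
  clear hu
  rw [← hl']
  induction l using List.reverseRecOn with
  | nil => simp
  | append_singleton l j ih =>
    rw [List.map_append, List.prod_append, List.map_singleton, List.prod_singleton] at hl' ⊢
    have hle := len_le (D := D) (l := l) rfl
    have hle' := len_mul_s_le (l.map D.s).prod j
    rw [← hl', List.length_append, List.length_singleton] at hle'
    have hlen : l.length = D.len (l.map D.s).prod := by omega
    have hlJ : ∀ i ∈ l, i ∈ J := fun i hi => hl i (List.mem_append_left _ hi)
    have hjJ : j ∈ J := hl j (by simp)
    have hpos : P.Pos (P.ρ (l.map D.s).prod (P.a j)) := by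
      rw [← P.len_le_iff_pos, ← hl', ← hlen]; simp
    have := P.pos_map hw (P.posOn_of_mem_par (word_mem_par rfl hlJ) hjJ hpos)
    rw [← ρ_mul] at this
    rw [← mul_assoc, P.len_mul_s_of_pos this, ih hlJ hlen, List.length_append,
      List.length_singleton, add_assoc]

theorem mem_minR_iff {J : Set I} {w : D.W} :
    w ∈ D.minR J ↔ ∀ j ∈ J, P.Pos (P.ρ w (P.a j)) :=
  ⟨fun h j hj => P.len_le_iff_pos.1 (h _ (s_mem_par hj)),
    fun h u hu => by rw [P.len_mul_of_pos h hu]; exact Nat.le_add_right _ _⟩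

theorem mem_minL_iff {K : Set I} {w : D.W} :
    w ∈ D.minL K ↔ ∀ k ∈ K, P.Pos (P.ρ w⁻¹ (P.a k)) := by
  rw [mem_minL_iff_inv, P.mem_minR_iff]

end RootRep

theorem len_mul_of_minR {J : Set I} {w u : D.W} (hw : w ∈ D.minR J) (hu : u ∈ D.par J) :
    D.len (w * u) = D.len w + D.len u :=
  D.roots.len_mul_of_pos (D.roots.mem_minR_iff.1 hw) hu

theorem minR_anti {J K : Set I} (h : J ⊆ K) : D.minR K ⊆ D.minR J :=
  fun _ hw u hu => hw u (par_mono h hu)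

theorem minL_anti {J K : Set I} (h : J ⊆ K) : D.minL K ⊆ D.minL J :=
  fun _ hw u hu => hw u (par_mono h hu)

theorem eq_one_of_minR_of_mem_par {J : Set I} {w : D.W} (hw : w ∈ D.minR J) (h : w ∈ D.par J) :
    w = 1 := by
  have := hw _ (inv_mem h)
  rw [mul_inv_cancel, len_one] at this
  exact eq_one_of_len (Nat.le_zero.1 this)

/-- An element of minimal length in the double coset is minimal on both sides. -/
theorem exists_minL_minR (K J : Set I) (w : D.W) :
    ∃ a ∈ D.par K, ∃ y ∈ D.minL K ∩ D.minR J, ∃ c ∈ D.par J, w = a * y * c := by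
  let S : Set D.W := {y | ∃ a ∈ D.par K, ∃ c ∈ D.par J, w = a * y * c}
  have hS : S.Nonempty := ⟨w, 1, one_mem _, 1, one_mem _, by simp⟩
  set y := Function.argminOn D.len S hS with hy
  obtain ⟨a, ha, c, hc, h⟩ := Function.argminOn_mem D.len S hS
  refine ⟨a, ha, y, ⟨fun u hu => ?_, fun u hu => ?_⟩, c, hc, h⟩
  · refine Function.argminOn_le D.len S (a := u * y) ⟨a * u⁻¹, mul_mem ha (inv_mem hu), c, hc, ?_⟩
    rw [h]; group; rfl
  · refine Function.argminOn_le D.len S (a := y * u) ⟨a, ha, u⁻¹ * c, mul_mem (inv_mem hu) hc, ?_⟩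
    rw [h]; group; rfl

theorem exists_minR_mul (J : Set I) (w : D.W) :
    ∃ u ∈ D.minR J, ∃ c ∈ D.par J, w = u * c := by
  obtain ⟨a, ha, y, hy, c, hc, rfl⟩ := exists_minL_minR ∅ J w
  have : a = 1 := by simpa [par] using ha
  exact ⟨y, hy.2, c, hc, by rw [this, one_mul]⟩

theorem minL_of_mul {K : Set I} {w u : D.W} (h : w * u ∈ D.minL K)
    (hl : D.len (w * u) = D.len w + D.len u) : w ∈ D.minL K := by
  intro v hv
  have h1 := h v hv
  have h2 := len_mul_le (v * w) u
  rw [mul_assoc] at h2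
  omega

end KMDatum

/-! ### Dominance, Tits cones and finite parabolic subgroups. -/

namespace KMDatum

open Finset

variable {I V : Type*} [Fintype I] [NormedAddCommGroup V] [NormedSpace ℝ V]
variable {D : KMDatum I V}

namespace RootRep

variable {M N : Type*} [AddCommGroup M] [Module ℝ M] [AddCommGroup N] [Module ℝ N]
variable (P : RootRep D M N)

/-! ### Dominant points -/

/-- The real roots of the parabolic subgroup `W_J`. -/
def rts (J : Set I) : Set M := {β | ∃ w ∈ D.par J, ∃ j ∈ J, β = P.ρ w (P.a j)}

/-- The positive real roots of `W_J` that are negative at `n`. -/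
def neg (J : Set I) (n : N) : Set M := {β | β ∈ P.rts J ∧ P.Pos β ∧ P.pair β n < 0}

/-- `n` is dominant with respect to `J`. -/
def Dom (J : Set I) (n : N) : Prop := ∀ j ∈ J, 0 ≤ P.pair (P.a j) n

theorem ρ_s_self (i : I) (m : M) : P.ρ (D.s i) (P.ρ (D.s i) m) = m := by
  rw [← ρ_mul, s_mul_s, ρ_one]

theorem pair_ν_s (i : I) (m : M) (n : N) :
    P.pair m (P.ν (D.s i) n) = P.pair (P.ρ (D.s i) m) n := by
  rw [pair_ν, s_inv]

theorem a_mem_rts {J : Set I} {j : I} (hj : j ∈ J) : P.a j ∈ P.rts J :=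
  ⟨1, one_mem _, j, hj, by rw [ρ_one]⟩

theorem ρ_mem_rts {J : Set I} {w : D.W} (hw : w ∈ D.par J) {β : M} (h : β ∈ P.rts J) :
    P.ρ w β ∈ P.rts J := by
  obtain ⟨u, hu, j, hj, rfl⟩ := h
  exact ⟨w * u, mul_mem hw hu, j, hj, by rw [ρ_mul]⟩

theorem rts_mono {J K : Set I} (h : J ⊆ K) : P.rts J ⊆ P.rts K := by
  rintro _ ⟨u, hu, j, hj, rfl⟩
  exact ⟨u, par_mono h hu, j, h hj, rfl⟩

theorem neg_mono {J K : Set I} (h : J ⊆ K) (n : N) : P.neg J n ⊆ P.neg K n :=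
  fun _ hβ => ⟨P.rts_mono h hβ.1, hβ.2⟩

theorem pair_nonneg_of_posOn {J : Set I} {n : N} (hn : P.Dom J n) {m : M} (hm : P.PosOn J m) :
    0 ≤ P.pair m n := by
  obtain ⟨c, hc, rfl⟩ := hm
  rw [map_sum, LinearMap.sum_apply]
  refine sum_nonneg fun i _ => ?_
  rw [map_smul, LinearMap.smul_apply, smul_eq_mul]
  by_cases hi : i ∈ J
  · exact mul_nonneg (Nat.cast_nonneg _) (hn i hi)
  · simp [hc i hi]

theorem posOn_of_mem_rts {J : Set I} {β : M} (h : β ∈ P.rts J) (hp : P.Pos β) :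
    P.PosOn J β := by
  obtain ⟨u, hu, j, hj, rfl⟩ := h
  exact P.posOn_of_mem_par hu hj hp

theorem neg_eq_empty {J : Set I} {n : N} (hn : P.Dom J n) : P.neg J n = ∅ :=
  Set.eq_empty_of_forall_notMem fun _ hβ =>
    hβ.2.2.not_ge (P.pair_nonneg_of_posOn hn (P.posOn_of_mem_rts hβ.1 hβ.2.1))

theorem s_mem_neg {J : Set I} {i : I} (hi : i ∈ J) {n : N} {β : M}
    (h : β ∈ P.neg J (P.ν (D.s i) n)) (hne : β ≠ P.a i) : P.ρ (D.s i) β ∈ P.neg J n := by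
  obtain ⟨h1, h2, h3⟩ := h
  refine ⟨P.ρ_mem_rts (s_mem_par hi) h1, ?_, by rwa [← pair_ν_s]⟩
  obtain ⟨u, hu, j, hj, rfl⟩ := h1
  exact P.pos_s h2 hne

theorem neg_s_finite {J : Set I} {i : I} (hi : i ∈ J) {n : N} (h : (P.neg J n).Finite) :
    (P.neg J (P.ν (D.s i) n)).Finite := by
  refine ((h.image (P.ρ (D.s i))).insert (P.a i)).subset fun β hβ => ?_
  by_cases hne : β = P.a i
  · exact Or.inl hne
  · exact Or.inr ⟨_, P.s_mem_neg hi hβ hne, P.ρ_s_self i β⟩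

theorem neg_finite_of_dom {u : N} (hu : P.Dom Set.univ u) (w : D.W) (J : Set I) :
    (P.neg J (P.ν w u)).Finite := by
  refine Set.Finite.subset ?_ (P.neg_mono (Set.subset_univ J) _)
  obtain ⟨l, rfl⟩ := exists_word w
  induction l with
  | nil =>
    rw [List.map_nil, List.prod_nil, ν_one, P.neg_eq_empty hu]
    exact Set.finite_empty
  | cons i l ih =>
    rw [List.map_cons, List.prod_cons, ν_mul]
    exact P.neg_s_finite (Set.mem_univ i) ih

/-- Reflecting in a simple root that is negative at `n` removes this root from the finite set of
negative ones and permutes the others, so the count drops. -/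
theorem exists_dominant {J : Set I} {n : N} (h : (P.neg J n).Finite) :
    ∃ w ∈ D.par J, P.Dom J (P.ν w n) := by
  induction hk : (P.neg J n).ncard using Nat.strong_induction_on generalizing n with
  | _ k ih =>
  by_cases hd : P.Dom J n
  · exact ⟨1, one_mem _, by rwa [ν_one]⟩
  simp only [Dom, not_forall, not_le] at hd
  obtain ⟨j, hj, hneg⟩ := hd
  have hmem : P.a j ∈ P.neg J n := ⟨P.a_mem_rts hj, P.posOn_a trivial, hneg⟩
  have hsub : P.neg J (P.ν (D.s j) n) ⊆ P.ρ (D.s j) '' (P.neg J n \ {P.a j}) := by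
    intro β hβ
    have hne : β ≠ P.a j := by
      rintro rfl
      have := hβ.2.2
      rw [pair_ν_s, ρ_s_a_self, map_neg, LinearMap.neg_apply] at this
      linarith
    refine ⟨_, ⟨P.s_mem_neg hj hβ hne, fun h => ?_⟩, P.ρ_s_self j β⟩
    have h1 : β = -P.a j := by
      rw [← P.ρ_s_self j β, Set.mem_singleton_iff.1 h, ρ_s_a_self]
    have h2 := hβ.2.1
    rw [h1] at h2
    exact P.a_ne_zero j (Pos.eq_zero (P.posOn_a trivial) h2)
  have hfin : (P.ρ (D.s j) '' (P.neg J n \ {P.a j})).Finite := (h.subset Set.sdiff_subset).image _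
  have hcard : (P.neg J (P.ν (D.s j) n)).ncard < k := by
    rw [← hk]
    refine (Set.ncard_le_ncard hsub hfin).trans_lt ?_
    refine (Set.ncard_image_le (h.subset Set.sdiff_subset)).trans_lt ?_
    exact Set.ncard_sdiff_singleton_lt_of_mem hmem h
  obtain ⟨w, hw, hw'⟩ := ih _ hcard (hfin.subset hsub) rfl
  exact ⟨w * D.s j, mul_mem hw (s_mem_par hj), by rwa [ν_mul]⟩

/-- The Tits cone: the union of the translates of the closed dominant chamber. -/
def tits : Set N := {n | ∃ w u, P.Dom Set.univ u ∧ n = P.ν w u}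

/-- This criterion makes convexity visible: a root negative on a sum is negative on one of the
summands. -/
theorem mem_tits_iff {n : N} : n ∈ P.tits ↔ (P.neg Set.univ n).Finite := by
  constructor
  · rintro ⟨w, u, hu, rfl⟩
    exact P.neg_finite_of_dom hu w _
  · intro h
    obtain ⟨w, -, hw⟩ := P.exists_dominant h
    exact ⟨w⁻¹, _, hw, by rw [ν_inv_self]⟩

theorem neg_finite_of_mem_tits {n : N} (h : n ∈ P.tits) (J : Set I) : (P.neg J n).Finite :=
  (P.mem_tits_iff.1 h).subset (P.neg_mono (Set.subset_univ J) n)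

theorem ν_mem_tits {n : N} (w : D.W) (h : n ∈ P.tits) : P.ν w n ∈ P.tits := by
  obtain ⟨u, n, hn, rfl⟩ := h
  exact ⟨w * u, n, hn, by rw [ν_mul]⟩

theorem add_mem_tits {m n : N} (hm : m ∈ P.tits) (hn : n ∈ P.tits) : m + n ∈ P.tits := by
  rw [mem_tits_iff] at *
  refine (hm.union hn).subset fun β hβ => ?_
  by_contra h
  simp only [Set.mem_union, not_or] at h
  have h1 : 0 ≤ P.pair β m := by
    by_contra! h'
    exact h.1 ⟨hβ.1, hβ.2.1, h'⟩
  have h2 : 0 ≤ P.pair β n := by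
    by_contra! h'
    exact h.2 ⟨hβ.1, hβ.2.1, h'⟩
  have := hβ.2.2
  rw [map_add] at this
  linarith

theorem smul_mem_tits {n : N} (hn : n ∈ P.tits) {c : ℝ} (hc : 0 ≤ c) : c • n ∈ P.tits := by
  obtain ⟨u, n, hn, rfl⟩ := hn
  exact ⟨u, c • n, fun j hj => by rw [map_smul]; exact mul_nonneg hc (hn j hj), by
    rw [map_smul]⟩

theorem ν_eq_self_of_mem_par {J : Set I} {n : N} (h : ∀ j ∈ J, P.pair (P.a j) n = 0) {w : D.W}
    (hw : w ∈ D.par J) : P.ν w n = n := by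
  obtain ⟨l, hl, rfl⟩ := exists_word_of_mem_par hw
  clear hw
  induction l with
  | nil => simp
  | cons i l ih =>
    rw [List.map_cons, List.prod_cons, ν_mul, ih fun j hj => hl j (List.mem_cons_of_mem _ hj),
      ν_s, h i (hl i List.mem_cons_self), zero_smul, sub_zero]

/-- Let `j` be the last letter of a reduced word `u s_j`. Dominance of the image, tested on the
positive root `u a_j`, gives a value of at most zero for `a j` at `n`, hence zero. So `s j` fixes
`n` and can be removed. -/
theorem ν_eq_self_of_dom {K : Set I} {w : D.W} (hw : w ∈ D.par K) {n : N} (h1 : P.Dom K n)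
    (h2 : P.Dom K (P.ν w n)) :
    P.ν w n = n ∧ w ∈ D.par {k | k ∈ K ∧ P.pair (P.a k) n = 0} := by
  obtain ⟨l, hl, rfl, hl'⟩ := exists_reduced_of_mem_par hw
  induction l using List.reverseRecOn with
  | nil => exact ⟨by simp, one_mem _⟩
  | append_singleton l j ih =>
    have hw' := word_mem_par (D := D) rfl hl
    rw [List.map_append, List.prod_append, List.map_singleton, List.prod_singleton]
      at hl' h2 hw' ⊢
    set u := (l.map D.s).prod with hu
    have hle : D.len u ≤ l.length := len_le rfl
    have hle' := len_mul_s_le u j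
    rw [← hl', List.length_append, List.length_singleton] at hle'
    have hlen : l.length = D.len u := by omega
    have hlK : ∀ i ∈ l, i ∈ K := fun i hi => hl i (List.mem_append_left _ hi)
    have hjK : j ∈ K := hl j (by simp)
    have hpos : P.Pos (P.ρ u (P.a j)) := by
      rw [← P.len_le_iff_pos, ← hl', ← hlen]; simp
    have h3 := P.pair_nonneg_of_posOn h2 (P.posOn_of_mem_par (word_mem_par rfl hlK) hjK hpos)
    rw [ν_mul, pair_ρ_ν, pair_ν_s, ρ_s_a_self, map_neg, LinearMap.neg_apply] at h3
    have h4 : P.pair (P.a j) n = 0 := le_antisymm (by linarith) (h1 j hjK)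
    have h5 : P.ν (D.s j) n = n := by rw [ν_s, h4, zero_smul, sub_zero]
    rw [ν_mul, h5] at h2
    obtain ⟨h6, h7⟩ := ih hlK (word_mem_par rfl hlK) h2 hlen
    exact ⟨by rw [ν_mul, h5, h6], mul_mem h7 (s_mem_par ⟨hjK, h4⟩)⟩

/-- An element of `W_J` is determined by its action on the `a j` with `j ∈ J`: one fixing all of
them is a minimal representative lying in `W_J`, hence trivial. -/
theorem par_finite {J : Set I} (h : (P.rts J).Finite) : (D.par J : Set D.W).Finite := by
  have : Finite (P.rts J) := h
  let f : D.par J → J → P.rts J := fun w j => ⟨P.ρ w.1 (P.a j), w.1, w.2, j, j.2, rfl⟩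
  have hf : Function.Injective f := by
    intro w u hwu
    have h1 : ∀ j ∈ J, P.ρ w.1 (P.a j) = P.ρ u.1 (P.a j) := fun j hj =>
      congrArg Subtype.val (congrFun hwu ⟨j, hj⟩)
    have h2 : w.1⁻¹ * u.1 = 1 := by
      refine eq_one_of_minR_of_mem_par (P.mem_minR_iff.2 fun j hj => ?_)
        (mul_mem (inv_mem w.2) u.2)
      rw [ρ_mul, ← h1 j hj, ρ_inv_self]
      exact P.posOn_a trivial
    exact Subtype.ext (inv_mul_eq_one.1 h2)
  have : Finite (D.par J) := Finite.of_injective f hf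
  exact Set.toFinite _

theorem rts_finite {J : Set I} (h : (D.par J : Set D.W).Finite) : (P.rts J).Finite := by
  refine ((h.prod (Set.toFinite J)).image fun p => P.ρ p.1 (P.a p.2)).subset ?_
  rintro _ ⟨w, hw, j, hj, rfl⟩
  exact ⟨(w, j), ⟨hw, hj⟩, rfl⟩

end RootRep

end KMDatum

/-! ### Dynkin components and the trichotomy of generalized Cartan matrices. -/

namespace KMDatum

open Finset

variable {I V : Type*} [Fintype I] [NormedAddCommGroup V] [NormedSpace ℝ V]
variable {D : KMDatum I V}

/-! ### Connected components -/

theorem mem_comp_self (Θ : Set I) (i : I) : i ∈ D.comp Θ i := Relation.ReflTransGen.refl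

theorem comp_subset {Θ : Set I} {i : I} (hi : i ∈ Θ) : D.comp Θ i ⊆ Θ := by
  intro j hj
  induction hj with
  | refl => exact hi
  | tail _ h _ => exact h.2.1

theorem comp_eq_of_mem {Θ : Set I} {i j : I} (hj : j ∈ D.comp Θ i) :
    D.comp Θ j = D.comp Θ i := by
  have hji : Relation.ReflTransGen (fun a b => a ∈ Θ ∧ b ∈ Θ ∧ D.A a b ≠ 0) j i := by
    induction hj with
    | refl => exact Relation.ReflTransGen.refl
    | tail _ hab ih =>
      exact Relation.ReflTransGen.head ⟨hab.2.1, hab.1, fun h' => hab.2.2 (D.zero_symm _ _ h')⟩ ih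
  exact Set.ext fun k => ⟨fun h => Relation.ReflTransGen.trans hj h,
    fun h => Relation.ReflTransGen.trans hji h⟩

theorem mem_comp_of_adj {Θ : Set I} {i a b : I} (hi : i ∈ Θ) (ha : a ∈ D.comp Θ i) (hb : b ∈ Θ)
    (hab : D.A a b ≠ 0) : b ∈ D.comp Θ i :=
  Relation.ReflTransGen.tail ha ⟨comp_subset hi ha, hb, hab⟩

theorem comp_eq_of_closed {J Θ : Set I} (hΘ : Θ ⊆ J)
    (h : ∀ a ∈ Θ, ∀ b ∈ J, D.A a b ≠ 0 → b ∈ Θ) {i : I} (hi : i ∈ Θ) :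
    D.comp J i = D.comp Θ i := by
  refine subset_antisymm (fun j hj => ?_) fun j hj => ?_
  · induction hj with
    | refl => exact mem_comp_self _ _
    | tail _ hab ih =>
      exact mem_comp_of_adj hi ih (h _ (comp_subset hi ih) _ hab.2.1 hab.2.2) hab.2.2
  · induction hj with
    | refl => exact mem_comp_self _ _
    | tail _ hab ih => exact mem_comp_of_adj (hΘ hi) ih (hΘ hab.2.1) hab.2.2

/-- `K` is connected in the Dynkin diagram (or empty). -/
def Conn (D : KMDatum I V) (K : Set I) : Prop :=
  ∀ T ⊆ K, T.Nonempty → (∀ a ∈ T, ∀ b ∈ K, D.A a b ≠ 0 → b ∈ T) → T = K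

theorem conn_comp {Θ : Set I} {i : I} (hi : i ∈ Θ) : D.Conn (D.comp Θ i) := by
  rintro T hT ⟨t, ht⟩ h
  refine subset_antisymm hT fun j hj => ?_
  rw [← comp_eq_of_mem (hT ht)] at hj
  induction hj with
  | refl => exact ht
  | tail _ hab ih => exact h _ ih _ (mem_comp_of_adj hi (hT ih) hab.2.1 hab.2.2) hab.2.2

theorem fin_union_inf (J : Set I) : D.inf J ∪ D.fin J = J := by
  ext i; simp only [inf, fin, Set.mem_union, Set.mem_ofPred_eq]; tauto

theorem fin_subset (J : Set I) : D.fin J ⊆ J := fun _ h => h.1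

theorem inf_subset (J : Set I) : D.inf J ⊆ J := fun _ h => h.1

theorem inf_closed {J : Set I} {a b : I} (ha : a ∈ D.inf J) (hb : b ∈ J) (h : D.A a b ≠ 0) :
    b ∈ D.inf J := by
  have : b ∈ D.comp J a := mem_comp_of_adj ha.1 (mem_comp_self _ _) hb h
  exact ⟨hb, by rw [comp_eq_of_mem this]; exact ha.2⟩

theorem fin_closed {J : Set I} {a b : I} (ha : a ∈ D.fin J) (hb : b ∈ J) (h : D.A a b ≠ 0) :
    b ∈ D.fin J := by
  have : b ∈ D.comp J a := mem_comp_of_adj ha.1 (mem_comp_self _ _) hb h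
  exact ⟨hb, by rw [comp_eq_of_mem this]; exact ha.2⟩

theorem isSpecial_inf (J : Set I) : D.IsSpecial (D.inf J) := by
  refine subset_antisymm (fun i hi => ⟨hi, ?_⟩) (inf_subset _)
  rw [← comp_eq_of_closed (inf_subset J) (fun a ha b hb h => inf_closed ha hb h) hi]
  exact hi.2

theorem fin_fin (J : Set I) : D.fin (D.fin J) = D.fin J := by
  refine subset_antisymm (fin_subset _) fun i hi => ⟨hi, ?_⟩
  rw [← comp_eq_of_closed (fin_subset J) (fun a ha b hb h => fin_closed ha hb h) hi]
  exact hi.2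

theorem mem_perp_comm {J K : Set I} : J ⊆ D.perp K ↔ K ⊆ D.perp J :=
  ⟨fun h _ hi _ hj => D.zero_symm _ _ (h hj _ hi), fun h _ hi _ hj => D.zero_symm _ _ (h hj _ hi)⟩

theorem fin_subset_perp (J : Set I) : D.fin J ⊆ D.perp (D.inf J) := by
  intro i hi j hj
  by_contra h
  exact hj.2 (fin_closed hi hj.1 h).2

theorem perp_anti {J K : Set I} (h : J ⊆ K) : D.perp K ⊆ D.perp J := fun _ hi j hj => hi j (h hj)

/-- By orthogonality the components of `Θ ∪ K` are those of `Θ` and those of `K`. -/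
theorem inf_fin_union {Θ K : Set I} (hΘ : D.IsSpecial Θ) (hK : D.fin K = K)
    (hKΘ : K ⊆ D.perp Θ) : D.inf (Θ ∪ K) = Θ ∧ D.fin (Θ ∪ K) = K := by
  have h1 : ∀ i ∈ Θ, D.comp (Θ ∪ K) i = D.comp Θ i := fun i hi => by
    refine comp_eq_of_closed Set.subset_union_left (fun a ha b hb h => ?_) hi
    exact hb.resolve_right fun hb => h (D.zero_symm _ _ (hKΘ hb a ha))
  have h2 : ∀ i ∈ K, D.comp (Θ ∪ K) i = D.comp K i := fun i hi => by
    refine comp_eq_of_closed Set.subset_union_right (fun a ha b hb h => ?_) hi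
    exact hb.resolve_left fun hb => h (hKΘ ha b hb)
  have h3 : ∀ i ∈ Θ, ¬ D.IsFiniteType (D.comp Θ i) := fun i hi => by
    rw [hΘ] at hi; exact hi.2
  have h4 : ∀ i ∈ K, D.IsFiniteType (D.comp K i) := fun i hi => by
    rw [← hK] at hi; exact hi.2
  constructor
  · ext i
    constructor
    · rintro ⟨hi | hi, h⟩
      · exact hi
      · rw [h2 i hi] at h; exact absurd (h4 i hi) h
    · exact fun hi => ⟨Or.inl hi, by rw [h1 i hi]; exact h3 i hi⟩
  · ext i
    constructor
    · rintro ⟨hi | hi, h⟩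
      · rw [h1 i hi] at h; exact absurd h (h3 i hi)
      · exact hi
    · exact fun hi => ⟨Or.inr hi, by rw [h2 i hi]; exact h4 i hi⟩

/-! ### Matrices of finite type -/

open Classical in
theorem subMul_eq (K : Set I) (v : I → ℝ) (i : I) :
    D.subMul K v i = ∑ j, if j ∈ K then (D.A i j : ℝ) * v j else 0 :=
  sum_congr rfl fun _ _ => Set.indicator_apply _ _ _

theorem A_nonpos {i j : I} (h : i ≠ j) : (D.A i j : ℝ) ≤ 0 := by exact_mod_cast D.offDiag i j h

theorem subMul_add_smul (K : Set I) (v u : I → ℝ) (t : ℝ) (i : I) :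
    D.subMul K (fun j => v j + t * u j) i = D.subMul K v i + t * D.subMul K u i := by
  classical
  simp only [subMul_eq, mul_sum, ← sum_add_distrib]
  refine sum_congr rfl fun j _ => ?_
  split_ifs <;> ring

theorem subMul_nonpos {K : Set I} {v : I → ℝ} (hv : ∀ i ∈ K, 0 ≤ v i) {i : I} (hi : v i = 0) :
    D.subMul K v i ≤ 0 := by
  classical
  rw [subMul_eq]
  refine sum_nonpos fun j _ => ?_
  split_ifs with h
  · rcases eq_or_ne i j with rfl | hij
    · rw [hi, mul_zero]
    · exact mul_nonpos_of_nonpos_of_nonneg (A_nonpos hij) (hv j h)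
  · exact le_rfl

/-- Subtract from `v` the largest multiple `t u` that leaves it nonnegative. At a zero of the
difference its image under `A_K` is at most zero, which forces `t ≥ 0`, so `v ≥ 0`. If `v` has a
zero, the same sign argument spreads it to the neighbours, and connectedness does the rest. -/
theorem pos_or_zero_of_subMul_nonneg {K : Set I} (hK : D.Conn K) {u : I → ℝ}
    (hu : ∀ i ∈ K, 0 < u i) (hAu : ∀ i ∈ K, 0 < D.subMul K u i) {v : I → ℝ}
    (hv : ∀ i ∈ K, 0 ≤ D.subMul K v i) : (∀ i ∈ K, 0 < v i) ∨ ∀ i ∈ K, v i = 0 := by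
  classical
  rcases K.eq_empty_or_nonempty with rfl | hne
  · simp
  obtain ⟨i₀, hi₀, hmin⟩ := Set.exists_min_image K (fun i => v i / u i) (Set.toFinite K) hne
  set t := v i₀ / u i₀ with ht
  have h1 : ∀ i ∈ K, 0 ≤ v i + -t * u i := fun i hi => by
    have := (le_div_iff₀ (hu i hi)).1 (hmin i hi)
    linarith
  have h2 : v i₀ + -t * u i₀ = 0 := by
    rw [ht]; field_simp [(hu i₀ hi₀).ne']; ring
  have h3 := subMul_nonpos (D := D) (v := fun i => v i + -t * u i) h1 h2
  rw [subMul_add_smul] at h3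
  have ht0 : 0 ≤ t := by
    have := hAu i₀ hi₀
    have := hv i₀ hi₀
    by_contra! h
    nlinarith
  have hv0 : ∀ i ∈ K, 0 ≤ v i := fun i hi => by
    have := mul_nonneg ht0 (hu i hi).le
    linarith [h1 i hi]
  by_cases hz : ∃ i ∈ K, v i = 0
  · right
    obtain ⟨i, hi, hi0⟩ := hz
    have := hK {i | i ∈ K ∧ v i = 0} (fun i h => h.1) ⟨i, hi, hi0⟩ ?_
    · intro j hj
      rw [← this] at hj
      exact hj.2
    · rintro a ⟨ha, ha0⟩ b hb hab
      refine ⟨hb, ?_⟩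
      have h4 := hv a ha
      rw [subMul_eq] at h4
      have h5 : ∀ j ∈ univ, (if j ∈ K then (D.A a j : ℝ) * v j else 0) ≤ 0 := by
        intro j _
        split_ifs with h
        · rcases eq_or_ne a j with rfl | hij
          · rw [ha0, mul_zero]
          · exact mul_nonpos_of_nonpos_of_nonneg (A_nonpos hij) (hv0 j h)
        · exact le_rfl
      have h6 := (sum_eq_zero_iff_of_nonpos h5).1 (le_antisymm (sum_nonpos h5) h4) b (mem_univ b)
      rw [if_pos hb] at h6
      exact (mul_eq_zero.1 h6).resolve_left (by exact_mod_cast hab)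
  · left
    push Not at hz
    exact fun i hi => lt_of_le_of_ne (hv0 i hi) (hz i hi).symm

theorem isFiniteType_of_pos {K : Set I} (hK : D.Conn K) {u : I → ℝ}
    (hu : ∀ i ∈ K, 0 < u i) (hAu : ∀ i ∈ K, 0 < D.subMul K u i) : D.IsFiniteType K := by
  refine ⟨fun v hv => ?_, ⟨u, hu, hAu⟩, fun v hv => pos_or_zero_of_subMul_nonneg hK hu hAu hv⟩
  refine (pos_or_zero_of_subMul_nonneg hK hu hAu (v := v) fun i hi => (hv i hi).ge).elim
    (fun h1 => ?_) id
  have h2 : ∀ i ∈ K, 0 ≤ D.subMul K (fun j => -v j) i := fun i hi => by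
    have := subMul_add_smul (D := D) K 0 v (-1) i
    simp only [Pi.zero_apply, zero_add, neg_mul, one_mul] at this
    rw [this, hv i hi]
    simp [subMul_eq]
  rcases pos_or_zero_of_subMul_nonneg hK hu hAu h2 with h3 | h3
  · exact fun i hi => absurd (h1 i hi) (by linarith [h3 i hi])
  · exact fun i hi => by linarith [h3 i hi]

/-- A nonzero nonnegative vector on `K` whose image under the transpose of `A_K` is
nonpositive. -/
structure IsSubNull (D : KMDatum I V) (K : Set I) (x : I → ℝ) : Prop where
  nonneg : ∀ i, 0 ≤ x i
  zero : ∀ i ∉ K, x i = 0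
  ne_zero : ∃ i, x i ≠ 0
  le : ∀ j ∈ K, ∑ i, x i * D.A i j ≤ 0

/-- A separation argument. The open positive orthant misses the cone of all `A_K y` with `y ≥ 0`: if
`A_K y > 0` then `y` cannot vanish anywhere on `K`, and `A_K` would be of finite type. The
coefficients of a separating functional, with sign reversed, are the required vector. -/
theorem exists_isSubNull {K : Set I} (hK : D.Conn K) (hfin : ¬ D.IsFiniteType K) :
    ∃ x, D.IsSubNull K x := by
  classical
  have hne : Nonempty K := by
    by_contra h
    rw [not_nonempty_iff, Set.isEmpty_coe_sort] at h
    subst h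
    exact hfin ⟨by simp, by simp, by simp⟩
  let S : Set (K → ℝ) := Set.univ.pi fun _ => Set.Ioi 0
  let T : Set (K → ℝ) := {z | ∃ y : I → ℝ, (∀ i, 0 ≤ y i) ∧ z = fun i : K => D.subMul K y i}
  have hSc : Convex ℝ S := convex_pi fun _ _ => convex_Ioi 0
  have hSo : IsOpen S := isOpen_set_pi Set.finite_univ fun _ _ => isOpen_Ioi
  have hTadd : ∀ y y' : I → ℝ, ∀ a b : ℝ, (fun i : K => D.subMul K (fun j => a * y j + b * y' j) i) =
      a • (fun i : K => D.subMul K y i) + b • fun i : K => D.subMul K y' i := by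
    intro y y' a b
    funext i
    have h1 := subMul_add_smul (D := D) K (fun j => a * y j) y' b i
    have h2 := subMul_add_smul (D := D) K 0 y a i
    have h3 : D.subMul K 0 i.1 = 0 := by simp [subMul_eq]
    simp only [Pi.zero_apply, zero_add] at h2
    rw [h1, h2, h3]
    simp
  have hTc : Convex ℝ T := by
    rintro _ ⟨y, hy, rfl⟩ _ ⟨y', hy', rfl⟩ a b ha hb _
    exact ⟨fun j => a * y j + b * y' j,
      fun i => add_nonneg (mul_nonneg ha (hy i)) (mul_nonneg hb (hy' i)), (hTadd y y' a b).symm⟩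
  have hdisj : Disjoint S T := by
    rw [Set.disjoint_left]
    rintro _ hz ⟨y, hy, rfl⟩
    have h1 : ∀ i ∈ K, 0 < D.subMul K y i := fun i hi => hz ⟨i, hi⟩ trivial
    refine hfin (isFiniteType_of_pos hK (u := y) (fun i hi => ?_) h1)
    refine lt_of_le_of_ne (hy i) fun h => ?_
    exact (h1 i hi).not_ge (subMul_nonpos (fun j _ => hy j) h.symm)
  obtain ⟨f, u, hf1, hf2⟩ := geometric_hahn_banach_open hSc hSo hTc hdisj
  have hu : u ≤ 0 := by
    have := hf2 _ ⟨0, fun _ => le_rfl, rfl⟩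
    have h0 : (fun i : K => D.subMul K 0 i.1) = 0 := by funext i; simp [subMul_eq]
    rwa [h0, map_zero] at this
  have hfT : ∀ z ∈ T, 0 ≤ f z := by
    rintro _ ⟨y, hy, rfl⟩
    by_contra! h
    -- With this factor the value `f z` becomes `u + f z`, which is below the bound `u`.
    have h1 := hf2 _ ⟨fun j => (u / f (fun i : K => D.subMul K y i) + 1) * y j + 0 * y j, fun i => by
      have : 0 ≤ u / f (fun i : K => D.subMul K y i) := div_nonneg_of_nonpos hu h.le
      have := hy i
      positivity, rfl⟩
    rw [hTadd, map_add, map_smul, map_smul, smul_eq_mul, smul_eq_mul, zero_mul, add_zero, add_mul,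
      div_mul_cancel₀ _ h.ne, one_mul] at h1
    linarith
  have hfS : ∀ z ∈ S, f z < 0 := fun z hz => (hf1 z hz).trans_le hu
  have hexp : ∀ z : K → ℝ, f z = ∑ i, z i * f (Pi.single i 1) := by
    intro z
    conv_lhs => rw [pi_eq_sum_univ' z, map_sum]
    refine sum_congr rfl fun i _ => ?_
    rw [map_smul, smul_eq_mul]
  have hle : ∀ i : K, f (Pi.single i 1) ≤ 0 := by
    intro i
    by_contra! h
    set a := f (Pi.single i 1)
    have h1 := hfS (fun _ => 1) fun _ _ => Set.mem_Ioi.2 one_pos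
    -- The multiple of the unit vector is chosen so that `f` takes the value `0` on the sum,
    -- although the sum is still positive.
    have h2 := hfS ((fun _ => 1) + ((-f fun _ => 1) / a) • Pi.single i 1) fun j _ => by
      have h3 : 0 ≤ (-f fun _ => 1) / a := div_nonneg (by linarith) h.le
      have h4 : (0 : ℝ) ≤ (Pi.single i 1 : K → ℝ) j := by
        rw [Pi.single_apply]; split_ifs <;> norm_num
      have := mul_nonneg h3 h4
      simp only [Set.mem_Ioi, Pi.add_apply, Pi.smul_apply, smul_eq_mul]
      linarith
    rw [map_add, map_smul, smul_eq_mul, div_mul_cancel₀ _ h.ne'] at h2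
    linarith
  refine ⟨fun i => if h : i ∈ K then -f (Pi.single ⟨i, h⟩ 1) else 0, ?_, ?_, ?_, ?_⟩
  · intro i
    split_ifs with h
    · linarith [hle ⟨i, h⟩]
    · exact le_rfl
  · intro i hi
    simp [hi]
  · by_contra! h
    have h1 := hfS (fun _ => 1) fun _ _ => Set.mem_Ioi.2 one_pos
    rw [hexp] at h1
    refine h1.ne (sum_eq_zero fun i _ => ?_)
    have := h i.1
    rw [dif_pos i.2] at this
    rw [neg_eq_zero.1 this, mul_zero]
  · intro j hj
    have h1 := hfT _ ⟨Pi.single j 1, fun i => by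
      rw [Pi.single_apply]; split_ifs <;> norm_num, rfl⟩
    rw [hexp] at h1
    have h2 : ∀ i, D.subMul K (Pi.single j 1) i = D.A i j := by
      intro i
      rw [subMul_eq, sum_eq_single j]
      · simp [hj]
      · intro b _ hb; simp [Pi.single_eq_of_ne hb]
      · simp
    have h3 : ∑ i, (if h : i ∈ K then -f (Pi.single ⟨i, h⟩ 1) else 0) * (D.A i j : ℝ) =
        -∑ i : K, D.subMul K (Pi.single j 1) i * f (Pi.single i 1) := by
      rw [← sum_neg_distrib, ← sum_subset (subset_univ (univ.filter (· ∈ K)))]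
      · rw [sum_subtype (p := (· ∈ K)) _ (by simp)]
        refine sum_congr rfl fun i _ => ?_
        rw [dif_pos i.2, h2]; ring
      · intro i _ hi
        simp at hi
        simp [hi]
    rw [h3]
    linarith

/-- Choose a solution of maximal support. If the support were not all of `K`, some `b ∈ K` outside
would have a neighbour `a` inside. Column `b` then has slack, and `b` can be added to the support.
-/
theorem exists_pos_isSubNull {K : Set I} (hK : D.Conn K) (hfin : ¬ D.IsFiniteType K) :
    ∃ x, D.IsSubNull K x ∧ ∀ i ∈ K, 0 < x i := by
  classical
  let supp : (I → ℝ) → ℕ := fun x => (univ.filter fun i => x i ≠ 0).card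
  let S : ℕ → Prop := fun n => ∃ x, D.IsSubNull K x ∧ supp x = n
  have hb : ∀ n, S n → n ≤ Fintype.card I := by
    rintro n ⟨x, -, rfl⟩
    exact card_le_univ _
  obtain ⟨x₀, hx₀⟩ := exists_isSubNull hK hfin
  have hS₀ : S (supp x₀) := ⟨x₀, hx₀, rfl⟩
  obtain ⟨x, hx, hxm⟩ := Nat.findGreatest_spec (hb _ hS₀) hS₀
  refine ⟨x, hx, ?_⟩
  have hT := hK {i | 0 < x i} (fun i hi => ?_) ?_ ?_
  · exact fun i hi => by rw [← hT] at hi; exact hi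
  · by_contra h
    exact (ne_of_gt hi) (hx.zero i h)
  · obtain ⟨i, hi⟩ := hx.ne_zero
    exact ⟨i, lt_of_le_of_ne (hx.nonneg i) hi.symm⟩
  · intro a ha b hb' hab
    by_contra hxb
    have hxb0 : x b = 0 := le_antisymm (not_lt.1 hxb) (hx.nonneg b)
    have hab' : a ≠ b := by rintro rfl; exact hxb ha
    have haK : a ∈ K := by
      by_contra h
      exact (ne_of_gt ha) (hx.zero a h)
    have hneg : (D.A a b : ℝ) < 0 := lt_of_le_of_ne (A_nonpos hab') (by exact_mod_cast hab)
    have hpos : 0 < -(x a * D.A a b) / 2 := by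
      have : x a * D.A a b < 0 := mul_neg_of_pos_of_neg ha hneg
      linarith
    -- As `A b b = 2`, raising `x b` by `e` adds `2 e = -(x a * A a b)` to column `b`, which the
    -- slack just covers.
    set e := -(x a * D.A a b) / 2 with he
    have hsum : ∀ j, ∑ i, (x i + if i = b then e else 0) * (D.A i j : ℝ) =
        ∑ i, x i * D.A i j + e * D.A b j := by
      intro j
      simp [add_mul, sum_add_distrib]
    have hnew : D.IsSubNull K fun i => x i + if i = b then e else 0 := by
      refine ⟨fun i => ?_, fun i hi => ?_, ⟨b, ?_⟩, fun j hj => ?_⟩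
      · have := hx.nonneg i
        split_ifs <;> linarith
      · have : i ≠ b := by rintro rfl; exact hi hb'
        simp [this, hx.zero i hi]
      · simp [hxb0, hpos.ne']
      · rw [hsum]
        rcases eq_or_ne b j with rfl | hbj
        · have h1 : ∑ i, x i * (D.A i b : ℝ) ≤ x a * D.A a b := by
            rw [← add_sum_erase _ _ (mem_univ a)]
            have : ∑ i ∈ univ.erase a, x i * (D.A i b : ℝ) ≤ 0 := by
              refine sum_nonpos fun i _ => ?_
              rcases eq_or_ne i b with rfl | h
              · rw [hxb0, zero_mul]
              · exact mul_nonpos_of_nonneg_of_nonpos (hx.nonneg i) (A_nonpos h)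
            linarith
          rw [D.diag]
          push_cast
          linarith
        · have := hx.le j hj
          have := mul_nonpos_of_nonneg_of_nonpos hpos.le (A_nonpos hbj : (D.A b j : ℝ) ≤ 0)
          linarith
    have hlt : supp x < supp fun i => x i + if i = b then e else 0 := by
      refine card_lt_card ⟨fun i hi => ?_, fun h => ?_⟩
      · simp only [mem_filter, mem_univ, true_and] at hi ⊢
        have : i ≠ b := by rintro rfl; exact hi hxb0
        simpa [this] using hi
      · have := h (x := b) (by simp [hxb0, hpos.ne'])
        simp [hxb0] at this
    have hle := Nat.le_findGreatest (P := S) (hb _ ⟨_, hnew, rfl⟩) ⟨_, hnew, rfl⟩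
    omega

end KMDatum

/-! ### Special sets, and finite type versus finite parabolic subgroups. -/

namespace KMDatum

open Finset Matrix

variable {I V : Type*} [Fintype I] [NormedAddCommGroup V] [NormedSpace ℝ V]
variable {D : KMDatum I V}

/-! ### Special sets -/

/-- The nonnegative combination of the coroots with coefficients `c` is antidominant. -/
structure IsAnti (D : KMDatum I V) (c : I → ℝ) : Prop where
  nonneg : ∀ i, 0 ≤ c i
  le : ∀ j, ∑ i, c i * D.A i j ≤ 0

/-- The vectors of `exists_pos_isSubNull` for the components of `Θ` are glued. Different components
do not interact, and columns outside `Θ` contain only nonpositive entries. -/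
theorem exists_isAnti {Θ : Set I} (hΘ : D.IsSpecial Θ) :
    ∃ c, D.IsAnti c ∧ {i | 0 < c i} = Θ := by
  classical
  have h1 : ∀ i ∈ Θ, ∃ x, D.IsSubNull (D.comp Θ i) x ∧ ∀ k ∈ D.comp Θ i, 0 < x k := fun i hi =>
    exists_pos_isSubNull (conn_comp hi) (by rw [hΘ] at hi; exact hi.2)
  -- The vector is chosen as a function of the component, not of its element, so that all indices of
  -- a component use the same one.
  have h2 : ∀ K : Set I, ∃ x : I → ℝ, (∃ i ∈ Θ, K = D.comp Θ i) →
      D.IsSubNull K x ∧ ∀ k ∈ K, 0 < x k := by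
    intro K
    by_cases h : ∃ i ∈ Θ, K = D.comp Θ i
    · obtain ⟨i, hi, rfl⟩ := h
      obtain ⟨x, hx⟩ := h1 i hi
      exact ⟨x, fun _ => hx⟩
    · exact ⟨0, fun h' => absurd h' h⟩
  choose X hX using h2
  let c : I → ℝ := fun i => if i ∈ Θ then X (D.comp Θ i) i else 0
  have hpos : ∀ i ∈ Θ, 0 < c i := fun i hi => by
    simp only [c, if_pos hi]
    exact (hX _ ⟨i, hi, rfl⟩).2 i (mem_comp_self _ _)
  have hzero : ∀ i ∉ Θ, c i = 0 := fun i hi => by simp only [c, if_neg hi]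
  have hnn : ∀ i, 0 ≤ c i := fun i => by
    by_cases h : i ∈ Θ
    · exact (hpos i h).le
    · exact (hzero i h).ge
  refine ⟨c, ⟨hnn, fun j => ?_⟩, Set.ext fun i => ⟨fun h => ?_, fun h => hpos i h⟩⟩
  · by_cases hj : j ∈ Θ
    · have h3 := (hX (D.comp Θ j) ⟨j, hj, rfl⟩).1
      refine le_trans (sum_le_sum fun i _ => ?_) (h3.le j (mem_comp_self _ _))
      by_cases hi : i ∈ Θ
      · by_cases hij : i ∈ D.comp Θ j
        · simp only [c, if_pos hi, comp_eq_of_mem hij]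
          exact le_rfl
        · have : D.A i j = 0 := by
            by_contra h
            exact hij (mem_comp_of_adj hj (mem_comp_self _ _) hi fun h' => h (D.zero_symm _ _ h'))
          simp [this]
      · have : i ∉ D.comp Θ j := fun h => hi (comp_subset hj h)
        rw [hzero i hi, h3.zero i this]
    · refine sum_nonpos fun i _ => ?_
      rcases eq_or_ne i j with rfl | hij
      · rw [hzero i hj, zero_mul]
      · exact mul_nonpos_of_nonneg_of_nonpos (hnn i) (A_nonpos hij)
  · by_contra h'
    exact (ne_of_gt h) (hzero i h')

/-- On a component `K` of finite type there is `u > 0` with `A_K u > 0`. Then `cᵀ A_K u` is positive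
as `c > 0` on `K`, but at most zero as `c` is antidominant. -/
theorem IsAnti.isSpecial {c : I → ℝ} (hc : D.IsAnti c) : D.IsSpecial {i | 0 < c i} := by
  classical
  refine subset_antisymm (fun i hi => ⟨hi, fun hfin => ?_⟩) (inf_subset _)
  obtain ⟨-, ⟨u, hu, hAu⟩, -⟩ := hfin
  set Θ := {i | 0 < c i} with hΘ
  set K := D.comp Θ i with hK
  have h1 : 0 < ∑ k, if k ∈ K then c k * D.subMul K u k else 0 := by
    refine sum_pos' (fun k _ => ?_) ⟨i, mem_univ _, ?_⟩
    · split_ifs with h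
      · exact mul_nonneg (hc.nonneg k) (hAu k h).le
      · exact le_rfl
    · rw [if_pos (mem_comp_self _ _)]
      exact mul_pos hi (hAu i (mem_comp_self _ _))
  have h2 : (∑ k, if k ∈ K then c k * D.subMul K u k else 0) =
      ∑ j, if j ∈ K then u j * ∑ k, c k * D.A k j else 0 := by
    simp only [subMul_eq, mul_sum, ← sum_filter]
    rw [sum_comm' (t' := univ.filter (· ∈ K)) (s' := fun _ => univ.filter (· ∈ K))]
    · refine sum_congr rfl fun j hj => ?_
      simp only [mem_filter, mem_univ, true_and] at hj
      rw [← sum_subset (subset_univ (univ.filter (· ∈ K)))]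
      · exact sum_congr rfl fun k _ => by ring
      · intro k _ hk
        simp only [mem_filter, mem_univ, true_and] at hk
        by_cases hkΘ : 0 < c k
        · have : D.A k j = 0 := by
            by_contra h
            exact hk (mem_comp_of_adj hi hj hkΘ fun h' => h (D.zero_symm _ _ h'))
          simp [this]
        · rw [le_antisymm (not_lt.1 hkΘ) (hc.nonneg k)]; ring
    · intro x y
      simp only [mem_filter, mem_univ, true_and]
  have h3 : (∑ j, if j ∈ K then u j * ∑ k, c k * D.A k j else 0) ≤ 0 := by
    refine sum_nonpos fun j _ => ?_
    split_ifs with h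
    · exact mul_nonpos_of_nonneg_of_nonpos (hu j h).le (hc.le j)
    · exact le_rfl
  linarith

/-! ### Finite type and finite parabolic subgroups -/

/-- The coefficients of the sum of all positive roots serve as the positive vector. Since `s i`
permutes the positive roots other than `α i`, their sum vanishes on `h i`, and only `α i (h i) = 2`
remains. -/
theorem isFiniteType_of_finite {K : Set I} (hK : D.Conn K)
    (h : {β | β ∈ D.roots.rts K ∧ D.roots.Pos β}.Finite) : D.IsFiniteType K := by
  classical
  let P := D.roots
  let S := h.toFinset
  have hS : ∀ β, β ∈ S ↔ β ∈ P.rts K ∧ P.Pos β := fun β => h.mem_toFinset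
  have hsimple : ∀ i ∈ K, D.α i ∈ S := fun i hi =>
    (hS _).2 ⟨P.a_mem_rts hi, P.posOn_a trivial⟩
  have hpos : ∀ β ∈ S, P.PosOn K β := fun β hβ =>
    P.posOn_of_mem_rts ((hS β).1 hβ).1 ((hS β).1 hβ).2
  choose! c hc1 hc2 using hpos
  have hcs : ∀ i ∈ K, c (D.α i) i = 1 := by
    intro i hi
    have h1 : D.α i = ∑ j, (if j = i then (1 : ℝ) else 0) • D.α j := by simp
    have h2 := congrFun (P.coeff_unique ((hc2 _ (hsimple i hi)).symm.trans h1)) i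
    simpa using h2
  let u : I → ℝ := fun i => ∑ β ∈ S, (c β i : ℝ)
  have hsum : ∑ β ∈ S, β = ∑ i, u i • D.α i := by
    rw [sum_congr rfl fun β hβ => hc2 β hβ, sum_comm]
    simp only [u, sum_smul]
    rfl
  refine isFiniteType_of_pos hK (u := u) (fun i hi => ?_) fun i hi => ?_
  · refine sum_pos' (fun β _ => Nat.cast_nonneg _) ⟨_, hsimple i hi, ?_⟩
    rw [hcs i hi]; norm_num
  · have h1 : D.subMul K u i = (∑ β ∈ S, β) (D.h i) := by
      rw [hsum, subMul_eq, LinearMap.sum_apply]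
      refine sum_congr rfl fun j _ => ?_
      rw [LinearMap.smul_apply, D.pairing, smul_eq_mul]
      split_ifs with hj
      · ring
      · have : u j = 0 := sum_eq_zero fun β hβ => by rw [hc1 β hβ j hj]; simp
        rw [this, zero_mul]
    rw [h1, ← add_sum_erase _ _ (hsimple i hi), LinearMap.add_apply, D.pairing_self]
    set y := ∑ β ∈ S.erase (D.α i), β with hy
    have h2 : D.dact (D.s i) y = y := by
      rw [hy, map_sum]
      refine sum_bij' (fun β _ => D.dact (D.s i) β) (fun β _ => D.dact (D.s i) β) ?_ ?_ ?_ ?_ ?_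
      pick_goal 3
      · exact fun β _ => P.ρ_s_self i β
      pick_goal 3
      · exact fun β _ => P.ρ_s_self i β
      pick_goal 3
      · exact fun β _ => rfl
      all_goals
      · intro β hβ
        obtain ⟨hne, hβS⟩ := mem_erase.1 hβ
        obtain ⟨hβ1, hβ2⟩ := (hS β).1 hβS
        refine mem_erase.2 ⟨fun h' => ?_, (hS _).2 ⟨P.ρ_mem_rts (s_mem_par hi) hβ1, ?_⟩⟩
        · have h3 : β = -D.α i := by
            rw [← P.ρ_s_self i β]
            exact (congrArg (P.ρ (D.s i)) h').trans (P.ρ_s_a_self i)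
          rw [h3] at hβ2
          exact P.a_ne_zero i (RootRep.Pos.eq_zero (P.posOn_a trivial) hβ2)
        · obtain ⟨w, -, j, -, rfl⟩ := hβ1
          exact P.pos_s hβ2 hne
    rw [dact_s, sub_eq_self, smul_eq_zero] at h2
    rw [h2.resolve_right (D.roots.a_ne_zero i)]
    norm_num

/-- Take `i` where `u` is minimal on `S`. Two different neighbours `j`, `k` in `S` would give an
entry of at most `2 u i - u j - u k ≤ 0`. Thus the diagram is a forest, and every subset has a leaf
or an isolated vertex. -/
theorem subMul_leaf {J S : Set I} (hSJ : S ⊆ J) (hS : S.Nonempty) {u : I → ℝ}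
    (hu : ∀ i ∈ J, 0 < u i) (hAu : ∀ i ∈ J, 0 < D.subMul J u i) :
    ∃ i ∈ S, ∀ j ∈ S, ∀ k ∈ S, j ≠ i → k ≠ i → D.A i j ≠ 0 → D.A i k ≠ 0 → j = k := by
  classical
  obtain ⟨i, hi, hmin⟩ := Set.exists_min_image S u (Set.toFinite S) hS
  refine ⟨i, hi, fun j hj k hk hji hki hAj hAk => ?_⟩
  by_contra hjk
  have h1 := hAu i (hSJ hi)
  rw [subMul_eq] at h1
  have hA : ∀ l, l ≠ i → D.A i l ≠ 0 → (D.A i l : ℝ) ≤ -1 := fun l hl hne => by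
    have h2 := D.offDiag i l hl.symm
    have h3 : D.A i l ≤ -1 := by omega
    exact_mod_cast h3
  have h2 : ∑ l, (if l ∈ J then (D.A i l : ℝ) * u l else 0) ≤
      ∑ l, ((if l = i then 2 * u i else 0) + (if l = j then -u j else 0) +
        if l = k then -u k else 0) := by
    refine sum_le_sum fun l _ => ?_
    by_cases hl : l ∈ J
    · rw [if_pos hl]
      have hul := hu l hl
      rcases eq_or_ne l i with rfl | hli
      · rw [D.diag]; simp [hji.symm, hki.symm]
      · rcases eq_or_ne l j with rfl | hlj
        · simp only [hli, if_false, if_true, hjk, zero_add, add_zero]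
          nlinarith [hA l hli hAj]
        · rcases eq_or_ne l k with rfl | hlk
          · simp only [hli, if_false, if_true, hlj, zero_add]
            nlinarith [hA l hli hAk]
          · simp only [hli, hlj, hlk, if_false, add_zero]
            exact mul_nonpos_of_nonpos_of_nonneg (A_nonpos hli.symm) hul.le
    · have h3 : l ≠ i := by rintro rfl; exact hl (hSJ hi)
      have h4 : l ≠ j := by rintro rfl; exact hl (hSJ hj)
      have h5 : l ≠ k := by rintro rfl; exact hl (hSJ hk)
      simp [hl, h3, h4, h5]
  simp only [sum_add_distrib, sum_ite_eq', mem_univ, if_true] at h2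
  linarith [hmin j hj, hmin k hk]

/-- Remove a leaf and use induction. Its single edge imposes one condition, which fixes the new
scaling factor. -/
theorem exists_symmetrizer {J : Set I} {u : I → ℝ}
    (hu : ∀ i ∈ J, 0 < u i) (hAu : ∀ i ∈ J, 0 < D.subMul J u i) (S : Finset I) (hS : ↑S ⊆ J) :
    ∃ d : I → ℝ, (∀ i ∈ S, 0 < d i) ∧ ∀ i ∈ S, ∀ j ∈ S, d i * D.A i j = d j * D.A j i := by
  classical
  induction hn : S.card generalizing S with
  | zero =>
    rw [Finset.card_eq_zero] at hn
    subst hn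
    exact ⟨0, by simp, by simp⟩
  | succ n ih =>
    have hne : (S : Set I).Nonempty := by
      rw [Finset.coe_nonempty, ← Finset.card_pos]; omega
    obtain ⟨i, hi, hleaf⟩ := subMul_leaf hS hne hu hAu
    rw [Finset.mem_coe] at hi
    obtain ⟨d, hd, hdA⟩ := ih (S.erase i)
      (fun j hj => hS (mem_of_mem_erase (Finset.mem_coe.1 hj))) (by rw [card_erase_of_mem hi]; omega)
    obtain ⟨x, hx, hxA⟩ : ∃ x : ℝ, 0 < x ∧ ∀ j ∈ S, j ≠ i → x * D.A i j = d j * D.A j i := by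
      by_cases h : ∃ j ∈ S, j ≠ i ∧ D.A i j ≠ 0
      · obtain ⟨j, hj, hji, hA⟩ := h
        have hA' : D.A j i ≠ 0 := fun h' => hA (D.zero_symm _ _ h')
        have h1 : (D.A i j : ℝ) < 0 := lt_of_le_of_ne (A_nonpos hji.symm) (by exact_mod_cast hA)
        have h2 : (D.A j i : ℝ) < 0 := lt_of_le_of_ne (A_nonpos hji) (by exact_mod_cast hA')
        refine ⟨d j * D.A j i / D.A i j, div_pos_of_neg_of_neg
          (mul_neg_of_pos_of_neg (hd j (mem_erase.2 ⟨hji, hj⟩)) h2) h1, fun k hk hki => ?_⟩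
        by_cases hAk : D.A i k = 0
        · rw [hAk, D.zero_symm _ _ hAk]; simp
        · rw [← hleaf j hj k hk hji hki hA hAk, div_mul_cancel₀ _ h1.ne]
      · push Not at h
        exact ⟨1, one_pos, fun j hj hji => by
          rw [h j hj hji, D.zero_symm _ _ (h j hj hji)]; simp⟩
    refine ⟨Function.update d i x, fun j hj => ?_, fun j hj k hk => ?_⟩
    · rcases eq_or_ne j i with rfl | hji
      · simpa using hx
      · rw [Function.update_of_ne hji]; exact hd j (mem_erase.2 ⟨hji, hj⟩)
    · rcases eq_or_ne j i with rfl | hji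
      · rcases eq_or_ne k j with rfl | hki
        · rfl
        · rw [Function.update_self, Function.update_of_ne hki]; exact hxA k hk hki
      · rcases eq_or_ne k i with rfl | hki
        · rw [Function.update_self, Function.update_of_ne hji]; exact (hxA j hj hji).symm
        · rw [Function.update_of_ne hki, Function.update_of_ne hji]
          exact hdA j (mem_erase.2 ⟨hji, hj⟩) k (mem_erase.2 ⟨hki, hk⟩)

/-- The symmetrized matrix `B` defines a form on coefficient vectors supported on `J`. It is
invariant under the reflections and bounded below by a diagonal form with positive entries on `J`.
Roots have integral coefficients and bounded form values, so there are finitely many. -/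
theorem rts_finite_of_pos {J : Set I} {u : I → ℝ} (hu : ∀ i ∈ J, 0 < u i)
    (hAu : ∀ i ∈ J, 0 < D.subMul J u i) : (D.roots.rts J).Finite := by
  classical
  obtain ⟨d, hd, hdA⟩ := exists_symmetrizer hu hAu (univ.filter (· ∈ J)) (by simp)
  simp only [mem_filter, mem_univ, true_and] at hd hdA
  obtain ⟨B, hB⟩ : ∃ B : Matrix I I ℝ,
      ∀ i j, B i j = if i ∈ J ∧ j ∈ J then d i * (D.A i j : ℝ) else 0 :=
    ⟨Matrix.of fun i j => if i ∈ J ∧ j ∈ J then d i * (D.A i j : ℝ) else 0, fun _ _ => rfl⟩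
  have hBsymm : Bᵀ = B := by
    ext i j
    simp only [transpose_apply, hB, and_comm (a := j ∈ J)]
    split_ifs with h
    · exact hdA j h.2 i h.1
    · rfl
  have hBc : ∀ c : I → ℝ, (∀ i ∉ J, c i = 0) → ∀ k ∈ J,
      (B *ᵥ c) k = d k * ∑ j, (D.A k j : ℝ) * c j := by
    intro c hc k hk
    simp only [mulVec, dotProduct, mul_sum]
    refine sum_congr rfl fun j _ => ?_
    by_cases hj : j ∈ J
    · simp only [hB, hk, hj, and_self, if_true]; ring
    · simp [hc j hj]
  have hinv : ∀ c : I → ℝ, (∀ i ∉ J, c i = 0) → ∀ k ∈ J,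
      (c - Pi.single k (∑ j, (D.A k j : ℝ) * c j)) ⬝ᵥ
        B *ᵥ (c - Pi.single k (∑ j, (D.A k j : ℝ) * c j)) = c ⬝ᵥ B *ᵥ c := by
    intro c hc k hk
    have h1 := hBc c hc k hk
    set t := ∑ j, (D.A k j : ℝ) * c j
    have h2 : c ⬝ᵥ B *ᵥ Pi.single k t = Pi.single k t ⬝ᵥ B *ᵥ c := by
      rw [dotProduct_mulVec, ← mulVec_transpose, hBsymm, dotProduct_comm]
    have h3 : (B *ᵥ Pi.single k t) k = 2 * d k * t := by
      rw [mulVec_single]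
      simp only [hB, Pi.smul_apply, col_apply, hk, and_self, if_true, D.diag, MulOpposite.smul_eq_mul_unop,
        MulOpposite.unop_op]
      push_cast
      ring
    rw [mulVec_sub, dotProduct_sub, sub_dotProduct, sub_dotProduct, h2, single_dotProduct,
      single_dotProduct, h1, h3]
    ring
  -- Extending `u` by `1` outside `J` only makes the divisions below legitimate; `B` does not see
  -- these entries.
  let v : I → ℝ := fun i => if i ∈ J then u i else 1
  have hv : ∀ i, 0 < v i := fun i => by
    simp only [v]; split_ifs with h
    exacts [hu i h, one_pos]
  have hBv : ∀ i, (B *ᵥ v) i = if i ∈ J then d i * D.subMul J u i else 0 := by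
    intro i
    split_ifs with hi
    · rw [subMul_eq, mul_sum]
      refine sum_congr rfl fun j _ => ?_
      by_cases hj : j ∈ J
      · simp only [hB, v, hi, hj, and_self, if_true]; ring
      · simp [hB, hj]
    · exact sum_eq_zero fun j _ => by simp [hB, hi]
  -- Off the diagonal `B i j ≤ 0`, so the inequality `2 c i c j ≤ c i ^ 2 v j / v i + c j ^ 2 v i /
  -- v j` bounds the form from below; on the diagonal equality holds.
  have hpos : ∀ c : I → ℝ, ∑ i, c i ^ 2 / v i * (B *ᵥ v) i ≤ c ⬝ᵥ B *ᵥ c := by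
    intro c
    have h1 : ∑ i, c i ^ 2 / v i * (B *ᵥ v) i = ∑ i, ∑ j, B i j * (c i ^ 2 * v j / v i) := by
      refine sum_congr rfl fun i _ => ?_
      rw [mulVec, dotProduct, mul_sum]
      exact sum_congr rfl fun j _ => by ring
    have h2 : ∑ i, ∑ j, B i j * (c i ^ 2 * v j / v i) =
        ∑ i, ∑ j, B i j * (c j ^ 2 * v i / v j) := by
      rw [sum_comm]
      refine sum_congr rfl fun i _ => sum_congr rfl fun j _ => ?_
      have : B j i = B i j := congrFun (congrFun hBsymm i) j
      rw [this]
    have h3 : c ⬝ᵥ B *ᵥ c = ∑ i, ∑ j, B i j * (c i * c j) := by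
      simp only [dotProduct, mulVec, mul_sum]
      exact sum_congr rfl fun i _ => sum_congr rfl fun j _ => by ring
    have h4 : ∑ i, ∑ j, (B i j * (c i ^ 2 * v j / v i) + B i j * (c j ^ 2 * v i / v j)) ≤
        ∑ i, ∑ j, (2 : ℝ) * (B i j * (c i * c j)) := by
      refine sum_le_sum fun i _ => sum_le_sum fun j _ => ?_
      have hvi := hv i
      have hvj := hv j
      rcases eq_or_ne i j with rfl | hij
      · refine le_of_eq ?_
        field_simp
        ring
      · have hBn : B i j ≤ 0 := by
          simp only [hB]; split_ifs with h
          · exact mul_nonpos_of_nonneg_of_nonpos (hd i h.1).le (A_nonpos hij)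
          · exact le_rfl
        have h5 : 2 * (c i * c j) ≤ c i ^ 2 * v j / v i + c j ^ 2 * v i / v j := by
          rw [div_add_div _ _ hvi.ne' hvj.ne', le_div_iff₀ (mul_pos hvi hvj)]
          nlinarith [sq_nonneg (c i * v j - c j * v i)]
        nlinarith
    simp only [sum_add_distrib, ← mul_sum] at h4
    rw [h1, h3]
    linarith
  -- The form takes the value `2 d j` at the simple root of `j ∈ J`, and by invariance at its whole
  -- orbit. Absolute values are needed since nothing is known of `d` outside `J`.
  let C := ∑ j, |2 * d j|
  have hroot : ∀ β ∈ D.roots.rts J, ∃ c : I → ℤ, (∀ i ∉ J, c i = 0) ∧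
      β = ∑ i, (c i : ℝ) • D.α i ∧ (fun i => (c i : ℝ)) ⬝ᵥ B *ᵥ (fun i => (c i : ℝ)) ≤ C := by
    rintro _ ⟨w, hw, j, hj, rfl⟩
    obtain ⟨l, hl, rfl⟩ := exists_word_of_mem_par hw
    clear hw
    induction l with
    | nil =>
      refine ⟨Pi.single j 1, fun i hi => ?_, ?_, ?_⟩
      · exact Pi.single_eq_of_ne (by rintro rfl; exact hi hj) _
      · simp only [List.map_nil, List.prod_nil, RootRep.ρ_one, Pi.single_apply]
        simp [roots]
      · have h1 : (fun i => ((Pi.single j 1 : I → ℤ) i : ℝ)) = Pi.single j 1 := by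
          funext i; simp [Pi.single_apply]
        have h2 : B j j = 2 * d j := by simp [hB, hj, D.diag]; ring
        rw [h1, single_dotProduct, mulVec_single_one, col_apply, h2, one_mul]
        exact (le_abs_self _).trans
          (single_le_sum (f := fun j => |2 * d j|) (fun i _ => abs_nonneg _) (mem_univ j))
    | cons k l ih =>
      obtain ⟨c, hc1, hc2, hc3⟩ := ih fun i hi => hl i (List.mem_cons_of_mem _ hi)
      have hk : k ∈ J := hl k List.mem_cons_self
      have hcast : (fun i => ((c - Pi.single k (∑ j, D.A k j * c j) : I → ℤ) i : ℝ)) =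
          (fun i => (c i : ℝ)) - Pi.single k (∑ j, (D.A k j : ℝ) * c j) := by
        funext i
        rcases eq_or_ne i k with rfl | hik
        · simp
        · simp [Pi.single_eq_of_ne hik]
      refine ⟨c - Pi.single k (∑ j, D.A k j * c j), fun i hi => ?_, ?_, ?_⟩
      · have : i ≠ k := by rintro rfl; exact hi hk
        simp [hc1 i hi, Pi.single_eq_of_ne this]
      · obtain ⟨e, he⟩ : ∃ e : I → ℝ, e = Pi.single k (∑ j, (D.A k j : ℝ) * c j) := ⟨_, rfl⟩
        rw [← he] at hcast
        have h5 : ∑ i, e i • D.α i = (∑ j, (D.A k j : ℝ) * c j) • D.α k := by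
          rw [sum_eq_single k]
          · rw [he, Pi.single_eq_same]
          · intro i _ hi; rw [he, Pi.single_eq_of_ne hi, zero_smul]
          · simp
        have h6 : D.roots.pair (∑ i, (c i : ℝ) • D.α i) (D.roots.b k) =
            ∑ j, (D.A k j : ℝ) * c j := by
          change (∑ i, (c i : ℝ) • D.α i) (D.h k) = _
          rw [LinearMap.sum_apply]
          exact sum_congr rfl fun i _ => by
            rw [LinearMap.smul_apply, D.pairing, smul_eq_mul, mul_comm]
        have h7 : ∀ i, ((c - Pi.single k (∑ j, D.A k j * c j) : I → ℤ) i : ℝ) • D.α i =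
            (c i : ℝ) • D.α i - e i • D.α i := fun i =>
          (congrArg (· • D.α i) (congrFun hcast i)).trans (sub_smul (c i : ℝ) (e i) (D.α i))
        rw [List.map_cons, List.prod_cons, RootRep.ρ_mul, hc2, RootRep.ρ_s, h6,
          sum_congr rfl fun i _ => h7 i, sum_sub_distrib, h5]
        rfl
      · rw [hcast, hinv _ (fun i hi => by rw [hc1 i hi]; simp) k hk]
        exact hc3
  -- For an integer, `|c i| ≤ c i ^ 2`, so the bound on the squares is also a bound on the
  -- coefficients.
  let R : I → ℤ := fun i => if i ∈ J then ⌈C / (d i * D.subMul J u i / v i)⌉ else 0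
  refine ((Set.finite_Icc (-R) R).image fun c : I → ℤ => ∑ i, (c i : ℝ) • D.α i).subset ?_
  intro β hβ
  obtain ⟨c, hc1, rfl, hc3⟩ := hroot β hβ
  have key : ∀ i, |c i| ≤ R i := by
    intro i
    by_cases hi : i ∈ J
    · have hm : 0 < d i * D.subMul J u i / v i := div_pos (mul_pos (hd i hi) (hAu i hi)) (hv i)
      have h1 : (c i : ℝ) ^ 2 * (d i * D.subMul J u i / v i) ≤ C := by
        refine le_trans ?_ ((hpos _).trans hc3)
        refine le_trans (le_of_eq ?_) (single_le_sum (fun j _ => ?_) (mem_univ i))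
        · rw [hBv, if_pos hi]; ring
        · rw [hBv]
          have := hv j
          split_ifs with hj
          · have := hd j hj
            have := hAu j hj
            positivity
          · simp
      have h2 : (c i : ℝ) ^ 2 ≤ C / (d i * D.subMul J u i / v i) := (le_div_iff₀ hm).2 h1
      simp only [R, if_pos hi]
      have h3 : |c i| ≤ c i ^ 2 := by
        rw [← sq_abs]
        rcases eq_or_ne (c i) 0 with h | h
        · simp [h]
        · have := Int.one_le_abs h
          nlinarith
      have h4 : ((|c i| : ℤ) : ℝ) ≤ (c i : ℝ) ^ 2 := by exact_mod_cast h3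
      exact_mod_cast h4.trans (h2.trans (Int.le_ceil _))
    · simp [R, hi, hc1 i hi]
  exact ⟨c, ⟨fun i => (abs_le.1 (key i)).1, fun i => (abs_le.1 (key i)).2⟩, rfl⟩

theorem par_finite_of_fin {J : Set I} (hJ : D.fin J = J) : (D.par J : Set D.W).Finite := by
  classical
  have h1 : ∀ K : Set I, ∃ u : I → ℝ, (∃ i ∈ J, K = D.comp J i) →
      (∀ i ∈ K, 0 < u i) ∧ ∀ i ∈ K, 0 < D.subMul K u i := by
    intro K
    by_cases h : ∃ i ∈ J, K = D.comp J i
    · obtain ⟨i, hi, rfl⟩ := h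
      rw [← hJ] at hi
      obtain ⟨u, hu⟩ := hi.2.2.1
      exact ⟨u, fun _ => hu⟩
    · exact ⟨0, fun h' => absurd h' h⟩
  choose U hU using h1
  refine D.roots.par_finite (rts_finite_of_pos (u := fun i => U (D.comp J i) i)
    (fun i hi => (hU _ ⟨i, hi, rfl⟩).1 i (mem_comp_self _ _)) fun i hi => ?_)
  have h2 := (hU _ ⟨i, hi, rfl⟩).2 i (mem_comp_self _ _)
  rw [subMul_eq] at h2 ⊢
  refine h2.trans_eq (sum_congr rfl fun j _ => ?_)
  by_cases hj : j ∈ J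
  · by_cases hij : j ∈ D.comp J i
    · rw [if_pos hij, if_pos hj, comp_eq_of_mem hij]
    · have : D.A i j = 0 := by
        by_contra h
        exact hij (mem_comp_of_adj hi (mem_comp_self _ _) hj h)
      simp [this]
  · have : j ∉ D.comp J i := fun h => hj (comp_subset hi h)
    rw [if_neg hj, if_neg this]

end KMDatum

/-! ### The Tits cone in the dual space and its special faces. -/

namespace KMDatum

open Finset

variable {I V : Type*} [Fintype I] [NormedAddCommGroup V] [NormedSpace ℝ V]
variable {D : KMDatum I V}

/-! ### Existence of points with prescribed values -/

theorem exists_dual (D : KMDatum I V) (f : I → ℝ) : ∃ l : Module.Dual ℝ V, ∀ i, l (D.h i) = f i := by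
  obtain ⟨g, hg⟩ := LinearMap.exists_extend ((Module.Basis.span D.h_indep).constr ℝ f)
  refine ⟨g, fun i => ?_⟩
  have h1 := LinearMap.congr_fun hg (Module.Basis.span D.h_indep i)
  rw [Module.Basis.constr_basis] at h1
  rw [← h1, LinearMap.comp_apply, Submodule.subtype_apply, Module.Basis.span_apply]

/-- A functional killing the image of `V` in `I → ℝ` would be a linear relation between the roots.
-/
theorem exists_point (D : KMDatum I V) (f : I → ℝ) : ∃ v : V, ∀ i, D.α i v = f i := by
  classical
  have h1 : LinearMap.range (LinearMap.pi D.α) = ⊤ := by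
    by_contra h
    obtain ⟨g, hg, hle⟩ := Submodule.exists_le_ker_of_lt_top _ (lt_top_iff_ne_top.2 h)
    refine hg (LinearMap.pi_ext' fun i => ?_)
    have h2 : ∑ i, g (Pi.single i 1) • D.α i = 0 := by
      ext v
      have h3 : g (LinearMap.pi D.α v) = 0 := hle ⟨v, rfl⟩
      rw [pi_eq_sum_univ' (LinearMap.pi D.α v), map_sum] at h3
      rw [LinearMap.sum_apply, LinearMap.zero_apply, ← h3]
      refine sum_congr rfl fun i _ => ?_
      rw [map_smul, LinearMap.smul_apply, smul_eq_mul, smul_eq_mul, mul_comm]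
      rfl
    have h4 := congrFun (D.roots.sum_eq_zero_coeff (c := fun i => g (Pi.single i 1)) h2) i
    ext
    simpa using h4
  obtain ⟨v, hv⟩ := LinearMap.range_eq_top.1 h1 f
  exact ⟨v, fun i => congrFun hv i⟩

/-- A point of the open facet of type `J` of the fundamental chamber in the dual space. -/
noncomputable def gen (D : KMDatum I V) (J : Set I) : Module.Dual ℝ V :=
  open Classical in (D.exists_dual fun i => if i ∈ J then 0 else 1).choose

theorem gen_h_of_mem {J : Set I} {i : I} (hi : i ∈ J) : D.gen J (D.h i) = 0 := by
  classical
  exact ((D.exists_dual fun i => if i ∈ J then 0 else 1).choose_spec i).trans (if_pos hi)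

theorem gen_h_of_notMem {J : Set I} {i : I} (hi : i ∉ J) : D.gen J (D.h i) = 1 := by
  classical
  exact ((D.exists_dual fun i => if i ∈ J then 0 else 1).choose_spec i).trans (if_neg hi)

theorem gen_mem (J : Set I) : D.gen J ∈ D.closedFacet J :=
  ⟨fun _ hi => gen_h_of_mem hi, fun _ hi => by rw [gen_h_of_notMem hi]; exact zero_le_one⟩

theorem gen_zero (J : Set I) : {k | D.gen J (D.h k) = 0} = J := by
  ext k
  refine ⟨fun h => ?_, fun h => gen_h_of_mem h⟩
  by_contra hk
  have h' : D.gen J (D.h k) = 0 := h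
  rw [gen_h_of_notMem hk] at h'
  exact one_ne_zero h'

/-! ### The Tits cone -/

theorem closedFacet_subset (J : Set I) : D.closedFacet J ⊆ D.chamber := fun l hl i => by
  by_cases h : i ∈ J
  · exact (hl.1 i h).ge
  · exact hl.2 i h

theorem chamber_iff {l : Module.Dual ℝ V} : l ∈ D.chamber ↔ D.coroots.Dom Set.univ l :=
  ⟨fun h i _ => h i, fun h i => h i trivial⟩

theorem orbit_eq_tits : D.orbit D.chamber = D.coroots.tits := by
  ext l
  constructor
  · rintro ⟨w, m, hm, rfl⟩
    exact ⟨w, m, chamber_iff.1 hm, rfl⟩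
  · rintro ⟨w, m, hm, rfl⟩
    exact ⟨w, m, chamber_iff.2 hm, rfl⟩

theorem coe_tits : (D.tits : Set (Module.Dual ℝ V)) = D.orbit D.chamber := by
  refine subset_antisymm (fun l hl => ?_) PointedCone.subset_hull
  rw [orbit_eq_tits]
  have hl' : l ∈ PointedCone.hull ℝ (D.orbit D.chamber) := hl
  refine Submodule.span_induction (p := fun x _ => x ∈ D.coroots.tits) ?_ ?_ ?_ ?_ hl'
  · intro x hx
    rwa [← orbit_eq_tits]
  · exact ⟨1, 0, fun i _ => by simp, by simp⟩
  · exact fun x y _ _ hx hy => D.coroots.add_mem_tits hx hy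
  · exact fun a x _ hx => D.coroots.smul_mem_tits hx a.2

theorem mem_tits {l : Module.Dual ℝ V} : l ∈ D.tits ↔ ∃ w, ∃ m ∈ D.chamber, l = D.dact w m := by
  rw [← SetLike.mem_coe, coe_tits]; rfl

theorem mem_tits_of_chamber {l : Module.Dual ℝ V} (h : l ∈ D.chamber) : l ∈ D.tits :=
  mem_tits.2 ⟨1, l, h, (D.dact_one l).symm⟩

theorem dact_mem_tits {l : Module.Dual ℝ V} (w : D.W) : D.dact w l ∈ D.tits ↔ l ∈ D.tits := by
  have : ∀ w : D.W, ∀ l, l ∈ D.tits → D.dact w l ∈ D.tits := by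
    intro w l hl
    obtain ⟨u, m, hm, rfl⟩ := mem_tits.1 hl
    exact mem_tits.2 ⟨w * u, m, hm, (D.dact_mul w u m).symm⟩
  exact ⟨fun h => by rw [← D.dact_inv_dact w l]; exact this _ _ h, this w l⟩

theorem dact_eq_of_chamber {w : D.W} {m : Module.Dual ℝ V} (h1 : m ∈ D.chamber)
    (h2 : D.dact w m ∈ D.chamber) : D.dact w m = m ∧ w ∈ D.par {k | m (D.h k) = 0} := by
  have := D.coroots.ν_eq_self_of_dom (K := Set.univ) (w := w) (by rw [par_univ]; trivial)
    (chamber_iff.1 h1) (chamber_iff.1 h2)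
  refine ⟨this.1, ?_⟩
  have h3 := this.2
  simp only [Set.mem_univ, true_and] at h3
  exact h3

theorem dact_eq_self {J : Set I} {l : Module.Dual ℝ V} (h : ∀ j ∈ J, l (D.h j) = 0) {w : D.W}
    (hw : w ∈ D.par J) : D.dact w l = l := D.coroots.ν_eq_self_of_mem_par h hw

/-! ### Commuting parabolic subgroups -/

theorem s_commute {i j : I} (h : D.A i j = 0) : D.s i * D.s j = D.s j * D.s i := by
  refine D.roots.mul_s_eq_s_mul ?_
  have : D.roots.B i j = 0 := h
  rw [RootRep.ρ_s_a, this]; simp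

theorem s_commute_par {K : Set I} {i : I} (hi : i ∈ D.perp K) {g : D.W} (hg : g ∈ D.par K) :
    D.s i * g = g * D.s i := by
  obtain ⟨l, hl, rfl⟩ := exists_word_of_mem_par hg
  clear hg
  induction l with
  | nil => simp
  | cons j l ih =>
    rw [List.map_cons, List.prod_cons, ← mul_assoc, s_commute (hi j (hl j List.mem_cons_self)),
      mul_assoc, ih fun k hk => hl k (List.mem_cons_of_mem _ hk), mul_assoc]

theorem par_commute {K L : Set I} (hL : L ⊆ D.perp K) {b g : D.W} (hb : b ∈ D.par L)
    (hg : g ∈ D.par K) : b * g = g * b := by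
  obtain ⟨l, hl, rfl⟩ := exists_word_of_mem_par hb
  clear hb
  induction l with
  | nil => simp
  | cons j l ih =>
    rw [List.map_cons, List.prod_cons, mul_assoc, ih fun k hk => hl k (List.mem_cons_of_mem _ hk),
      ← mul_assoc, s_commute_par (hL (hl j List.mem_cons_self)) hg, mul_assoc]

theorem mem_par_union {K L : Set I} (hL : L ⊆ D.perp K) {w : D.W} (hw : w ∈ D.par (K ∪ L)) :
    ∃ b ∈ D.par L, ∃ a ∈ D.par K, w = b * a := by
  obtain ⟨l, hl, rfl⟩ := exists_word_of_mem_par hw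
  clear hw
  induction l with
  | nil => exact ⟨1, one_mem _, 1, one_mem _, by simp⟩
  | cons j l ih =>
    obtain ⟨b, hb, a, ha, h⟩ := ih fun k hk => hl k (List.mem_cons_of_mem _ hk)
    rw [List.map_cons, List.prod_cons, h]
    rcases hl j List.mem_cons_self with hj | hj
    · refine ⟨b, hb, D.s j * a, mul_mem (s_mem_par hj) ha, ?_⟩
      rw [← mul_assoc, s_commute_par (mem_perp_comm.1 hL hj) hb, mul_assoc]
    · exact ⟨D.s j * b, mul_mem (s_mem_par hj) hb, a, ha, (mul_assoc _ _ _).symm⟩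

/-! ### Antidominant combinations of coroots -/

/-- The combination of the coroots with coefficients `c`. -/
noncomputable def hc (D : KMDatum I V) (c : I → ℝ) : V := ∑ i, c i • D.h i

theorem apply_hc (l : Module.Dual ℝ V) (c : I → ℝ) : l (D.hc c) = ∑ i, c i * l (D.h i) := by
  simp [hc]

theorem α_hc (j : I) (c : I → ℝ) : D.α j (D.hc c) = ∑ i, c i * D.A i j := by
  simp [apply_hc, D.pairing]

theorem IsAnti.pos_apply {c : I → ℝ} (hc : D.IsAnti c) {β : Module.Dual ℝ V}
    (hβ : D.roots.Pos β) : β (D.hc c) ≤ 0 := by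
  obtain ⟨d, -, rfl⟩ := hβ
  rw [LinearMap.sum_apply]
  refine sum_nonpos fun i _ => ?_
  rw [LinearMap.smul_apply]
  refine mul_nonpos_of_nonneg_of_nonpos (Nat.cast_nonneg _) ?_
  change D.α i (D.hc c) ≤ 0
  rw [α_hc]
  exact hc.le i

theorem exists_eq_s_mul {w : D.W} (hw : w ≠ 1) :
    ∃ i u, w = D.s i * u ∧ D.len w = D.len u + 1 := by
  obtain ⟨u, i, h, hu⟩ := exists_eq_mul_s (inv_ne_one.2 hw)
  refine ⟨i, u⁻¹, ?_, by rw [len_inv, ← hu, len_inv]⟩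
  rw [← inv_inv w, h, mul_inv_rev, s_inv]

/-- Multiply by simple reflections that increase the length. Then `α i` is at most zero on the
vector reached so far, so reflecting can only raise the coefficient of `h i`. If this coefficient
becomes positive, `s i` joins `g`. If it stays zero, `i` is orthogonal to the current support, so `s
i` commutes with `g` and joins `b`. -/
theorem IsAnti.exists_act {c : I → ℝ} (hc : D.IsAnti c) (w : D.W) :
    ∃ d : I → ℝ, (∀ i, c i ≤ d i) ∧ w.1 (D.hc c) = D.hc d ∧
      ∃ g ∈ D.par {i | 0 < d i}, ∃ b ∈ D.par (D.perp {i | 0 < c i}), w = g * b := by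
  classical
  induction hn : D.len w generalizing w with
  | zero =>
    rw [eq_one_of_len hn]
    exact ⟨c, fun _ => le_rfl, rfl, 1, one_mem _, 1, one_mem _, by simp⟩
  | succ n ih =>
    have hw : w ≠ 1 := by rintro rfl; rw [len_one] at hn; omega
    obtain ⟨i, u, rfl, hu⟩ := exists_eq_s_mul hw
    obtain ⟨d, hcd, hud, g, hg, b, hb, rfl⟩ := ih u (by omega)
    set u := g * b
    have hpos : D.roots.Pos (D.roots.ρ u⁻¹ (D.α i)) := by
      refine D.roots.pos_of_len_le (w := u⁻¹) (i := i) ?_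
      have : u⁻¹ * D.s i = (D.s i * u)⁻¹ := by rw [mul_inv_rev (D.s i) u, s_inv]
      rw [this, len_inv, len_inv, hu]
      omega
    have hx : D.α i (D.hc d) ≤ 0 := by
      have h1 := hc.pos_apply hpos
      rw [← hud]
      have h2 := D.roots.pair_ν u (D.α i) (D.hc c)
      exact h2.trans_le h1
    set x := D.α i (D.hc d)
    set d' : I → ℝ := fun j => d j + if j = i then -x else 0 with hd'
    have hdd' : ∀ j, d j ≤ d' j := fun j => by
      simp only [hd']; split_ifs <;> linarith
    have hact : (D.s i * u).1 (D.hc c) = D.hc d' := by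
      rw [W_mul_apply, hud, s_apply]
      simp only [KMDatum.hc, hd', add_smul, sum_add_distrib, ite_smul, zero_smul, sum_ite_eq',
        mem_univ, if_true, neg_smul, sub_eq_add_neg]
      rfl
    have hsub : {j | 0 < d j} ⊆ {j | 0 < d' j} := fun j hj => lt_of_lt_of_le hj (hdd' j)
    refine ⟨d', fun j => (hcd j).trans (hdd' j), hact, ?_⟩
    by_cases hi : 0 < d' i
    · exact ⟨D.s i * g, mul_mem (s_mem_par hi) (par_mono hsub hg), b, hb, (mul_assoc _ _ _).symm⟩
    · have hdi := (hc.nonneg i).trans (hcd i)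
      have hx0 : d' i = d i - x := by simp [hd']; ring
      have h1 : d i = 0 := by linarith
      have h2 : x = 0 := by linarith
      have h3 : ∀ j, 0 < d j → D.A i j = 0 := by
        intro j hj
        have h4 : ∀ k ∈ univ, d k * (D.A k i : ℝ) ≤ 0 := fun k _ => by
          rcases eq_or_ne k i with rfl | hk
          · rw [h1, zero_mul]
          · exact mul_nonpos_of_nonneg_of_nonpos ((hc.nonneg k).trans (hcd k)) (A_nonpos hk)
        have h5 : ∑ k, d k * (D.A k i : ℝ) = 0 := by rw [← α_hc]; exact h2
        have h6 := (sum_eq_zero_iff_of_nonpos h4).1 h5 j (mem_univ j)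
        refine D.zero_symm _ _ ?_
        exact_mod_cast (mul_eq_zero.1 h6).resolve_left hj.ne'
      refine ⟨g, par_mono hsub hg, D.s i * b, mul_mem (s_mem_par fun j hj => ?_) hb, ?_⟩
      · exact h3 j (lt_of_lt_of_le hj (hcd j))
      · rw [← mul_assoc, ← mul_assoc, s_commute_par (K := {j | 0 < d j}) h3 hg]

theorem IsAnti.nonneg_of_mem_tits {c : I → ℝ} (hc : D.IsAnti c) {l : Module.Dual ℝ V}
    (hl : l ∈ D.tits) : 0 ≤ l (D.hc c) := by
  obtain ⟨w, m, hm, rfl⟩ := mem_tits.1 hl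
  obtain ⟨d, hd, hwd, -⟩ := hc.exists_act w⁻¹
  rw [dact_apply, hwd, apply_hc]
  exact sum_nonneg fun i _ => mul_nonneg ((hc.nonneg i).trans (hd i)) (hm i)

/-- This exhibits `R(Θ)` as an exposed face. If `w m` with `m` dominant is killed by the vector,
then `m` vanishes on the support of the transformed coefficients. In `w⁻¹ = g b` the factor `g`
therefore fixes `m`, and `b ∈ W_{Θ^⊥}` is all that is left. -/
theorem IsAnti.mem_specialFace {c : I → ℝ} (hc : D.IsAnti c) {l : Module.Dual ℝ V} :
    l ∈ D.specialFace {i | 0 < c i} ↔ l ∈ D.tits ∧ l (D.hc c) = 0 := by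
  constructor
  · rintro ⟨w, hw, m, hm, rfl⟩
    refine ⟨mem_tits.2 ⟨w, m, closedFacet_subset _ hm, rfl⟩, ?_⟩
    have h1 : w⁻¹.1 (D.hc c) = D.hc c := by
      refine D.roots.ν_eq_self_of_mem_par (fun j hj => ?_) (inv_mem hw)
      change D.α j (D.hc c) = 0
      rw [α_hc]
      refine sum_eq_zero fun i _ => ?_
      by_cases hi : 0 < c i
      · rw [D.zero_symm _ _ (hj i hi)]; simp
      · rw [le_antisymm (not_lt.1 hi) (hc.nonneg i), zero_mul]
    rw [dact_apply, h1, apply_hc]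
    refine sum_eq_zero fun i _ => ?_
    by_cases hi : 0 < c i
    · rw [hm.1 i hi, mul_zero]
    · rw [le_antisymm (not_lt.1 hi) (hc.nonneg i), zero_mul]
  · rintro ⟨hl, h0⟩
    obtain ⟨w, m, hm, rfl⟩ := mem_tits.1 hl
    obtain ⟨d, hd, hwd, g, hg, b, hb, hgb⟩ := hc.exists_act w⁻¹
    rw [dact_apply, hwd, apply_hc] at h0
    have hnn : ∀ i ∈ univ, 0 ≤ d i * m (D.h i) := fun i _ =>
      mul_nonneg ((hc.nonneg i).trans (hd i)) (hm i)
    have h1 : ∀ i, 0 < d i → m (D.h i) = 0 := fun i hi =>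
      (mul_eq_zero.1 ((sum_eq_zero_iff_of_nonneg hnn).1 h0 i (mem_univ i))).resolve_left hi.ne'
    refine ⟨b⁻¹, inv_mem hb, m, ⟨fun i hi => h1 i (lt_of_lt_of_le hi (hd i)), fun i _ => hm i⟩, ?_⟩
    rw [← inv_inv w, hgb, mul_inv_rev, dact_mul, dact_eq_self h1 (inv_mem hg)]

/-! ### The special faces -/

theorem exists_isSpecialFace {Θ : Set I} (hΘ : D.IsSpecial Θ) :
    ∃ R : D.Face, R.IsSpecialFace Θ := by
  obtain ⟨c, hc, rfl⟩ := exists_isAnti hΘ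
  let F : PointedCone ℝ (Module.Dual ℝ V) :=
    { carrier := {l | l ∈ D.tits ∧ l (D.hc c) = 0}
      add_mem' := fun {x y} hx hy => ⟨add_mem hx.1 hy.1, by
        rw [LinearMap.add_apply, hx.2, hy.2, add_zero]⟩
      zero_mem' := ⟨zero_mem _, rfl⟩
      smul_mem' := fun a x hx => ⟨Submodule.smul_mem _ a hx.1, by
        change a.1 * x (D.hc c) = 0
        rw [hx.2, mul_zero]⟩ }
  refine ⟨⟨F, fun l hl => hl.1, fun {x y a} hx hy ha h => ⟨hx, ?_⟩⟩, ?_⟩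
  · have h1 : a * x (D.hc c) + y (D.hc c) = 0 := h.2
    have h2 := hc.nonneg_of_mem_tits hx
    have h3 := hc.nonneg_of_mem_tits hy
    have h4 : a * x (D.hc c) = 0 := le_antisymm (by linarith) (mul_nonneg ha.le h2)
    exact (mul_eq_zero.1 h4).resolve_left ha.ne'
  · ext l
    exact hc.mem_specialFace.symm

/-- The special face `R(Θ)` (for special `Θ`). -/
noncomputable def Rf (D : KMDatum I V) (Θ : Set I) : D.Face :=
  -- The whole cone is a junk value, taken when `R(Θ)` is not a face.
  open Classical in if h : ∃ R : D.Face, R.IsSpecialFace Θ then h.choose else Face.full D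

theorem Rf_spec {Θ : Set I} (hΘ : D.IsSpecial Θ) : (D.Rf Θ).IsSpecialFace Θ := by
  have h := exists_isSpecialFace hΘ
  rw [Rf, dif_pos h]
  exact h.choose_spec

theorem mem_Rf {Θ : Set I} (hΘ : D.IsSpecial Θ) {l : Module.Dual ℝ V} :
    l ∈ (D.Rf Θ).1 ↔ l ∈ D.specialFace Θ := by
  rw [← Rf_spec hΘ]; rfl

theorem Face.IsSpecialFace.eq_Rf {Θ : Set I} {R : D.Face} (h : R.IsSpecialFace Θ) :
    R = D.Rf Θ := by
  have h' : ∃ R : D.Face, R.IsSpecialFace Θ := ⟨R, h⟩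
  have h1 : (D.Rf Θ).IsSpecialFace Θ := by
    rw [Rf, dif_pos h']
    exact h'.choose_spec
  exact Subtype.ext (SetLike.coe_injective (h.trans h1.symm))

theorem IsAnti.mem_Rf {c : I → ℝ} (hc : D.IsAnti c) {l : Module.Dual ℝ V} :
    l ∈ (D.Rf {i | 0 < c i}).1 ↔ l ∈ D.tits ∧ l (D.hc c) = 0 := by
  rw [KMDatum.mem_Rf hc.isSpecial, hc.mem_specialFace]

theorem gen_mem_Rf {Θ : Set I} (hΘ : D.IsSpecial Θ) : D.gen Θ ∈ (D.Rf Θ).1 :=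
  (mem_Rf hΘ).2 ⟨1, one_mem _, _, gen_mem Θ, (D.dact_one _).symm⟩

theorem specialFace_h {Θ : Set I} {l : Module.Dual ℝ V} (hl : l ∈ D.specialFace Θ) {i : I}
    (hi : i ∈ Θ) : l (D.h i) = 0 := by
  obtain ⟨w, hw, m, hm, rfl⟩ := hl
  rw [dact_apply]
  have : w⁻¹.1 (D.h i) = D.h i := by
    refine D.roots.ν_eq_self_of_mem_par (fun j hj => ?_) (inv_mem hw)
    change D.α j (D.h i) = 0
    rw [D.pairing, D.zero_symm _ _ (hj i hi)]; simp
  rw [this, hm.1 i hi]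

theorem specialFace_dact {Θ : Set I} {l : Module.Dual ℝ V} (hl : l ∈ D.specialFace Θ) {w : D.W}
    (hw : w ∈ D.par (D.perp Θ)) : D.dact w l ∈ D.specialFace Θ := by
  obtain ⟨u, hu, m, hm, rfl⟩ := hl
  exact ⟨w * u, mul_mem hw hu, m, hm, (D.dact_mul w u m).symm⟩

theorem Rf_dact_fix {Θ : Set I} (hΘ : D.IsSpecial Θ) {l : Module.Dual ℝ V} (hl : l ∈ (D.Rf Θ).1)
    {w : D.W} (hw : w ∈ D.par Θ) : D.dact w l = l :=
  dact_eq_self (fun _ hj => specialFace_h ((mem_Rf hΘ).1 hl) hj) hw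

theorem Face.smul_smul (w u : D.W) (F : D.Face) : (F.smul u).smul w = F.smul (w * u) :=
  Face.ext fun l => by simp only [Face.mem_smul, mul_inv_rev, dact_mul]

theorem Face.smul_one (F : D.Face) : F.smul 1 = F :=
  Face.ext fun l => by simp only [Face.mem_smul, inv_one, dact_one]

theorem Face.smul_inter (w : D.W) (F G : D.Face) :
    (F.inter G).smul w = (F.smul w).inter (G.smul w) :=
  Face.ext fun l => by simp only [Face.mem_smul, Face.mem_inter]

theorem Face.smul_full (w : D.W) : (Face.full D).smul w = Face.full D :=
  Face.ext fun l => by simp only [Face.mem_smul, Face.mem_full, dact_mem_tits]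

theorem Rf_smul_perp {Θ : Set I} (hΘ : D.IsSpecial Θ) {w : D.W} (hw : w ∈ D.par (D.perp Θ)) :
    (D.Rf Θ).smul w = D.Rf Θ := by
  refine Face.ext fun l => ?_
  rw [Face.mem_smul, mem_Rf hΘ, mem_Rf hΘ]
  refine ⟨fun h => ?_, fun h => specialFace_dact h (inv_mem hw)⟩
  rw [← D.dact_dact_inv w l]
  exact specialFace_dact h hw

theorem Rf_smul_self {Θ : Set I} (hΘ : D.IsSpecial Θ) {w : D.W} (hw : w ∈ D.par Θ) :
    (D.Rf Θ).smul w = D.Rf Θ := by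
  refine Face.ext fun l => ?_
  rw [Face.mem_smul]
  constructor
  · intro h
    rw [← D.dact_dact_inv w l, Rf_dact_fix hΘ h hw]
    exact h
  · intro h
    rw [Rf_dact_fix hΘ h (inv_mem hw)]
    exact h

/-- Inclusions between translates of special faces. -/
theorem Rf_le {Θ Θ' : Set I} (hΘ : D.IsSpecial Θ) (hΘ' : D.IsSpecial Θ') {σ : D.W}
    (h : ∀ l ∈ (D.Rf Θ).1, D.dact σ l ∈ (D.Rf Θ').1) :
    Θ' ⊆ Θ ∧ ∃ w ∈ D.par (D.perp Θ'), ∃ u ∈ D.par Θ, σ = w * u := by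
  -- It suffices to follow one point. The zero set of `gen Θ` is exactly `Θ`, so two elements moving
  -- it to the same dominant point differ by `W_Θ`.
  have h1 := h _ (gen_mem_Rf hΘ)
  rw [mem_Rf hΘ'] at h1
  obtain ⟨w, hw, m, hm, h2⟩ := h1
  have h3 : D.dact (w⁻¹ * σ) (D.gen Θ) = m := by rw [dact_mul, h2, dact_inv_dact]
  have h4 := dact_eq_of_chamber (w := w⁻¹ * σ) (closedFacet_subset _ (gen_mem Θ))
    (by rw [h3]; exact closedFacet_subset _ hm)
  rw [gen_zero] at h4
  rw [h3] at h4
  refine ⟨fun i hi => ?_, w, hw, _, h4.2, by group⟩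
  rw [← gen_zero (D := D) Θ]
  change D.gen Θ (D.h i) = 0
  rw [← h4.1]
  exact hm.1 i hi

theorem Rf_smul_eq {Θ Θ' : Set I} (hΘ : D.IsSpecial Θ) (hΘ' : D.IsSpecial Θ') {σ : D.W}
    (h : (D.Rf Θ).smul σ = D.Rf Θ') :
    Θ = Θ' ∧ ∃ w ∈ D.par (D.perp Θ), ∃ u ∈ D.par Θ, σ = w * u := by
  have h1 := Rf_le hΘ hΘ' (σ := σ) fun l hl => by
    rw [← h, Face.mem_smul, dact_inv_dact]; exact hl
  have h2 := Rf_le hΘ' hΘ (σ := σ⁻¹) fun l hl => by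
    rwa [← h, Face.mem_smul] at hl
  have h3 : Θ = Θ' := subset_antisymm h2.1 h1.1
  subst h3
  exact ⟨rfl, h1.2⟩

end KMDatum

/-! ### Classification and intersections of faces; the face monoid and the subspaces of faces. -/

namespace KMDatum

open Finset Filter Topology

variable {I V : Type*} [Fintype I] [NormedAddCommGroup V] [NormedSpace ℝ V]
variable {D : KMDatum I V}

/-! ### Classification of the faces -/

theorem exists_pos_mul_lt {ι : Type*} {S : Set ι} (hS : S.Finite) {x y : ι → ℝ}
    (hy : ∀ i ∈ S, 0 < y i) : ∃ e : ℝ, 0 < e ∧ ∀ i ∈ S, e * x i < y i := by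
  have h1 : ∀ᶠ e : ℝ in 𝓝[>] 0, ∀ i ∈ S, e * x i < y i := by
    rw [hS.eventually_all]
    intro i hi
    have h2 : Tendsto (fun e : ℝ => e * x i) (𝓝[>] 0) (𝓝 0) := by
      have : Tendsto (fun e : ℝ => e * x i) (𝓝 0) (𝓝 (0 * x i)) := tendsto_id.mul_const _
      rw [zero_mul] at this
      exact this.mono_left nhdsWithin_le_nhds
    exact h2.eventually_lt_const (hy i hi)
  obtain ⟨e, he, he'⟩ := (h1.and self_mem_nhdsWithin).exists
  exact ⟨e, he', he⟩

/-- A face that contains a point of the open facet of type `J` of the fundamental chamber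
contains the special face of `J^∞`. -/
theorem specialFace_subset_of_mem {F : D.Face} {l : Module.Dual ℝ V} (hl : l ∈ F.1)
    (hl' : l ∈ D.chamber) {m : Module.Dual ℝ V}
    (hm : m ∈ (D.Rf (D.inf {i | l (D.h i) = 0})).1) : m ∈ F.1 := by
  set J := {i | l (D.h i) = 0} with hJ
  have hΘ := D.isSpecial_inf J
  have hfin : (D.par (D.fin J) : Set D.W).Finite := par_finite_of_fin (fin_fin J)
  have hpos : ∀ i ∉ J, 0 < l (D.h i) := fun i hi => lt_of_le_of_ne (hl' i) (Ne.symm hi)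
  -- One `e` works for all translates by the finite group `W_{J⁰}`: `l - e w m` stays positive off
  -- `J`. It vanishes on `J^∞`, and a suitable `w` makes it dominant on `J⁰`, so `l - e m` lies in
  -- the Tits cone.
  obtain ⟨e, he, hlt⟩ := exists_pos_mul_lt (S := (D.par (D.fin J) : Set D.W) ×ˢ Jᶜ)
    (hfin.prod (Set.toFinite _)) (x := fun p => D.dact p.1 m (D.h p.2))
    (y := fun p => l (D.h p.2)) fun p hp => hpos p.2 hp.2
  have hn : (D.coroots.neg (D.fin J) (l - e • m)).Finite :=
    (D.coroots.rts_finite hfin).subset fun β hβ => hβ.1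
  obtain ⟨w, hw, hdom⟩ := D.coroots.exists_dominant hn
  have hwl : D.dact w l = l := dact_eq_self (J := D.fin J) (fun j hj => hj.1) hw
  have hact : D.coroots.ν w (l - e • m) = l - e • D.dact w m := by
    change D.dact w (l - e • m) = _
    rw [map_sub, map_smul, hwl]
  rw [hact] at hdom
  have hch : l - e • D.dact w m ∈ D.chamber := by
    intro i
    by_cases hi : i ∈ J
    · rw [← fin_union_inf (D := D) J] at hi
      rcases hi with hi | hi
      · have h1 : D.dact w m (D.h i) = 0 := specialFace_h
          (specialFace_dact ((mem_Rf hΘ).1 hm) (par_mono (fin_subset_perp J) hw)) hi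
        have h2 : l (D.h i) = 0 := hi.1
        rw [LinearMap.sub_apply, LinearMap.smul_apply, h1, h2]; simp
      · exact hdom i hi
    · have := hlt (w, i) ⟨hw, hi⟩
      rw [LinearMap.sub_apply, LinearMap.smul_apply, smul_eq_mul]
      linarith
  have ht : l - e • m ∈ D.tits := by
    rw [← dact_mem_tits w]
    refine mem_tits_of_chamber ?_
    rw [map_sub, map_smul, hwl]
    exact hch
  -- Now `l` is the sum of `e m` and `l - e m`, both in the Tits cone, so the face `F` contains `m`.
  refine F.2.mem_of_smul_add_mem ((D.Rf _).2.le hm) ht he ?_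
  rwa [add_sub_cancel]

/-- Take a point of `F` for which the non-finite part of its type is smallest. Adding any `μ ∈ F`
gives a point of some `σ' R(Θ')`, which as a face contains both summands. Then `σ R(Θ) ⊆ σ' R(Θ')`,
minimality gives `Θ' = Θ`, the faces coincide, and `μ` lies in `σ R(Θ)`. -/
theorem exists_eq_smul_Rf (F : D.Face) : ∃ σ Θ, D.IsSpecial Θ ∧ F = (D.Rf Θ).smul σ := by
  classical
  let S : ℕ → Prop := fun n => ∃ (σ : D.W) (m : Module.Dual ℝ V), m ∈ D.chamber ∧
    D.dact σ m ∈ F.1 ∧ (D.inf {i | m (D.h i) = 0}).ncard = n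
  have hS : ∃ n, S n := ⟨_, 1, 0, fun i => le_rfl, by rw [dact_one]; exact zero_mem _, rfl⟩
  obtain ⟨σ, m, hm, hmF, hn⟩ := Nat.find_spec hS
  have hmin : ∀ k, S k → Nat.find hS ≤ k := fun k hk => Nat.find_min' hS hk
  set Θ := D.inf {i | m (D.h i) = 0} with hΘdef
  have hΘ : D.IsSpecial Θ := isSpecial_inf _
  refine ⟨σ, Θ, hΘ, Face.ext fun μ => ⟨fun hμ => ?_, fun hμ => ?_⟩⟩
  · have hsum : D.dact σ m + μ ∈ F.1 := add_mem hmF hμ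
    obtain ⟨σ', m', hm', heq⟩ := mem_tits.1 (F.2.le hsum)
    set Θ' := D.inf {i | m' (D.h i) = 0} with hΘ'def
    have hΘ' : D.IsSpecial Θ' := isSpecial_inf _
    have hcard := hmin _ ⟨σ', m', hm', by rw [← heq]; exact hsum, rfl⟩
    have hm'R : m' ∈ (D.Rf Θ').1 := (mem_Rf hΘ').2 ⟨1, one_mem _, m',
      ⟨fun i hi => hi.1, fun i _ => hm' i⟩, (D.dact_one _).symm⟩
    have hR' : D.dact σ m + μ ∈ ((D.Rf Θ').smul σ').1 := by
      rw [heq, Face.mem_smul, dact_inv_dact]; exact hm'R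
    have h1 := (((D.Rf Θ').smul σ').2.add_mem_iff_mem (F.2.le hmF) (F.2.le hμ)).1 hR'
    have h2 : ∀ l ∈ (D.Rf Θ).1, D.dact (σ'⁻¹ * σ) l ∈ (D.Rf Θ').1 := by
      intro l hl
      have h3 : m ∈ ((D.Rf Θ').smul (σ⁻¹ * σ')).1 := by
        have := h1.1
        rw [Face.mem_smul] at this ⊢
        rwa [mul_inv_rev, inv_inv, dact_mul]
      have h4 := specialFace_subset_of_mem h3 hm hl
      rwa [Face.mem_smul, mul_inv_rev, inv_inv] at h4
    obtain ⟨hsub, w, hw, u, hu, hwu⟩ := Rf_le hΘ hΘ' h2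
    have hΘΘ' : Θ' = Θ := Set.eq_of_subset_of_ncard_le hsub (by rw [hn]; exact hcard)
    rw [hΘΘ'] at h1 hw
    have h5 : σ = σ' * (w * u) := by rw [← hwu]; group
    have h6 := h1.2
    rw [h5, ← Face.smul_smul, ← Face.smul_smul, Rf_smul_self hΘ hu, Rf_smul_perp hΘ hw]
    exact h6
  · have hmF' : m ∈ (F.smul σ⁻¹).1 := by rw [Face.mem_smul, inv_inv]; exact hmF
    rw [Face.mem_smul] at hμ
    have := specialFace_subset_of_mem hmF' hm hμ
    rwa [Face.mem_smul, inv_inv, dact_dact_inv] at this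

/-! ### Intersections of special faces -/

/-- Lengths add in `g = x b⁻¹`, so every letter of `x` occurs in `g`. -/
theorem red_subset_of_minR {K S : Set I} {x g b : D.W} (hx : x ∈ D.minR K) (hg : g ∈ D.par S)
    (hb : b ∈ D.par K) (h : x = g * b) : D.red x ⊆ S := by
  have h1 : x * b⁻¹ = g := by rw [h]; group
  have h2 := len_mul_of_minR hx (inv_mem hb)
  refine (red_subset_mul_of_len h2).1.trans ?_
  rw [h1]
  exact red_subset_iff.2 hg

/-- The two faces are the zero sets in `X` of nonnegative functionals given by the antidominant
vectors of `c₁` and `c₂`, the second transported by `x`. Their intersection is the zero set of any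
positive combination. A suitable one is again antidominant, and its support names the face. -/
theorem Rf_inter {Θ₁ Θ₂ : Set I} (h₁ : D.IsSpecial Θ₁) (h₂ : D.IsSpecial Θ₂) {x : D.W}
    (hxL : x ∈ D.minL (Θ₁ ∪ D.perp Θ₁)) (hxR : x ∈ D.minR (D.perp Θ₂)) :
    D.IsSpecial (Θ₁ ∪ Θ₂ ∪ D.red x) ∧
      (D.Rf Θ₁).inter ((D.Rf Θ₂).smul x) = D.Rf (Θ₁ ∪ Θ₂ ∪ D.red x) := by
  classical
  obtain ⟨c₁, hc₁, hs₁⟩ := exists_isAnti h₁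
  obtain ⟨c₂, hc₂, hs₂⟩ := exists_isAnti h₂
  obtain ⟨d, hd, hxd, g, hg, b, hb, hgb⟩ := hc₂.exists_act x
  rw [hs₂] at hb
  have hred : D.red x ⊆ {i | 0 < d i} := red_subset_of_minR hxR hg hb hgb
  have hd0 : ∀ i, 0 ≤ d i := fun i => (hc₂.nonneg i).trans (hd i)
  -- Acting by `x` changes only coefficients in `red x`. That all of these become positive is where
  -- the minimality of `x` on the right enters.
  have hsupp : {i | 0 < d i} = Θ₂ ∪ D.red x := by
    refine subset_antisymm (fun i hi => ?_) (Set.union_subset (fun i hi => ?_) hred)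
    · by_contra hi'
      simp only [Set.mem_union, not_or] at hi'
      obtain ⟨f, hf, hf'⟩ := D.coroots.ρ_eq_add (mem_par_red x) (D.hc c₂)
      have h3 : D.hc d = D.hc c₂ + ∑ i, f i • D.h i := hxd.symm.trans hf'
      have h4 : ∑ i, d i • D.coroots.a i = ∑ i, (c₂ i + f i) • D.coroots.a i := by
        simp only [add_smul, sum_add_distrib]
        exact h3
      have h5 := congrFun (D.coroots.coeff_unique h4) i
      have h6 : c₂ i = 0 := by
        refine le_antisymm (not_lt.1 fun h => hi'.1 ?_) (hc₂.nonneg i)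
        rw [← hs₂]; exact h
      simp only [hf i hi'.2, h6, add_zero] at h5
      exact (ne_of_gt hi) h5
    · rw [← hs₂] at hi
      exact lt_of_lt_of_le hi (hd i)
  have hneg : ∀ j ∉ Θ₁ ∪ D.perp Θ₁, ∑ i, c₁ i * (D.A i j : ℝ) < 0 := by
    intro j hj
    simp only [Set.mem_union, not_or] at hj
    obtain ⟨k, hk, hjk⟩ : ∃ k ∈ Θ₁, D.A j k ≠ 0 := by
      by_contra! h
      exact hj.2 h
    have hkj : D.A k j ≠ 0 := fun h => hjk (D.zero_symm _ _ h)
    have hck : 0 < c₁ k := by rw [← hs₁] at hk; exact hk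
    have hne : k ≠ j := by rintro rfl; exact hj.1 hk
    refine sum_neg' (fun i _ => ?_) ⟨k, mem_univ _, ?_⟩
    · rcases eq_or_ne i j with rfl | hij
      · have : c₁ i = 0 := by
          refine le_antisymm (not_lt.1 fun h => hj.1 ?_) (hc₁.nonneg i)
          rw [← hs₁]; exact h
        rw [this, zero_mul]
      · exact mul_nonpos_of_nonneg_of_nonpos (hc₁.nonneg i) (A_nonpos hij)
    · exact mul_neg_of_pos_of_neg hck (lt_of_le_of_ne (A_nonpos hne) (by exact_mod_cast hkj))
  -- On `Θ₁ ∪ Θ₁^⊥` both summands are antidominant, by the minimality of `x` on the left. Elsewhere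
  -- the first is strictly negative and absorbs a small multiple of the second.
  obtain ⟨e, he, hlt⟩ := exists_pos_mul_lt (S := (Θ₁ ∪ D.perp Θ₁)ᶜ) (Set.toFinite _)
    (x := fun j => ∑ i, d i * (D.A i j : ℝ)) (y := fun j => -∑ i, c₁ i * (D.A i j : ℝ))
    fun j hj => by linarith [hneg j hj]
  set f : I → ℝ := fun i => c₁ i + e * d i with hf
  have hanti : D.IsAnti f := by
    refine ⟨fun i => add_nonneg (hc₁.nonneg i) (mul_nonneg he.le (hd0 i)), fun j => ?_⟩
    have h3 : ∑ i, f i * (D.A i j : ℝ) =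
        ∑ i, c₁ i * (D.A i j : ℝ) + e * ∑ i, d i * (D.A i j : ℝ) := by
      simp only [hf, add_mul, sum_add_distrib, mul_sum, mul_assoc]
    rw [h3]
    by_cases hj : j ∈ Θ₁ ∪ D.perp Θ₁
    · have h4 := hc₂.pos_apply (D.roots.mem_minL_iff.1 hxL j hj)
      have h5 : D.α j (D.hc d) ≤ 0 := by
        rw [← hxd]
        exact (D.roots.pair_ν x (D.α j) (D.hc c₂)).trans_le h4
      rw [α_hc] at h5
      have := mul_nonpos_of_nonneg_of_nonpos he.le h5
      linarith [hc₁.le j]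
    · have := hlt j hj
      linarith
  have hfs : {i | 0 < f i} = Θ₁ ∪ Θ₂ ∪ D.red x := by
    rw [Set.union_assoc, ← hsupp, ← hs₁]
    ext i
    have h3 := hc₁.nonneg i
    have h4 := hd0 i
    change 0 < c₁ i + e * d i ↔ 0 < c₁ i ∨ 0 < d i
    constructor
    · intro h
      by_contra! h'
      have h5 : d i = 0 := le_antisymm h'.2 h4
      rw [h5] at h
      linarith
    · rintro (h | h)
      · have := mul_nonneg he.le h4; linarith
      · have := mul_pos he h; linarith
  rw [← hfs]
  refine ⟨hanti.isSpecial, Face.ext fun l => ?_⟩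
  have hfc : D.hc f = D.hc c₁ + e • D.hc d := by
    simp only [KMDatum.hc, hf, add_smul, sum_add_distrib, smul_sum, mul_smul]
  rw [Face.mem_inter, Face.mem_smul, hanti.mem_Rf, ← hs₁, ← hs₂, hc₁.mem_Rf, hc₂.mem_Rf,
    dact_mem_tits, dact_apply, inv_inv, hxd, hfc, map_add, map_smul, smul_eq_mul]
  constructor
  · rintro ⟨⟨h3, h4⟩, -, h5⟩
    exact ⟨h3, by rw [h4, h5]; simp⟩
  · rintro ⟨h3, h4⟩
    have h5 := hc₁.nonneg_of_mem_tits h3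
    have h6 := hc₂.nonneg_of_mem_tits ((dact_mem_tits x⁻¹).2 h3)
    rw [dact_apply, inv_inv, hxd] at h6
    have h7 := mul_nonneg he.le h6
    have h8 : e * l (D.hc d) = 0 := by linarith
    exact ⟨⟨h3, by linarith⟩, h3, (mul_eq_zero.1 h8).resolve_left he.ne'⟩

/-! ### The face monoid -/

theorem wε_eq_iff {σ τ : D.W} {R S : D.Face} :
    D.wε σ R = D.wε τ S ↔ R = S ∧ ∀ l ∈ R.1, D.dact τ l = D.dact σ l := by
  unfold wε
  rw [Con.eq]
  change R = S ∧ σ⁻¹ * τ ∈ R.stab ↔ _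
  rw [Face.inv_mul_mem_stab]

theorem wε_mul (σ τ : D.W) (R S : D.Face) :
    D.wε σ R * D.wε τ S = D.wε (σ * τ) ((R.smul τ⁻¹).inter S) := rfl

theorem inter_full (R : D.Face) : R.inter (Face.full D) = R :=
  Face.ext fun _ => ⟨fun h => h.1, fun h => ⟨h, R.2.le h⟩⟩

theorem full_inter (R : D.Face) : (Face.full D).inter R = R :=
  Face.ext fun _ => ⟨fun h => h.2, fun h => ⟨R.2.le h, h⟩⟩

theorem ofW_mul_wε (σ τ : D.W) (R : D.Face) : D.ofW σ * D.wε τ R = D.wε (σ * τ) R := by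
  rw [ofW, wε_mul, Face.smul_full, full_inter]

theorem wε_mul_ofW (σ τ : D.W) (R : D.Face) :
    D.wε σ R * D.ofW τ = D.wε (σ * τ) (R.smul τ⁻¹) := by
  rw [ofW, wε_mul, inter_full]

theorem ofW_mul_ε (σ : D.W) (R : D.Face) : D.ofW σ * D.ε R = D.wε σ R := by
  rw [ε, ofW_mul_wε, mul_one]

theorem exists_wε (m : D.FaceMonoid) : ∃ σ R, m = D.wε σ R := by
  induction m using Con.induction_on with
  | H x => exact ⟨x.w, x.R, rfl⟩

theorem exists_ofW_ε_ofW (m : D.FaceMonoid) : ∃ (σ₁ σ₂ : D.W) (Θ : Set I) (R : D.Face),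
    D.IsSpecial Θ ∧ R.IsSpecialFace Θ ∧ m = D.ofW σ₁ * D.ε R * D.ofW σ₂ := by
  obtain ⟨σ, F, rfl⟩ := exists_wε m
  obtain ⟨ρ, Θ, hΘ, rfl⟩ := exists_eq_smul_Rf F
  refine ⟨σ * ρ, ρ⁻¹, Θ, D.Rf Θ, hΘ, Rf_spec hΘ, ?_⟩
  rw [ofW_mul_ε, wε_mul_ofW, inv_inv, mul_inv_cancel_right]

/-! ### The subspaces belonging to the faces -/

/-- A functional `f` killing the span but not `v` can be added in a small multiple to the generic
point `gen Θ` without leaving the closed facet. The two points then differ on `v`. -/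
theorem mem_span_h_iff {Θ : Set I} {v : V} :
    v ∈ Submodule.span ℝ (D.h '' Θ) ↔ ∀ l ∈ D.specialFace Θ, l v = 0 := by
  constructor
  · intro hv l hl
    induction hv using Submodule.span_induction with
    | mem x hx =>
      obtain ⟨i, hi, rfl⟩ := hx
      exact specialFace_h hl hi
    | zero => exact map_zero l
    | add x y _ _ hx hy => rw [map_add, hx, hy, add_zero]
    | smul a x _ hx => rw [map_smul, hx, smul_zero]
  · intro h
    by_contra hv
    obtain ⟨f, hf, hle⟩ := Submodule.exists_le_ker_of_notMem hv
    have hf0 : ∀ i ∈ Θ, f (D.h i) = 0 := fun i hi => hle (Submodule.subset_span ⟨i, hi, rfl⟩)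
    obtain ⟨e, he, hlt⟩ := exists_pos_mul_lt (S := Θᶜ) (Set.toFinite _)
      (x := fun i => -f (D.h i)) (y := fun _ => 1) fun _ _ => one_pos
    have h1 : ∀ l ∈ D.closedFacet Θ, l v = 0 := fun l hl =>
      h l ⟨1, one_mem _, l, hl, (D.dact_one l).symm⟩
    have h2 := h1 _ (gen_mem Θ)
    have h3 := h1 (D.gen Θ + e • f) ⟨fun i hi => by
      rw [LinearMap.add_apply, LinearMap.smul_apply, hf0 i hi, gen_h_of_mem hi]; simp,
      fun i hi => by
        have := hlt i hi
        rw [LinearMap.add_apply, LinearMap.smul_apply, gen_h_of_notMem hi, smul_eq_mul]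
        linarith⟩
    rw [LinearMap.add_apply, LinearMap.smul_apply, h2, zero_add, smul_eq_mul] at h3
    exact hf ((mul_eq_zero.1 h3).resolve_left he.ne')

theorem mem_map_span_h_iff {Θ : Set I} {σ : D.W} {v : V} :
    v ∈ (Submodule.span ℝ (D.h '' Θ)).map (σ.1 : V →ₗ[ℝ] V) ↔
      ∀ l ∈ D.dact σ '' D.specialFace Θ, l v = 0 := by
  rw [Set.forall_mem_image]
  have h1 : ∀ l : Module.Dual ℝ V, D.dact σ l v = l (σ⁻¹.1 v) := fun l => rfl
  simp only [h1]
  rw [← mem_span_h_iff]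
  constructor
  · rintro ⟨u, hu, rfl⟩
    have : σ⁻¹.1 (σ.1 u) = u := W_inv_apply_self σ u
    change σ⁻¹.1 (σ.1 u) ∈ _
    rwa [this]
  · intro h
    exact ⟨_, h, W_apply_inv_self σ v⟩

/-- Every presentation `σ R(Θ)` of the face yields the common kernel of its linear forms, so the
supremum over all presentations is that one subspace. -/
theorem mem_faceSub_iff {R : D.Face} {v : V} : v ∈ D.faceSub R ↔ ∀ l ∈ R.1, l v = 0 := by
  constructor
  · intro hv
    have hle : D.faceSub R ≤ ⨅ l : R.1, LinearMap.ker l.1 := by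
      refine iSup_le fun σ => iSup_le fun Θ => iSup_le fun h => ?_
      intro u hu
      rw [mem_map_span_h_iff, ← h.2] at hu
      rw [Submodule.mem_iInf]
      exact fun l => hu l.1 l.2
    intro l hl
    exact (Submodule.mem_iInf _).1 (hle hv) ⟨l, hl⟩
  · intro h
    obtain ⟨σ, Θ, hΘ, rfl⟩ := exists_eq_smul_Rf R
    have hR : (((D.Rf Θ).smul σ).1 : Set (Module.Dual ℝ V)) = D.dact σ '' D.specialFace Θ := by
      ext l
      rw [SetLike.mem_coe, Face.mem_smul, mem_Rf hΘ]
      constructor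
      · exact fun hl => ⟨_, hl, D.dact_dact_inv σ l⟩
      · rintro ⟨m, hm, rfl⟩
        rwa [dact_inv_dact]
    have h1 : v ∈ (Submodule.span ℝ (D.h '' Θ)).map (σ.1 : V →ₗ[ℝ] V) := by
      rw [mem_map_span_h_iff, ← hR]
      exact h
    have h2 : (Submodule.span ℝ (D.h '' Θ)).map (σ.1 : V →ₗ[ℝ] V) ≤
        D.faceSub ((D.Rf Θ).smul σ) :=
      le_iSup_of_le σ (le_iSup_of_le Θ (le_iSup_of_le ⟨hΘ, hR⟩ le_rfl))
    exact h2 h1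

theorem proj_eq_iff {R S : D.Face} {v u : V} :
    D.proj R v = D.proj S u ↔ R = S ∧ ∀ l ∈ R.1, l v = l u := by
  constructor
  · intro h
    have h1 : R = S := congrArg Sigma.fst h
    subst h1
    have h2 : (Submodule.Quotient.mk v : V ⧸ D.faceSub R) = Submodule.Quotient.mk u :=
      eq_of_heq (Sigma.mk.inj h).2
    rw [Submodule.Quotient.eq, mem_faceSub_iff] at h2
    exact ⟨rfl, fun l hl => by have := h2 l hl; rwa [map_sub, sub_eq_zero] at this⟩
  · rintro ⟨rfl, h⟩
    have : (Submodule.Quotient.mk v : V ⧸ D.faceSub R) = Submodule.Quotient.mk u := by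
      rw [Submodule.Quotient.eq, mem_faceSub_iff]
      exact fun l hl => by rw [map_sub, h l hl, sub_self]
    unfold proj
    rw [this]

end KMDatum

/-! ### Looijenga's cone: the action and the partition into facets. -/

namespace KMDatum

open Finset Filter Topology

variable {I V : Type*} [Fintype I] [NormedAddCommGroup V] [NormedSpace ℝ V]
variable {D : KMDatum I V}

/-! ### Cosets -/

theorem cosetSet_subset_iff {τ τ' : D.W} {J J' : Set I} :
    D.cosetSet τ' J' ⊆ D.cosetSet τ J ↔ J' ⊆ J ∧ τ⁻¹ * τ' ∈ D.par J := by
  constructor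
  · intro h
    have h1 : ∀ u ∈ D.par J', τ⁻¹ * τ' * u ∈ D.par J := fun u hu => by
      obtain ⟨u', hu', h'⟩ := h ⟨u, hu, rfl⟩
      rw [mul_assoc, h', inv_mul_cancel_left]
      exact hu'
    have h2 : τ⁻¹ * τ' ∈ D.par J := by simpa using h1 1 (one_mem _)
    refine ⟨fun i hi => ?_, h2⟩
    rw [← D.s_mem_par_iff]
    exact ((D.par J).mul_mem_cancel_left h2).1 (h1 _ (s_mem_par hi))
  · rintro ⟨hJ, h⟩ _ ⟨u, hu, rfl⟩
    exact ⟨τ⁻¹ * τ' * u, mul_mem h (par_mono hJ hu), by group⟩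

theorem coset_le_iff {τ τ' : D.W} {J J' : Set I} :
    D.coset τ J ≤ D.coset τ' J' ↔ J' ⊆ J ∧ τ⁻¹ * τ' ∈ D.par J := cosetSet_subset_iff

theorem coset_eq_iff {τ τ' : D.W} {J J' : Set I} :
    D.coset τ J = D.coset τ' J' ↔ J = J' ∧ τ⁻¹ * τ' ∈ D.par J := by
  rw [le_antisymm_iff, coset_le_iff, coset_le_iff]
  constructor
  · rintro ⟨⟨h1, h2⟩, h3, -⟩
    exact ⟨subset_antisymm h3 h1, h2⟩
  · rintro ⟨rfl, h⟩
    refine ⟨⟨subset_rfl, h⟩, subset_rfl, ?_⟩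
    have := inv_mem h
    rwa [mul_inv_rev, inv_inv] at this

theorem exists_coset (x : D.Cox) : ∃ τ J, x = D.coset τ J := by
  obtain ⟨S, τ, J, rfl⟩ := x
  exact ⟨τ, J, rfl⟩

/-! ### The interior of the Tits cone in `V` -/

theorem cotits_eq : D.cotits = D.roots.tits := by
  ext v
  constructor
  · rintro ⟨w, u, hu, rfl⟩
    exact ⟨w, u, fun i _ => hu i, rfl⟩
  · rintro ⟨w, u, hu, rfl⟩
    exact ⟨w, u, fun i => hu i trivial, rfl⟩

theorem continuous_dual [FiniteDimensional ℝ V] (l : Module.Dual ℝ V) : Continuous l :=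
  LinearMap.continuous_of_finiteDimensional l

theorem continuous_W [FiniteDimensional ℝ V] (w : D.W) : Continuous w.1 :=
  LinearMap.continuous_of_finiteDimensional (w.1 : V →ₗ[ℝ] V)

theorem act_mem_interior [FiniteDimensional ℝ V] {v : V} (hv : v ∈ interior D.cotits) (w : D.W) :
    w.1 v ∈ interior D.cotits := by
  have h1 : w⁻¹.1 ⁻¹' interior D.cotits ⊆ interior D.cotits := by
    refine interior_maximal (fun u hu => ?_) (isOpen_interior.preimage (continuous_W w⁻¹))
    have h2 := interior_subset hu
    rw [cotits_eq] at h2 ⊢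
    have h3 : D.roots.ν w (D.roots.ν w⁻¹ u) ∈ D.roots.tits := D.roots.ν_mem_tits w h2
    rwa [RootRep.ν_self_inv] at h3
  refine h1 ?_
  rw [Set.mem_preimage, W_inv_apply_self]
  exact hv

/-- For `y` near `v`, all `w y` with `w` in the finite group `W_J` stay positive on the roots
outside `J`. One of them is also dominant on `J`. -/
theorem mem_interior_of_finite [FiniteDimensional ℝ V] {v : V} (hv : ∀ i, 0 ≤ D.α i v)
    (hfin : (D.par {i | D.α i v = 0} : Set D.W).Finite) : v ∈ interior D.cotits := by
  set J := {i | D.α i v = 0} with hJ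
  rw [mem_interior_iff_mem_nhds]
  have h1 : ∀ᶠ y in 𝓝 v, ∀ p ∈ (D.par J : Set D.W) ×ˢ Jᶜ, 0 < D.α p.2 (p.1.1 y) := by
    rw [(hfin.prod (Set.toFinite _)).eventually_all]
    rintro ⟨w, i⟩ ⟨hw, hi⟩
    have h2 : ContinuousAt (fun y => D.α i (w.1 y)) v :=
      ((continuous_dual _).comp (continuous_W w)).continuousAt
    refine h2.eventually (lt_mem_nhds ?_)
    have h3 : w.1 v = v := D.roots.ν_eq_self_of_mem_par (J := J) (fun j hj => hj) hw
    change 0 < D.α i (w.1 v)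
    rw [h3]
    exact lt_of_le_of_ne (hv i) (Ne.symm hi)
  filter_upwards [h1] with y hy
  have hn : (D.roots.neg J y).Finite := (D.roots.rts_finite hfin).subset fun β hβ => hβ.1
  obtain ⟨w, hw, hdom⟩ := D.roots.exists_dominant hn
  refine ⟨w⁻¹, w.1 y, fun i => ?_, (W_inv_apply_self w y).symm⟩
  by_cases hi : i ∈ J
  · exact hdom i hi
  · exact (hy (w, i) ⟨hw, hi⟩).le

/-- Move `v` slightly in a direction on which all simple roots are `-1`. The point stays in the Tits
cone, where only finitely many positive roots are negative, while every positive root of `W_K` has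
become negative. -/
theorem fin_eq_of_mem_interior {v : V} (hv : v ∈ interior D.cotits) {K : Set I}
    (hK : ∀ i ∈ K, D.α i v = 0) : D.fin K = K := by
  refine subset_antisymm (fin_subset K) fun i hi => ⟨hi, ?_⟩
  refine isFiniteType_of_finite (conn_comp hi) ?_
  obtain ⟨x, hx⟩ := D.exists_point fun _ => -1
  have h1 : ∀ᶠ e : ℝ in 𝓝[>] 0, v + e • x ∈ D.cotits := by
    have h2 : Tendsto (fun e : ℝ => v + e • x) (𝓝 0) (𝓝 (v + (0 : ℝ) • x)) :=
      (continuous_const.add (continuous_id.smul continuous_const)).tendsto 0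
    rw [zero_smul, add_zero] at h2
    exact (h2.mono_left nhdsWithin_le_nhds).eventually (mem_interior_iff_mem_nhds.1 hv)
  obtain ⟨e, he, hpos⟩ := (h1.and self_mem_nhdsWithin).exists
  rw [cotits_eq] at he
  refine (D.roots.neg_finite_of_mem_tits he K).subset ?_
  rintro β ⟨hβ, hβp⟩
  have hβK := D.roots.rts_mono (comp_subset hi) hβ
  refine ⟨hβK, hβp, ?_⟩
  obtain ⟨c, hc, hβc⟩ := D.roots.posOn_of_mem_rts hβK hβp
  have hc0 : ∃ j, c j ≠ 0 := by
    by_contra! h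
    obtain ⟨w, -, j, -, hwj⟩ := hβ
    refine D.roots.ρ_a_ne_zero w j ?_
    rw [← hwj, hβc]
    exact sum_eq_zero fun i _ => by rw [h i]; simp
  obtain ⟨j, hj⟩ := hc0
  change β (v + e • x) < 0
  have h2 : β (v + e • x) = ∑ i, (c i : ℝ) * D.α i (v + e • x) := by
    rw [hβc, LinearMap.sum_apply]
    rfl
  have h3 : ∀ i, (c i : ℝ) * D.α i (v + e • x) = -(c i * e) := fun i => by
    by_cases hiK : i ∈ K
    · rw [map_add, map_smul, hK i hiK, hx]; simp
    · rw [hc i hiK]; simp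
  rw [h2, sum_congr rfl fun i _ => h3 i]
  refine sum_neg' (fun i _ => ?_) ⟨j, mem_univ _, ?_⟩
  · have : 0 ≤ (c i : ℝ) * e := mul_nonneg (Nat.cast_nonneg _) (le_of_lt hpos)
    linarith
  · have : 0 < (c j : ℝ) * e := mul_pos (Nat.cast_pos.2 (Nat.pos_of_ne_zero hj)) hpos
    linarith

/-! ### The action on Looijenga's cone -/

/-- The point `p_R(v)` of Looijenga's cone. -/
def looPt (D : KMDatum I V) (R : D.Face) (v : V) (hv : v ∈ interior D.cotits) : D.Loo :=
  ⟨D.proj R v, R, v, hv, rfl⟩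

theorem exists_looPt (p : D.Loo) : ∃ R v, ∃ hv : v ∈ interior D.cotits, p = D.looPt R v hv := by
  obtain ⟨p, R, v, hv, rfl⟩ := p
  exact ⟨R, v, hv, rfl⟩

theorem looPt_eq_iff {R S : D.Face} {v u : V} {hv : v ∈ interior D.cotits}
    {hu : u ∈ interior D.cotits} :
    D.looPt R v hv = D.looPt S u hu ↔ R = S ∧ ∀ l ∈ R.1, l v = l u := by
  rw [← proj_eq_iff]
  exact Subtype.ext_iff

/-- The action of the elements of the semidirect product on Looijenga's cone. -/
noncomputable def looFun [FiniteDimensional ℝ V] (a : D.PreMonoid) (p : D.Loo) : D.Loo :=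
  D.looPt ((a.R.inter (exists_looPt p).choose).smul a.w)
    (a.w.1 (exists_looPt p).choose_spec.choose)
    (act_mem_interior (exists_looPt p).choose_spec.choose_spec.choose a.w)

/-- The chosen representative does not matter: forms in the new face, pulled back by `σ`, lie in
`T`, where both representatives have the same values. -/
theorem looFun_looPt [FiniteDimensional ℝ V] (a : D.PreMonoid) (T : D.Face) (v : V) (hv : v ∈ interior D.cotits) :
    looFun a (D.looPt T v hv) =
      D.looPt ((a.R.inter T).smul a.w) (a.w.1 v) (act_mem_interior hv a.w) := by
  have h := (exists_looPt (D.looPt T v hv)).choose_spec.choose_spec.choose_spec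
  rw [looPt_eq_iff] at h
  unfold looFun
  rw [looPt_eq_iff]
  refine ⟨congrArg (fun S => (a.R.inter S).smul a.w) h.1.symm, fun l hl => ?_⟩
  rw [Face.mem_smul, Face.mem_inter] at hl
  have h1 := h.2 (D.dact a.w⁻¹ l) (by have h2 := hl.2; generalize_proofs at h h2; exact h.1 ▸ h2)
  rw [dact_apply, dact_apply, inv_inv] at h1
  exact h1.symm

/-- The action of the face monoid on Looijenga's cone. -/
noncomputable def looAct [FiniteDimensional ℝ V] (D : KMDatum I V) : D.FaceMonoid →* Function.End D.Loo :=
  D.faceCon.lift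
    { toFun := looFun
      map_one' := by
        funext p
        obtain ⟨T, v, hv, rfl⟩ := exists_looPt p
        rw [looFun_looPt]
        change _ = D.looPt T v hv
        refine looPt_eq_iff.2 ⟨?_, fun _ _ => rfl⟩
        exact (Face.smul_one _).trans (full_inter T)
      map_mul' := fun a b => by
        funext p
        obtain ⟨T, v, hv, rfl⟩ := exists_looPt p
        change _ = looFun a (looFun b _)
        rw [looFun_looPt, looFun_looPt, looFun_looPt]
        refine looPt_eq_iff.2 ⟨Face.ext fun l => ?_, fun _ _ => rfl⟩
        simp only [PreMonoid.mul_R, PreMonoid.mul_w, Face.mem_smul, Face.mem_inter, mul_inv_rev,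
          inv_inv, dact_mul, dact_dact_inv]
        tauto }
    (by
      rintro a b ⟨h1, h2⟩
      rw [Face.inv_mul_mem_stab] at h2
      refine funext fun p => ?_
      obtain ⟨T, v, hv, rfl⟩ := exists_looPt p
      change looFun a _ = looFun b _
      rw [looFun_looPt, looFun_looPt, looPt_eq_iff, ← h1]
      have key : ∀ l, l ∈ ((a.R.inter T).smul a.w).1 →
          ∃ m, m ∈ a.R.1 ∧ m ∈ T.1 ∧ l = D.dact a.w m ∧ l = D.dact b.w m := by
        intro l hl
        rw [Face.mem_smul, Face.mem_inter] at hl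
        exact ⟨_, hl.1, hl.2, (D.dact_dact_inv _ _).symm, by rw [h2 _ hl.1, dact_dact_inv]⟩
      refine ⟨Face.ext fun l => ⟨fun hl => ?_, fun hl => ?_⟩, fun l hl => ?_⟩
      · obtain ⟨m, h3, h4, -, rfl⟩ := key l hl
        rw [Face.mem_smul, Face.mem_inter, dact_inv_dact]
        exact ⟨h3, h4⟩
      · rw [Face.mem_smul, Face.mem_inter] at hl ⊢
        have h5 : D.dact a.w⁻¹ l = D.dact b.w⁻¹ l := by
          rw [← D.dact_inv_dact a.w (D.dact b.w⁻¹ l), ← h2 _ hl.1, dact_dact_inv]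
        rwa [h5]
      · obtain ⟨m, h3, h4, h5, h6⟩ := key l hl
        have h7 : l (a.w.1 v) = m v := by rw [h5, dact_apply, W_inv_apply_self]
        have h8 : l (b.w.1 v) = m v := by rw [h6, dact_apply, W_inv_apply_self]
        rw [h7, h8])

theorem looAct_looPt [FiniteDimensional ℝ V] (σ : D.W) (R T : D.Face) (v : V) (hv : v ∈ interior D.cotits) :
    D.looAct (D.wε σ R) (D.looPt T v hv) =
      D.looPt ((R.inter T).smul σ) (σ.1 v) (act_mem_interior hv σ) :=
  looFun_looPt ⟨σ, R⟩ T v hv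

theorem isLooAction_looAct [FiniteDimensional ℝ V] : D.IsLooAction D.looAct := fun σ R T v hv =>
  congrArg Subtype.val (looAct_looPt σ R T v hv)

/-! ### The facets of Looijenga's cone -/

/-- `v` represents a point of the facet `F_{J⁰}^∨(J^∞)`. -/
structure IsFacetPt (D : KMDatum I V) (J : Set I) (v : V) : Prop where
  interior : v ∈ interior D.cotits
  zero : ∀ i ∈ D.fin J, D.α i v = 0
  pos : ∀ i ∈ D.perp (D.inf J) \ D.fin J, 0 < D.α i v

theorem mem_looFacet {τ : D.W} {J : Set I} {p : D.HHat} :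
    p ∈ D.looFacet τ J ↔
      ∃ v, D.IsFacetPt J v ∧ p = D.proj ((D.Rf (D.inf J)).smul τ) (τ.1 v) := by
  constructor
  · rintro ⟨R, hR, v, hv, h1, h2, rfl⟩
    exact ⟨v, ⟨hv, h1, h2⟩, by rw [hR.eq_Rf]⟩
  · rintro ⟨v, ⟨hv, h1, h2⟩, rfl⟩
    exact ⟨_, Rf_spec (isSpecial_inf J), v, hv, h1, h2, rfl⟩

theorem IsFacetPt.dom {J : Set I} {v : V} (hv : D.IsFacetPt J v) :
    D.roots.Dom (D.perp (D.inf J)) v := by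
  intro i hi
  by_cases h : i ∈ D.fin J
  · exact (hv.zero i h).ge
  · exact (hv.pos i ⟨hi, h⟩).le

theorem IsFacetPt.zero_set {J : Set I} {v : V} (hv : D.IsFacetPt J v) :
    {k | k ∈ D.perp (D.inf J) ∧ D.α k v = 0} = D.fin J := by
  ext k
  constructor
  · rintro ⟨h1, h2⟩
    by_contra h
    exact (hv.pos k ⟨h1, h⟩).ne' h2
  · exact fun h => ⟨fin_subset_perp J h, hv.zero k h⟩

theorem exists_isFacetPt [FiniteDimensional ℝ V] (J : Set I) : ∃ v, D.IsFacetPt J v := by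
  classical
  obtain ⟨v, hv⟩ := D.exists_point fun i => if i ∈ D.fin J then 0 else 1
  have h0 : {i | D.α i v = 0} = D.fin J := by
    ext i
    change D.α i v = 0 ↔ _
    rw [hv]
    split_ifs with h <;> simp [h]
  refine ⟨v, mem_interior_of_finite (fun i => ?_) ?_, fun i hi => ?_, fun i hi => ?_⟩
  · rw [hv]; split_ifs <;> norm_num
  · rw [h0]; exact par_finite_of_fin (fin_fin J)
  · rw [hv, if_pos hi]
  · rw [hv, if_neg hi.2]; norm_num

theorem apply_par_inf {Θ : Set I} (hΘ : D.IsSpecial Θ) {l : Module.Dual ℝ V}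
    (hl : l ∈ (D.Rf Θ).1) {u : D.W} (hu : u ∈ D.par Θ) (v : V) : l (u.1 v) = l v := by
  have h1 := Rf_dact_fix hΘ hl (inv_mem hu)
  have h2 : D.dact u⁻¹ l v = l (u.1 v) := by rw [dact_apply, inv_inv]
  rw [← h2, h1]

theorem proj_Rf_smul_mul [FiniteDimensional ℝ V] {Θ : Set I} (hΘ : D.IsSpecial Θ) (τ : D.W) {a : D.W} (ha : a ∈ D.par Θ)
    (v : V) : D.proj ((D.Rf Θ).smul (τ * a)) ((τ * a).1 v) =
      D.proj ((D.Rf Θ).smul τ) (τ.1 v) := by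
  rw [proj_eq_iff]
  have h1 : (D.Rf Θ).smul (τ * a) = (D.Rf Θ).smul τ := by
    rw [← Face.smul_smul, Rf_smul_self hΘ ha]
  refine ⟨h1, fun l hl => ?_⟩
  rw [h1, Face.mem_smul] at hl
  have h2 := apply_par_inf hΘ hl ha v
  rw [dact_apply, dact_apply, inv_inv] at h2
  exact h2

/-- The part of `u` in `W_{J⁰}` fixes `v` and stabilizes `R(J^∞)`. The part in `W_{J^∞}` acts
trivially on the quotient. -/
theorem proj_facet_mul [FiniteDimensional ℝ V] {J : Set I} {v : V} (hv : D.IsFacetPt J v) (τ : D.W) {u : D.W}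
    (hu : u ∈ D.par J) : D.proj ((D.Rf (D.inf J)).smul (τ * u)) ((τ * u).1 v) =
      D.proj ((D.Rf (D.inf J)).smul τ) (τ.1 v) := by
  rw [← fin_union_inf (D := D) J] at hu
  obtain ⟨b, hb, a, ha, rfl⟩ := mem_par_union (fin_subset_perp J) hu
  rw [← mul_assoc, proj_Rf_smul_mul (isSpecial_inf J) _ ha, ← Face.smul_smul,
    Rf_smul_perp (isSpecial_inf J) (par_mono (fin_subset_perp J) hb), W_mul_apply]
  have : b.1 v = v := D.roots.ν_eq_self_of_mem_par (J := D.fin J) (fun j hj => hv.zero j hj) hb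
  rw [this]

theorem looFacet_mul [FiniteDimensional ℝ V] {J : Set I} (τ : D.W) {u : D.W} (hu : u ∈ D.par J) :
    D.looFacet (τ * u) J = D.looFacet τ J := by
  ext p
  rw [mem_looFacet, mem_looFacet]
  refine exists_congr fun v => and_congr_right fun hv => ?_
  rw [proj_facet_mul hv τ hu]

theorem looFacet_eq_of_coset_eq [FiniteDimensional ℝ V] {τ τ' : D.W} {J J' : Set I} (h : D.coset τ J = D.coset τ' J') :
    D.looFacet τ J = D.looFacet τ' J' := by
  obtain ⟨rfl, h'⟩ := coset_eq_iff.1 h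
  rw [← looFacet_mul τ h', mul_inv_cancel_left]

/-- The roots indexed by `Θ^⊥` vanish on the `h j` with `j ∈ Θ`, so they descend to the quotient. -/
theorem α_eq_of_Rf {Θ : Set I} (hΘ : D.IsSpecial Θ) {v u : V} (h : ∀ l ∈ (D.Rf Θ).1, l v = l u)
    {i : I} (hi : i ∈ D.perp Θ) : D.α i v = D.α i u := by
  have h1 : v - u ∈ Submodule.span ℝ (D.h '' Θ) := mem_span_h_iff.2 fun l hl => by
    rw [map_sub, h l ((mem_Rf hΘ).2 hl), sub_self]
  have h2 : Submodule.span ℝ (D.h '' Θ) ≤ LinearMap.ker (D.α i) := by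
    rw [Submodule.span_le]
    rintro _ ⟨j, hj, rfl⟩
    change D.α i (D.h j) = 0
    rw [D.pairing, D.zero_symm _ _ (hi j hj)]; simp
  have h3 : D.α i (v - u) = 0 := h2 h1
  rwa [map_sub, sub_eq_zero] at h3

/-- Equality of the faces gives `J^∞ = J'^∞` and `τ'⁻¹ τ = w u` with `w ∈ W_{(J^∞)^⊥}`, `u ∈
W_{J^∞}`. On the roots of `(J^∞)^⊥` the vectors `w v` and `v'` agree and are dominant. So `w` fixes
`v`, lies in `W_{J⁰}`, and the zero sets `J⁰` and `J'⁰` coincide. -/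
theorem coset_eq_of_mem_looFacet [FiniteDimensional ℝ V] {τ τ' : D.W} {J J' : Set I} {p : D.HHat}
    (h : p ∈ D.looFacet τ J) (h' : p ∈ D.looFacet τ' J') : D.coset τ J = D.coset τ' J' := by
  obtain ⟨v, hv, rfl⟩ := mem_looFacet.1 h
  obtain ⟨v', hv', heq⟩ := mem_looFacet.1 h'
  rw [proj_eq_iff] at heq
  obtain ⟨hR, hl⟩ := heq
  have hΘ := D.isSpecial_inf J
  have hΘ' := D.isSpecial_inf J'
  have hR' : (D.Rf (D.inf J)).smul (τ'⁻¹ * τ) = D.Rf (D.inf J') := by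
    rw [← Face.smul_smul, hR, Face.smul_smul, inv_mul_cancel, Face.smul_one]
  obtain ⟨hΘΘ, w, hw, u, hu, hwu⟩ := Rf_smul_eq hΘ hΘ' hR'
  have h1 : ∀ l ∈ (D.Rf (D.inf J)).1, l (w.1 v) = l v' := by
    intro l hlR
    have h2 : D.dact τ' l ∈ ((D.Rf (D.inf J)).smul τ).1 := by
      rw [hR, Face.mem_smul, dact_inv_dact, ← hΘΘ]; exact hlR
    have h3 := hl _ h2
    rw [dact_apply, dact_apply, W_inv_apply_self, ← W_mul_apply, hwu, W_mul_apply] at h3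
    rw [← h3]
    have h4 : D.dact w⁻¹ l ∈ (D.Rf (D.inf J)).1 := (mem_Rf hΘ).2
      (specialFace_dact ((mem_Rf hΘ).1 hlR) (inv_mem hw))
    have h5 := apply_par_inf hΘ h4 hu v
    rw [dact_apply, dact_apply, inv_inv] at h5
    exact h5.symm
  have h2 : ∀ i ∈ D.perp (D.inf J), D.α i (w.1 v) = D.α i v' := fun i hi => α_eq_of_Rf hΘ h1 hi
  have hdom : D.roots.Dom (D.perp (D.inf J)) (D.roots.ν w v) := by
    intro i hi
    have := hv'.dom i (by rwa [← hΘΘ])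
    exact this.trans_eq (h2 i hi).symm
  obtain ⟨h3, h4⟩ := D.roots.ν_eq_self_of_dom hw hv.dom hdom
  have h4' : w ∈ D.par (D.fin J) := by rw [← hv.zero_set]; exact h4
  have h3' : w.1 v = v := h3
  have hfin : D.fin J = D.fin J' := by
    rw [← hv.zero_set, ← hv'.zero_set, ← hΘΘ]
    ext k
    refine and_congr_right fun hk => ?_
    rw [← h2 k hk, h3']
  have hJ : J = J' := by
    rw [← fin_union_inf (D := D) J, ← fin_union_inf (D := D) J', hΘΘ, hfin]
  symm
  refine coset_eq_iff.2 ⟨hJ.symm, ?_⟩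
  rw [← hJ, hwu]
  exact mul_mem (par_mono (fin_subset J) h4') (par_mono (inf_subset J) hu)

theorem looFacet_nonempty [FiniteDimensional ℝ V] (τ : D.W) (J : Set I) : (D.looFacet τ J).Nonempty := by
  obtain ⟨v, hv⟩ := D.exists_isFacetPt J
  exact ⟨_, mem_looFacet.2 ⟨v, hv, rfl⟩⟩

theorem looFacet_subset [FiniteDimensional ℝ V] (τ : D.W) (J : Set I) : D.looFacet τ J ⊆ D.Loo := by
  intro p hp
  obtain ⟨v, hv, rfl⟩ := mem_looFacet.1 hp
  exact ⟨_, _, act_mem_interior hv.interior τ, rfl⟩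

/-- Make the vector dominant by an element of `W_{Θ^⊥}`, which stabilizes `R(Θ)`. Its zero set in
`Θ^⊥` is of finite type because the vector is interior. -/
theorem exists_mem_looFacet [FiniteDimensional ℝ V] {p : D.HHat} (hp : p ∈ D.Loo) : ∃ τ J, p ∈ D.looFacet τ J := by
  obtain ⟨T, v, hv, rfl⟩ := hp
  obtain ⟨σ, Θ, hΘ, rfl⟩ := exists_eq_smul_Rf T
  have hv1 := act_mem_interior hv σ⁻¹
  have hn : (D.roots.neg (D.perp Θ) (σ⁻¹.1 v)).Finite :=
    D.roots.neg_finite_of_mem_tits (by rw [← cotits_eq]; exact interior_subset hv1) _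
  obtain ⟨w, hw, hdom⟩ := D.roots.exists_dominant hn
  have hv2 := act_mem_interior hv1 w
  set v2 := w.1 (σ⁻¹.1 v) with hv2def
  set K := {k | k ∈ D.perp Θ ∧ D.α k v2 = 0} with hK
  have hKfin : D.fin K = K := fin_eq_of_mem_interior hv2 fun i hi => hi.2
  have hKsub : K ⊆ D.perp Θ := fun i hi => hi.1
  obtain ⟨h1, h2⟩ := inf_fin_union hΘ hKfin hKsub
  refine ⟨σ * w⁻¹, Θ ∪ K, mem_looFacet.2 ⟨v2, ⟨hv2, ?_, ?_⟩, ?_⟩⟩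
  · rw [h2]; exact fun i hi => hi.2
  · rw [h1, h2]
    rintro i ⟨hi, hi'⟩
    exact lt_of_le_of_ne (hdom i hi) fun h => hi' ⟨hi, h.symm⟩
  · rw [h1, ← Face.smul_smul, Rf_smul_perp hΘ (inv_mem hw), W_mul_apply, W_inv_apply_self,
      W_apply_inv_self]

theorem facetsPartition [FiniteDimensional ℝ V] : D.FacetsPartition where
  nonempty := looFacet_nonempty
  subset := looFacet_subset
  eq_iff τ J τ' J' := by
    refine ⟨fun h => ?_, looFacet_eq_of_coset_eq⟩
    obtain ⟨p, hp⟩ := D.looFacet_nonempty τ J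
    exact coset_eq_of_mem_looFacet hp (h ▸ hp)
  disjoint τ J τ' J' h := Set.disjoint_left.2 fun p hp hp' =>
    h (looFacet_eq_of_coset_eq (coset_eq_of_mem_looFacet hp hp'))
  cover _ := exists_mem_looFacet

end KMDatum

/-! ### Decompositions and the image of a facet under an idempotent. -/

namespace KMDatum

open Finset

section Root

variable {I V : Type*} [Fintype I] [NormedAddCommGroup V] [NormedSpace ℝ V]
variable {D : KMDatum I V} {M N : Type*} [AddCommGroup M] [Module ℝ M] [AddCommGroup N]
  [Module ℝ N] (P : RootRep D M N)

/-- A minimal representative sends each simple root of `K` to a positive one. As a simple root is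
not a sum of two nonzero positive vectors, any single term of the combination already has image `a
i`. -/
theorem RootRep.exists_eq_of_minR {K : Set I} {c : D.W} (hc : c ∈ D.minR K) {m : M}
    (hm : P.PosOn K m) {i : I} (h : P.ρ c m = P.a i) : ∃ k ∈ K, P.a i = P.ρ c (P.a k) := by
  classical
  have hc' := P.mem_minR_iff.1 hc
  obtain ⟨n, hn, rfl⟩ := hm
  obtain ⟨k, hk⟩ : ∃ k, n k ≠ 0 := by
    by_contra! h0
    simp only [h0, Nat.cast_zero, zero_smul, sum_const_zero, map_zero] at h
    exact P.a_ne_zero i h.symm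
  have hkK : k ∈ K := by
    by_contra h0
    exact hk (hn k h0)
  set n' : I → ℕ := fun j => if j = k then n k - 1 else n j with hn'
  have h1 : ∑ j, (n j : ℝ) • P.a j = P.a k + ∑ j, (n' j : ℝ) • P.a j := by
    have h2 : ∀ j, (n j : ℝ) • P.a j = (if j = k then P.a k else 0) + (n' j : ℝ) • P.a j := by
      intro j
      by_cases hj : j = k
      · subst hj
        have h3 : (n j : ℝ) = 1 + ((n j - 1 : ℕ) : ℝ) := by
          rw [Nat.cast_sub (Nat.one_le_iff_ne_zero.2 hk)]; simp
        simp only [hn', if_true]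
        rw [h3, add_smul, one_smul]
      · simp [hn', hj]
    rw [sum_congr rfl fun j _ => h2 j, sum_add_distrib]
    simp
  have h2 : P.PosOn K (∑ j, (n' j : ℝ) • P.a j) := by
    refine ⟨n', fun j hj => ?_, rfl⟩
    simp only [hn']
    rw [if_neg (fun h0 : j = k => hj (h0 ▸ hkK)), hn j hj]
  obtain ⟨x, -, hx⟩ := hc' k hkK
  obtain ⟨y, -, hy⟩ := P.pos_map hc' h2
  rw [h1, map_add, hx, hy, ← sum_add_distrib] at h
  have h3 : (fun j => (x j : ℝ) + y j) = fun j => if j = i then 1 else 0 := by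
    refine P.coeff_unique ?_
    simp only [ite_smul, one_smul, zero_smul, sum_ite_eq', mem_univ, if_true]
    rw [← h]
    exact sum_congr rfl fun j _ => by rw [add_smul]
  have h4 : ∀ j, j ≠ i → x j = 0 := by
    intro j hj
    have h5 := congrFun h3 j
    simp only [if_neg hj] at h5
    have h6 : x j + y j = 0 := by exact_mod_cast h5
    omega
  have h5 : P.ρ c (P.a k) = (x i : ℝ) • P.a i := by
    rw [hx]
    refine sum_eq_single i (fun j _ hj => ?_) (by simp)
    rw [h4 j hj]; simp
  refine ⟨k, hkK, ?_⟩
  rw [h5, P.eq_one_of_smul h5]; simp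

end Root

variable {I V : Type*} [Fintype I] [NormedAddCommGroup V] [NormedSpace ℝ V]
variable {D : KMDatum I V}

/-! ### Existence of decompositions -/

theorem exists_decomp1 (D : KMDatum I V) (Θ J : Set I) (w : D.W) :
    ∃ a₁ a₂ y c, D.Decomp1 Θ J w a₁ a₂ y c := by
  obtain ⟨a, ha, y, hy, c, hc, rfl⟩ := exists_minL_minR (Θ ∪ D.perp Θ) J w
  obtain ⟨b, hb, a', ha', rfl⟩ := mem_par_union subset_rfl ha
  exact ⟨b, a', y, c, rfl, hb, ha', hy, hc⟩

theorem dact_α_of_perp {Θ : Set I} {u : D.W} (hu : u ∈ D.par Θ) {i : I} (hi : i ∈ D.perp Θ) :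
    D.dact u (D.α i) = D.α i :=
  dact_eq_self (fun j hj => by rw [D.pairing, D.zero_symm _ _ (hi j hj), Int.cast_zero]) hu

/-- Write `z = x f g` with `x` minimal, `f ∈ W_{(J^∞)^⊥}` and `g ∈ W_{J^∞}`. The minimality of `z`
for `J` passes to `g`, as `f` fixes the roots of `J^∞`; hence `g = 1`. -/
theorem exists_minR_inf {K J : Set I} {z : D.W} (hK : z ∈ D.minL K) (hJz : z ∈ D.minR J) :
    ∃ x c, x ∈ D.minL K ∩ D.minR (D.inf J ∪ D.perp (D.inf J)) ∧
      c ∈ (D.par (D.perp (D.inf J)) : Set D.W) ∩ D.minR (D.fin J) ∧ z = x * c := by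
  obtain ⟨x, hx, e, he, rfl⟩ := exists_minR_mul (D.inf J ∪ D.perp (D.inf J)) z
  have hJ : J ⊆ D.inf J ∪ D.perp (D.inf J) := by
    conv_lhs => rw [← fin_union_inf (D := D) J]
    exact Set.union_subset_union_right _ (fin_subset_perp J)
  have hlen : ∀ u ∈ D.par (D.inf J ∪ D.perp (D.inf J)), D.len (x * u) = D.len x + D.len u :=
    fun u hu => len_mul_of_minR hx hu
  have heJ : e ∈ D.minR J := by
    intro u hu
    have h1 := hJz u hu
    rw [mul_assoc, hlen e he, hlen _ (mul_mem he (par_mono hJ hu))] at h1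
    omega
  obtain ⟨f, hf, g, hg, rfl⟩ := mem_par_union subset_rfl he
  have hg1 : g = 1 := by
    refine eq_one_of_minR_of_mem_par (D.roots.mem_minR_iff.2 fun j hj => ?_) hg
    have h1 := D.roots.mem_minR_iff.1 heJ j (inf_subset J hj)
    rw [par_commute subset_rfl hf hg, RootRep.ρ_mul] at h1
    have h2 : D.roots.ρ f (D.roots.a j) = D.roots.a j :=
      dact_α_of_perp hf (mem_perp_comm.1 subset_rfl hj)
    rwa [h2] at h1
  subst hg1
  rw [mul_one] at *
  exact ⟨x, f, ⟨minL_of_mul hK (hlen f he), hx⟩, ⟨hf, minR_anti (fin_subset J) heJ⟩, rfl⟩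

theorem exists_decomp2 (D : KMDatum I V) (Θ J : Set I) (w : D.W) :
    ∃ a₁ a₂ x c₁ c₂, D.Decomp2 Θ J w a₁ a₂ x c₁ c₂ := by
  obtain ⟨a₁, a₂, z, c, h⟩ := D.exists_decomp1 Θ J w
  obtain ⟨x, f, hx, hf, rfl⟩ := exists_minR_inf h.y_mem.1 h.y_mem.2
  exact ⟨a₁, a₂, x, f, c, by rw [h.eq]; group, h.a₁_mem, h.a₂_mem, hx, hf, h.c_mem, h.y_mem⟩

/-! ### The action on the facets of Looijenga's cone -/

/-- The index set of the facet that contains the image of a facet of type `J`. -/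
def actIndex (D : KMDatum I V) (Θ J : Set I) (x c₁ : D.W) : Set I :=
  D.Xi Θ J x ∪ (D.perp (D.Xi Θ J x) ∩ D.simpleImage c₁ (D.fin J))

theorem Decomp2.inter {Θ J : Set I} (hΘ : D.IsSpecial Θ) {w a₁ a₂ x c₁ c₂ : D.W}
    (h : D.Decomp2 Θ J w a₁ a₂ x c₁ c₂) : D.IsSpecial (D.Xi Θ J x) ∧
      (D.Rf Θ).inter ((D.Rf (D.inf J)).smul (x * c₁)) = D.Rf (D.Xi Θ J x) := by
  have h1 := Rf_inter hΘ (D.isSpecial_inf J) h.x_mem.1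
    (minR_anti Set.subset_union_right h.x_mem.2)
  refine ⟨h1.1, ?_⟩
  rw [← Face.smul_smul, Rf_smul_perp (D.isSpecial_inf J) h.c₁_mem.1]
  exact h1.2

theorem Xi_apply_α {Θ J : Set I} {x c₁ : D.W} {v : V} {i : I} (hi : i ∈ D.perp (D.Xi Θ J x)) :
    D.α i ((x * c₁).1 v) = D.dact c₁⁻¹ (D.α i) v := by
  have h1 : D.dact x⁻¹ (D.α i) = D.α i :=
    dact_α_of_perp (Θ := D.Xi Θ J x) (inv_mem (par_mono Set.subset_union_right (mem_par_red x))) hi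
  conv_rhs => rw [← h1]
  rw [← dact_mul, ← mul_inv_rev, dact_apply, inv_inv]

variable [FiniteDimensional ℝ V]

theorem looAct_ofW_mem {σ τ : D.W} {J : Set I} {p : D.Loo} (hp : p.1 ∈ D.looFacet τ J) :
    (D.looAct (D.ofW σ) p).1 ∈ D.looFacet (σ * τ) J := by
  obtain ⟨v, hv, hpv⟩ := mem_looFacet.1 hp
  have h1 : p = D.looPt ((D.Rf (D.inf J)).smul τ) (τ.1 v) (act_mem_interior hv.interior τ) :=
    Subtype.ext hpv
  rw [h1, ofW, looAct_looPt, full_inter]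
  refine mem_looFacet.2 ⟨v, hv, ?_⟩
  rw [← Face.smul_smul]
  rfl

/-- For `i ∈ Ξ^⊥` the element `x` fixes `α i`, so the value there is that of `c₁⁻¹ α i` at `v`. This
is a positive root of `W_{(J^∞)^⊥}`, hence the value is nonnegative. It vanishes only if the root is
supported on `J⁰`, and the minimality of `c₁` then makes it a simple root of `J⁰`. -/
theorem Decomp2.isFacetPt {Θ J : Set I} (hΘ : D.IsSpecial Θ) {w a₁ a₂ x c₁ c₂ : D.W}
    (h : D.Decomp2 Θ J w a₁ a₂ x c₁ c₂) {v : V} (hv : D.IsFacetPt J v) :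
    D.inf (D.actIndex Θ J x c₁) = D.Xi Θ J x ∧
      D.IsFacetPt (D.actIndex Θ J x c₁) ((x * c₁).1 v) := by
  obtain ⟨hΞ, -⟩ := h.inter hΘ
  set Ξ := D.Xi Θ J x with hΞdef
  set K := D.perp Ξ ∩ D.simpleImage c₁ (D.fin J) with hK
  have happ : ∀ i ∈ D.perp Ξ, D.α i ((x * c₁).1 v) = D.dact c₁⁻¹ (D.α i) v := fun i hi =>
    Xi_apply_α hi
  have hint : (x * c₁).1 v ∈ interior D.cotits := act_mem_interior hv.interior _
  have hzero : ∀ i ∈ K, D.α i ((x * c₁).1 v) = 0 := by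
    rintro i ⟨hi, j, hj, hij⟩
    rw [happ i hi, hij, dact_inv_dact]
    exact hv.zero j hj
  have hpos : ∀ i ∈ D.perp Ξ \ K, 0 < D.α i ((x * c₁).1 v) := by
    rintro i ⟨hi, hiK⟩
    have hi1 : i ∈ D.perp Θ := perp_anti (fun k hk => Or.inl (Or.inl hk)) hi
    have hi2 : i ∈ D.perp (D.inf J) := perp_anti (fun k hk => Or.inl (Or.inr hk)) hi
    have h1 : D.roots.Pos (D.dact c₁⁻¹ (D.α i)) := by
      have h2 := D.roots.mem_minL_iff.1 h.xc₁_mem.1 i (Or.inr hi1)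
      rw [mul_inv_rev, RootRep.ρ_mul] at h2
      have h3 : D.roots.ρ x⁻¹ (D.roots.a i) = D.α i := dact_α_of_perp (Θ := Ξ)
        (inv_mem (par_mono Set.subset_union_right (mem_par_red x))) hi
      rwa [h3] at h2
    obtain ⟨n, hn, hβ⟩ := D.roots.posOn_of_mem_par (inv_mem h.c₁_mem.1) hi2 h1
    have hterm : ∀ k, 0 ≤ (n k : ℝ) * D.α k v := by
      intro k
      by_cases hk : k ∈ D.perp (D.inf J)
      · exact mul_nonneg (Nat.cast_nonneg _) (hv.dom k hk)
      · rw [hn k hk]; simp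
    have hsum : D.dact c₁⁻¹ (D.α i) v = ∑ k, (n k : ℝ) * D.α k v := by
      have h2 : D.dact c₁⁻¹ (D.α i) = ∑ k, (n k : ℝ) • D.α k := hβ
      rw [h2, LinearMap.sum_apply]
      rfl
    rw [happ i hi, hsum]
    refine lt_of_le_of_ne (sum_nonneg fun k _ => hterm k) fun h0 => hiK ⟨hi, ?_⟩
    have h2 := (sum_eq_zero_iff_of_nonneg fun k _ => hterm k).1 h0.symm
    have h3 : D.roots.PosOn (D.fin J) (D.dact c₁⁻¹ (D.α i)) := by
      refine ⟨n, fun k hk => ?_, hβ⟩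
      by_contra hnk
      by_cases hk' : k ∈ D.perp (D.inf J)
      · have h4 := hv.pos k ⟨hk', hk⟩
        have h5 : (n k : ℝ) ≠ 0 := Nat.cast_ne_zero.2 hnk
        exact mul_ne_zero h5 h4.ne' (h2 k (mem_univ k))
      · exact hnk (hn k hk')
    exact D.roots.exists_eq_of_minR h.c₁_mem.2 h3 (D.dact_dact_inv c₁ (D.α i))
  obtain ⟨h1, h2⟩ := inf_fin_union hΞ (fin_eq_of_mem_interior hint hzero)
    (Set.inter_subset_left)
  refine ⟨h1, hint, ?_, ?_⟩
  · rw [actIndex, h2]; exact hzero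
  · rw [actIndex, h2, h1]; exact hpos

/-- Since `a₁ a₂` stabilizes `R(Θ)`, it can be pulled out of the intersection. Then `a₂ ∈ W_Θ ⊆ W_Ξ`
disappears modulo the span of the `h i` with `i ∈ Ξ`. -/
theorem Decomp2.looAct_mem {Θ J : Set I} (hΘ : D.IsSpecial Θ) {w a₁ a₂ x c₁ c₂ : D.W}
    (h : D.Decomp2 Θ J w a₁ a₂ x c₁ c₂) {p : D.Loo} (hp : p.1 ∈ D.looFacet w J) :
    (D.looAct (D.ε (D.Rf Θ)) p).1 ∈ D.looFacet a₁ (D.actIndex Θ J x c₁) := by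
  rw [h.eq, looFacet_mul _ h.c₂_mem] at hp
  obtain ⟨v, hv, hpv⟩ := mem_looFacet.1 hp
  obtain ⟨h1, h2⟩ := h.isFacetPt hΘ hv
  obtain ⟨h3, h4⟩ := h.inter hΘ
  have h5 : p = D.looPt _ _ (act_mem_interior hv.interior (a₁ * a₂ * x * c₁)) :=
    Subtype.ext hpv
  have h6 : ((D.Rf Θ).inter ((D.Rf (D.inf J)).smul (a₁ * a₂ * x * c₁))).smul 1 =
      (D.Rf (D.Xi Θ J x)).smul (a₁ * a₂) := by
    have h7 : (D.Rf Θ).smul (a₁ * a₂) = D.Rf Θ := by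
      rw [← Face.smul_smul, Rf_smul_self hΘ h.a₂_mem, Rf_smul_perp hΘ h.a₁_mem]
    rw [← h4, Face.smul_one, Face.smul_inter, h7, Face.smul_smul, mul_assoc (a₁ * a₂)]
  rw [h5, ε, looAct_looPt, h6]
  refine mem_looFacet.2 ⟨_, h2, ?_⟩
  rw [h1, ← proj_Rf_smul_mul h3 a₁ (par_mono (fun i hi => Or.inl (Or.inl hi)) h.a₂_mem)]
  change D.proj _ ((a₁ * a₂ * x * c₁).1 v) = _
  rw [mul_assoc (a₁ * a₂)]
  rfl

end KMDatum

/-! ### Good action 2: construction, stabilizers, faithfulness and order. -/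

namespace KMDatum

open Finset

variable {I V : Type*} [Fintype I] [NormedAddCommGroup V] [NormedSpace ℝ V]
variable {D : KMDatum I V}

/-! ### Comparison of the index sets for nested facets -/

/-- Contrapositively, a connected subset of a component of finite type is of finite type, because
its parabolic subgroup has only finitely many roots. -/
theorem inf_mono {J K : Set I} (h : J ⊆ K) : D.inf J ⊆ D.inf K := by
  rintro i ⟨hi, hi'⟩
  refine ⟨h hi, fun hfin => hi' ?_⟩
  have h1 : D.fin (D.comp K i) = D.comp K i := by
    refine subset_antisymm (fin_subset _) fun j hj => ⟨hj, ?_⟩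
    have h2 : D.comp (D.comp K i) j = D.comp K j :=
      (comp_eq_of_closed (comp_subset (h hi)) (fun a ha b hb hab =>
        mem_comp_of_adj (h hi) ha hb hab) hj).symm
    rw [h2, comp_eq_of_mem hj]
    exact hfin
  have h2 : (D.par (D.comp K i) : Set D.W).Finite := h1 ▸ par_finite_of_fin (fin_fin (D.comp K i))
  have h3 : D.comp J i ⊆ D.comp K i := fun j hj =>
    Relation.ReflTransGen.mono (fun _ _ hab => ⟨h hab.1, h hab.2.1, hab.2.2⟩) i j hj
  exact isFiniteType_of_finite (conn_comp hi)
    ((D.roots.rts_finite h2).subset fun β hβ => D.roots.rts_mono h3 hβ.1)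

theorem specialFace_anti {Θ Θ' : Set I} (h : Θ ⊆ Θ') : D.specialFace Θ' ⊆ D.specialFace Θ := by
  rintro _ ⟨w, hw, m, hm, rfl⟩
  exact ⟨w, par_mono (perp_anti h) hw, m, ⟨fun i hi => hm.1 i (h hi), fun i _ =>
    closedFacet_subset _ hm i⟩, rfl⟩

/-- As `i ∉ red x`, the form `-α i` is dominant for `red x`. Being fixed by `x`, it puts `x` into
the subgroup generated by the `s k` with `α i (h k) = 0`. -/
theorem mem_perp_red_of_fix {x : D.W} {i : I} (hi : i ∉ D.red x)
    (h : D.dact x (D.α i) = D.α i) : i ∈ D.perp (D.red x) := by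
  have hdom : D.coroots.Dom (D.red x) (-D.α i) := by
    intro j hj
    change 0 ≤ (-D.α i) (D.h j)
    have hji : j ≠ i := fun h0 => hi (h0 ▸ hj)
    rw [LinearMap.neg_apply, D.pairing]
    have := D.A_nonpos hji
    linarith
  have h1 : D.coroots.ν x (-D.α i) = -D.α i := by
    rw [map_neg]; exact congrArg Neg.neg h
  have h2 := (D.coroots.ν_eq_self_of_dom (mem_par_red x) hdom (by rw [h1]; exact hdom)).2
  intro k hk
  have h3 := (red_subset_iff.2 h2 hk).2
  have h4 : (-D.α i) (D.h k) = 0 := h3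
  rw [LinearMap.neg_apply, D.pairing, neg_eq_zero] at h4
  exact D.zero_symm _ _ (by exact_mod_cast h4)

theorem mem_or_eq_of_dact {Ξ : Set I} {x : D.W} (hx : x ∈ D.par Ξ) {i l : I}
    (h : D.α i = D.dact x (D.α l)) : i ∈ Ξ ∨ i = l := by
  classical
  obtain ⟨c, hc, h1⟩ := D.roots.ρ_eq_add hx (D.α l)
  by_contra! h0
  have h2 : (fun j => if j = i then (1 : ℝ) else 0) = fun j => (if j = l then 1 else 0) + c j := by
    refine D.roots.coeff_unique ?_
    simp only [add_smul, sum_add_distrib, ite_smul, one_smul, zero_smul, sum_ite_eq', mem_univ,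
      if_true]
    exact h.trans h1
  have h3 := congrFun h2 i
  simp [h0.2, hc i h0.1] at h3

theorem mem_of_dact {Ξ : Set I} {x : D.W} (hx : x ∈ D.par Ξ) {i l : I} (hl : l ∈ Ξ)
    (h : D.α i = D.dact x (D.α l)) : i ∈ Ξ := by
  rcases mem_or_eq_of_dact hx h with h1 | rfl
  · exact h1
  · exact hl

/-- The inclusion of the sets `Ξ` follows from that of the faces. For an index `i` outside `Ξ` in
the second part, `α i = x c₁ c₂ α j`. Minimality of `x c₁` replaces `c₂ α j` by a simple root `α k`
of `J`. Here `k ∈ J^∞` would force `i ∈ Ξ`, so `k ∈ J⁰`. Minimality of `x` then gives `α i = x α l`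
with `l ∈ (J^∞)^⊥`, hence `l = i`, and `x` fixes `α i`. -/
theorem Decomp2.actIndex_subset {Θ J J' : Set I} (hΘ : D.IsSpecial Θ) (hJ : J' ⊆ J)
    {z a₁ a₂ x c₁ c₂ a₁' a₂' x' c₁' c₂' : D.W}
    (h : D.Decomp2 Θ J z a₁ a₂ x c₁ c₂) (h' : D.Decomp2 Θ J' z a₁' a₂' x' c₁' c₂')
    (heq : x' * c₁' = x * c₁ * c₂) :
    D.actIndex Θ J' x' c₁' ⊆ D.actIndex Θ J x c₁ := by
  have hc := h.c₂_mem
  obtain ⟨h1, h2⟩ := h.inter hΘ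
  obtain ⟨h1', h2'⟩ := h'.inter hΘ
  have hcJ : (D.Rf (D.inf J)).smul c₂ = D.Rf (D.inf J) := by
    rw [← fin_union_inf (D := D) J] at hc
    obtain ⟨b, hb, a, ha, rfl⟩ := mem_par_union (fin_subset_perp J) hc
    rw [← Face.smul_smul, Rf_smul_self (D.isSpecial_inf J) ha,
      Rf_smul_perp (D.isSpecial_inf J) (par_mono (fin_subset_perp J) hb)]
  have hΞ : D.Xi Θ J' x' ⊆ D.Xi Θ J x := by
    refine (Rf_le (σ := 1) h1 h1' fun l hl => ?_).1
    rw [dact_one]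
    rw [← h2, Face.mem_inter] at hl
    rw [← h2', Face.mem_inter]
    refine ⟨hl.1, ?_⟩
    have h3 := hl.2
    rw [← hcJ, Face.smul_smul, ← heq, Face.mem_smul, mem_Rf (D.isSpecial_inf J)] at h3
    rw [Face.mem_smul, mem_Rf (D.isSpecial_inf J')]
    exact specialFace_anti (inf_mono hJ) h3
  have hxΞ : x ∈ D.par (D.Xi Θ J x) := par_mono Set.subset_union_right (mem_par_red x)
  rintro i (hi | ⟨hi, j, hj, hij⟩)
  · exact Or.inl (hΞ hi)
  by_cases hiΞ : i ∈ D.Xi Θ J x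
  · exact Or.inl hiΞ
  have hx' : x' ∈ D.par (D.Xi Θ J' x') := par_mono Set.subset_union_right (mem_par_red x')
  have h3 : D.α i = D.dact (x * c₁) (D.dact c₂ (D.α j)) := by
    rw [← dact_mul, ← heq, dact_mul, ← hij, dact_α_of_perp hx' hi]
  have hjJ : j ∈ J := hJ (fin_subset J' hj)
  have hposJ : D.roots.PosOn J (D.dact c₂ (D.α j)) := by
    rcases D.roots.pos_or_neg c₂ j with h4 | h4
    · exact D.roots.posOn_of_mem_par hc hjJ h4
    · exfalso
      have h5 := D.roots.pos_map (D.roots.mem_minR_iff.1 h.xc₁_mem.2)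
        (D.roots.negOn_of_mem_par hc hjJ h4)
      rw [map_neg] at h5
      have h6 : D.roots.ρ (x * c₁) (D.roots.ρ c₂ (D.roots.a j)) = D.roots.a i := h3.symm
      rw [h6] at h5
      exact D.roots.a_ne_zero i (RootRep.Pos.eq_zero (D.roots.posOn_a (Set.mem_univ i)) h5)
  obtain ⟨k, hk, hik⟩ := D.roots.exists_eq_of_minR h.xc₁_mem.2 hposJ h3.symm
  replace hik : D.α i = D.dact x (D.dact c₁ (D.α k)) := by
    rw [← dact_mul]; exact hik
  have hkJ := hk
  rw [← fin_union_inf (D := D) J] at hkJ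
  rcases hkJ with hk' | hk'
  · rw [dact_α_of_perp h.c₁_mem.1 (mem_perp_comm.1 subset_rfl hk')] at hik
    exact absurd (mem_of_dact hxΞ (Or.inl (Or.inr hk')) hik) hiΞ
  · have hposP : D.roots.PosOn (D.perp (D.inf J)) (D.dact c₁ (D.α k)) :=
      D.roots.posOn_of_mem_par h.c₁_mem.1 (fin_subset_perp J hk')
        (D.roots.mem_minR_iff.1 h.c₁_mem.2 k hk')
    obtain ⟨l, hl, hil⟩ := D.roots.exists_eq_of_minR
      (minR_anti Set.subset_union_right h.x_mem.2) hposP hik.symm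
    replace hil : D.α i = D.dact x (D.α l) := hil
    rcases mem_or_eq_of_dact hxΞ hil with h4 | rfl
    · exact absurd h4 hiΞ
    refine Or.inr ⟨?_, k, hk', ?_⟩
    · have h5 := mem_perp_red_of_fix (fun h0 => hiΞ (Or.inr h0)) hil.symm
      rintro j ((h6 | h6) | h6)
      · exact hi j (Or.inl (Or.inl h6))
      · exact hl j h6
      · exact h5 j h6
    · exact (D.dact x).injective (hil.symm.trans hik)

theorem exists_decomp2_of_minL {Θ J : Set I} {z : D.W} (hz : z ∈ D.minL (Θ ∪ D.perp Θ)) :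
    ∃ x c₁ c₂, D.Decomp2 Θ J z 1 1 x c₁ c₂ := by
  obtain ⟨y, hy, c, hc, rfl⟩ := exists_minR_mul J z
  have hyL : y ∈ D.minL (Θ ∪ D.perp Θ) := minL_of_mul hz (len_mul_of_minR hy hc)
  obtain ⟨x, c₁, hx, hc₁, rfl⟩ := exists_minR_inf hyL hy
  exact ⟨x, c₁, c, by simp, one_mem _, one_mem _, hx, hc₁, hc, hyL, hy⟩

/-- For a special face, `Rf_le` places `σ` in `W_{Θ^⊥} W_Θ`, which stabilizes it. The general face
is a translate. -/
theorem Face.smul_eq_of_le {F : D.Face} {σ : D.W} (h : ∀ l ∈ (F.smul σ).1, l ∈ F.1) :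
    F.smul σ = F := by
  obtain ⟨ρ, Θ, hΘ, rfl⟩ := exists_eq_smul_Rf F
  obtain ⟨-, w, hw, u, hu, h1⟩ := Rf_le (σ := ρ⁻¹ * σ * ρ) hΘ hΘ fun l hl => by
    have h2 := h (D.dact (σ * ρ) l) (by
      rw [Face.smul_smul, Face.mem_smul, dact_inv_dact]; exact hl)
    rwa [Face.mem_smul, ← dact_mul, ← mul_assoc] at h2
  have h2 : σ * ρ = ρ * (w * u) := by rw [← h1]; group
  rw [Face.smul_smul, h2, ← Face.smul_smul, ← Face.smul_smul w, Rf_smul_self hΘ hu,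
    Rf_smul_perp hΘ hw]

theorem Face.inter_eq_of_smul {F R : D.Face} {σ : D.W} (h : R.inter F = F.smul σ) :
    R.inter F = F := by
  rw [h]
  refine Face.smul_eq_of_le fun l hl => ?_
  rw [← h] at hl
  exact hl.2

theorem inter_eq_of_looFacet {R : D.Face} {σ τ τ' : D.W} {J : Set I} {u : V}
    (h : D.proj ((R.inter ((D.Rf (D.inf J)).smul τ)).smul σ) u ∈ D.looFacet τ' J) :
    R.inter ((D.Rf (D.inf J)).smul τ) = (D.Rf (D.inf J)).smul τ := by
  obtain ⟨v, -, h1⟩ := mem_looFacet.1 h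
  have h2 := congrArg (Face.smul σ⁻¹) (proj_eq_iff.1 h1).1
  refine Face.inter_eq_of_smul (σ := σ⁻¹ * τ' * τ⁻¹) ?_
  rw [Face.smul_smul, inv_mul_cancel, Face.smul_one] at h2
  rw [h2, Face.smul_smul, Face.smul_smul, inv_mul_cancel_right]

/-! ### Good action 2 -/

variable [FiniteDimensional ℝ V]

theorem Decomp2.looAct_mem' {Θ J : Set I} (hΘ : D.IsSpecial Θ) {σ₁ σ₂ τ a₁ a₂ x c₁ c₂ : D.W}
    (h : D.Decomp2 Θ J (σ₂ * τ) a₁ a₂ x c₁ c₂) {p : D.Loo} (hp : p.1 ∈ D.looFacet τ J) :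
    (D.looAct (D.ofW σ₁ * D.ε (D.Rf Θ) * D.ofW σ₂) p).1 ∈
      D.looFacet (σ₁ * a₁) (D.actIndex Θ J x c₁) := by
  rw [map_mul, map_mul]
  exact looAct_ofW_mem (h.looAct_mem hΘ (looAct_ofW_mem hp))

/-- The element of the Coxeter complex that belongs to the facet of a point. -/
noncomputable def facetOf (p : D.Loo) : D.Cox :=
  D.coset (exists_mem_looFacet p.2).choose (exists_mem_looFacet p.2).choose_spec.choose

theorem facetOf_eq_iff {p : D.Loo} {τ : D.W} {J : Set I} :
    facetOf p = D.coset τ J ↔ p.1 ∈ D.looFacet τ J := by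
  have h := (exists_mem_looFacet p.2).choose_spec.choose_spec
  constructor
  · intro h1
    rwa [← looFacet_eq_of_coset_eq h1]
  · exact coset_eq_of_mem_looFacet h

theorem exists_facetOf (x : D.Cox) : ∃ p : D.Loo, facetOf p = x := by
  obtain ⟨τ, J, rfl⟩ := exists_coset x
  obtain ⟨p, hp⟩ := D.looFacet_nonempty τ J
  exact ⟨⟨p, looFacet_subset τ J hp⟩, facetOf_eq_iff.2 hp⟩

/-- The facet of the image is computed from a decomposition of `σ₂ τ` alone, not from the point. -/
theorem facetOf_looAct_congr (m : D.FaceMonoid) {p q : D.Loo} (h : facetOf p = facetOf q) :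
    facetOf (D.looAct m p) = facetOf (D.looAct m q) := by
  obtain ⟨σ₁, σ₂, Θ, R, hΘ, hR, rfl⟩ := exists_ofW_ε_ofW m
  obtain ⟨τ, J, hq⟩ := exists_coset (facetOf q)
  obtain ⟨a₁, a₂, x, c₁, c₂, hd⟩ := D.exists_decomp2 Θ J (σ₂ * τ)
  rw [hR.eq_Rf, facetOf_eq_iff.2 (hd.looAct_mem' hΘ (facetOf_eq_iff.1 (h.trans hq))),
    facetOf_eq_iff.2 (hd.looAct_mem' hΘ (facetOf_eq_iff.1 hq))]

/-- Good action 2, as the action on the set of facets of Looijenga's cone. -/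
noncomputable def cellAct (D : KMDatum I V) : D.FaceMonoid →* Function.End D.Cox where
  toFun m x := facetOf (D.looAct m (exists_facetOf x).choose)
  map_one' := by
    funext x
    rw [map_one]
    exact (exists_facetOf x).choose_spec
  map_mul' m n := by
    funext x
    rw [map_mul]
    exact facetOf_looAct_congr m (exists_facetOf
      (facetOf (D.looAct n (exists_facetOf x).choose))).choose_spec.symm

theorem cellAct_facetOf (m : D.FaceMonoid) (p : D.Loo) :
    D.cellAct m (facetOf p) = facetOf (D.looAct m p) :=
  facetOf_looAct_congr m (exists_facetOf (facetOf p)).choose_spec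

theorem cellAct_eq_iff {m : D.FaceMonoid} {p : D.Loo} {τ τ' : D.W} {J J' : Set I}
    (hp : p.1 ∈ D.looFacet τ J) :
    D.cellAct m (D.coset τ J) = D.coset τ' J' ↔ (D.looAct m p).1 ∈ D.looFacet τ' J' := by
  rw [← facetOf_eq_iff.2 hp, cellAct_facetOf, facetOf_eq_iff]

theorem isInducedBy_looAct : D.IsInducedBy D.cellAct D.looAct :=
  fun _ _ _ _ _ h _ hp => (cellAct_eq_iff hp).1 h

theorem isAction2_cellAct : D.IsAction2 D.cellAct := by
  intro Θ hΘ R hR σ₁ σ₂ τ J a₁ a₂ x c₁ c₂ hd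
  obtain ⟨p, hp⟩ := D.looFacet_nonempty τ J
  rw [hR.eq_Rf]
  exact (cellAct_eq_iff (p := ⟨p, looFacet_subset τ J hp⟩) hp).2 (hd.looAct_mem' hΘ hp)

theorem cellAct_ofW (σ τ : D.W) (J : Set I) :
    D.cellAct (D.ofW σ) (D.coset τ J) = D.coset (σ * τ) J := by
  obtain ⟨p, hp⟩ := D.looFacet_nonempty τ J
  exact (cellAct_eq_iff (p := ⟨p, looFacet_subset τ J hp⟩) hp).2 (looAct_ofW_mem hp)

theorem cellAct_ε {Θ J : Set I} (hΘ : D.IsSpecial Θ) {w a₁ a₂ x c₁ c₂ : D.W}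
    (h : D.Decomp2 Θ J w a₁ a₂ x c₁ c₂) :
    D.cellAct (D.ε (D.Rf Θ)) (D.coset w J) = D.coset a₁ (D.actIndex Θ J x c₁) := by
  obtain ⟨p, hp⟩ := D.looFacet_nonempty w J
  exact (cellAct_eq_iff (p := ⟨p, looFacet_subset w J hp⟩) hp).2 (h.looAct_mem hΘ hp)

/-- The point of the facet `τ F_{J⁰}^∨(J^∞)` that is represented by `τ v`. -/
theorem IsFacetPt.mem_looFacet {J : Set I} {v : V} (hv : D.IsFacetPt J v) (τ : D.W) :
    (D.looPt ((D.Rf (D.inf J)).smul τ) (τ.1 v) (act_mem_interior hv.interior τ)).1 ∈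
      D.looFacet τ J :=
  KMDatum.mem_looFacet.2 ⟨v, hv, rfl⟩

theorem looAct_facet_iff {J J' : Set I} {v : V} (hv : D.IsFacetPt J v) {σ τ τ' : D.W}
    {R : D.Face} : D.cellAct (D.wε σ R) (D.coset τ J) = D.coset τ' J' ↔
      D.proj ((R.inter ((D.Rf (D.inf J)).smul τ)).smul σ) (σ.1 (τ.1 v)) ∈ D.looFacet τ' J' := by
  rw [cellAct_eq_iff (hv.mem_looFacet τ), looAct_looPt]
  rfl

/-- If the type is unchanged, intersecting with `R` turns the face of the facet into a translate of
itself contained in it, hence changes nothing. Then `σ ε(R)` acts like `σ`. -/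
theorem cellAct_wε_eq {R : D.Face} {σ τ τ' : D.W} {J : Set I} :
    D.cellAct (D.wε σ R) (D.coset τ J) = D.coset τ' J ↔
      R.inter ((D.Rf (D.inf J)).smul τ) = (D.Rf (D.inf J)).smul τ ∧
        D.coset (σ * τ) J = D.coset τ' J := by
  obtain ⟨v, hv⟩ := D.exists_isFacetPt J
  rw [looAct_facet_iff hv]
  have h1 : D.proj (((D.Rf (D.inf J)).smul τ).smul σ) (σ.1 (τ.1 v)) ∈ D.looFacet (σ * τ) J := by
    rw [Face.smul_smul]
    exact hv.mem_looFacet (σ * τ)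
  constructor
  · intro h
    have h2 := inter_eq_of_looFacet h
    refine ⟨h2, ?_⟩
    rw [h2] at h
    exact coset_eq_of_mem_looFacet h1 h
  · rintro ⟨h2, h3⟩
    rwa [h2, ← looFacet_eq_of_coset_eq h3]

theorem stabilizer_cellAct (J : Set I) :
    {m | D.cellAct m (D.coset 1 J) = D.coset 1 J} = D.parMonoid J := by
  ext m
  obtain ⟨σ, R, rfl⟩ := exists_wε m
  constructor
  · intro h
    obtain ⟨h1, h2⟩ := cellAct_wε_eq.1 h
    rw [coset_eq_iff, mul_one, mul_one] at h2
    rw [Face.smul_one] at h1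
    refine ⟨σ, by simpa using inv_mem h2.2, R, fun l hl => ?_, (ofW_mul_ε σ R).symm⟩
    have h3 := (mem_Rf (D.isSpecial_inf J)).2 hl
    rw [← h1] at h3
    exact h3.1
  · rintro ⟨u, hu, S, hS, h⟩
    rw [h, ofW_mul_ε]
    refine cellAct_wε_eq.2 ⟨?_, ?_⟩
    · rw [Face.smul_one]
      exact Face.ext fun l => ⟨fun hl => hl.2, fun hl =>
        ⟨hS ((mem_Rf (D.isSpecial_inf J)).1 hl), hl⟩⟩
    · rw [coset_eq_iff]
      exact ⟨rfl, by simpa using hu⟩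

/-- Test on `ρ W_Θ`, where `R = ρ R(Θ)`. There `σ ε(R)` preserves the type, so an element acting
equally has a face containing `R` and agrees with `σ` on `R`. Exchanging the roles finishes the
argument. -/
theorem injective_cellAct : Function.Injective D.cellAct := by
  have key : ∀ σ σ' (R R' : D.Face), D.cellAct (D.wε σ R) = D.cellAct (D.wε σ' R') →
      R'.inter R = R ∧ ∀ l ∈ R.1, D.dact σ' l = D.dact σ l := by
    intro σ σ' R R' h
    obtain ⟨ρ, Θ, hΘ, rfl⟩ := exists_eq_smul_Rf R
    have h1 : D.cellAct (D.wε σ ((D.Rf Θ).smul ρ)) (D.coset ρ Θ) = D.coset (σ * ρ) Θ :=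
      cellAct_wε_eq.2 ⟨by rw [← hΘ]; exact Face.ext fun l => and_self_iff, rfl⟩
    rw [h] at h1
    obtain ⟨h2, h3⟩ := cellAct_wε_eq.1 h1
    rw [← hΘ] at h2
    refine ⟨h2, fun l hl => ?_⟩
    rw [Face.mem_smul] at hl
    have h4 := (coset_eq_iff.1 h3).2
    have h5 := Rf_dact_fix hΘ hl h4
    have h6 : D.dact (σ' * ρ) (D.dact ((σ' * ρ)⁻¹ * (σ * ρ)) (D.dact ρ⁻¹ l)) =
        D.dact (σ' * ρ) (D.dact ρ⁻¹ l) := by rw [h5]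
    rw [← dact_mul, ← dact_mul, ← dact_mul] at h6
    rw [show σ' * ρ * ((σ' * ρ)⁻¹ * (σ * ρ)) * ρ⁻¹ = σ by group,
      show σ' * ρ * ρ⁻¹ = σ' by group] at h6
    exact h6.symm
  intro m m' h
  obtain ⟨σ, R, rfl⟩ := exists_wε m
  obtain ⟨σ', R', rfl⟩ := exists_wε m'
  obtain ⟨h1, h2⟩ := key σ σ' R R' h
  obtain ⟨h3, -⟩ := key σ' σ R' R h.symm
  exact wε_eq_iff.2 ⟨h1.symm.trans ((show R'.inter R = R.inter R' from
    Face.ext fun l => and_comm (a := l ∈ R'.1) (b := l ∈ R.1)).trans h3), h2⟩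

/-- A decomposition for `J` can be built from one for `J'` with the same first two factors, which
leaves only the index sets to compare. -/
theorem cellAct_ε_le {Θ J J' : Set I} (hΘ : D.IsSpecial Θ) (hJ : J' ⊆ J) (w : D.W) :
    D.cellAct (D.ε (D.Rf Θ)) (D.coset w J) ≤ D.cellAct (D.ε (D.Rf Θ)) (D.coset w J') := by
  obtain ⟨b₁, b₂, x', c₁', c₂', h'⟩ := D.exists_decomp2 Θ J' w
  obtain ⟨x, c₁, c₂, h⟩ := exists_decomp2_of_minL (J := J) h'.xc₁_mem.1
  have h1 : D.Decomp2 Θ J w b₁ b₂ x c₁ (c₂ * c₂') := by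
    refine ⟨?_, h'.a₁_mem, h'.a₂_mem, h.x_mem, h.c₁_mem, mul_mem h.c₂_mem (par_mono hJ h'.c₂_mem),
      h.xc₁_mem⟩
    rw [h'.eq, mul_assoc (b₁ * b₂), h.eq]
    group
  have h2 : D.Decomp2 Θ J' (x' * c₁') 1 1 x' c₁' 1 :=
    ⟨by group, one_mem _, one_mem _, h'.x_mem, h'.c₁_mem, one_mem _, h'.xc₁_mem⟩
  rw [cellAct_ε hΘ h1, cellAct_ε hΘ h', coset_le_iff, inv_mul_cancel]
  refine ⟨h.actIndex_subset hΘ hJ h2 ?_, one_mem _⟩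
  rw [h.eq, one_mul, one_mul]

theorem monotone_cellAct_ofW (σ : D.W) : Monotone (D.cellAct (D.ofW σ)) := by
  intro x y hxy
  obtain ⟨τ, J, rfl⟩ := exists_coset x
  obtain ⟨τ', J', rfl⟩ := exists_coset y
  rw [coset_le_iff] at hxy
  rw [cellAct_ofW, cellAct_ofW, coset_le_iff]
  exact ⟨hxy.1, by rw [mul_inv_rev, mul_assoc, inv_mul_cancel_left]; exact hxy.2⟩

theorem monotone_cellAct (m : D.FaceMonoid) : Monotone (D.cellAct m) := by
  obtain ⟨σ₁, σ₂, Θ, R, hΘ, hR, rfl⟩ := exists_ofW_ε_ofW m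
  rw [map_mul, map_mul, hR.eq_Rf]
  refine ((monotone_cellAct_ofW σ₁).comp (g := D.cellAct (D.ofW σ₁)) ?_).comp
    (monotone_cellAct_ofW σ₂)
  intro x y hxy
  obtain ⟨τ, J, rfl⟩ := exists_coset x
  obtain ⟨τ', J', rfl⟩ := exists_coset y
  rw [coset_le_iff] at hxy
  have h1 : D.coset τ J = D.coset τ' J := coset_eq_iff.2 ⟨rfl, hxy.2⟩
  rw [h1]
  exact cellAct_ε_le hΘ hxy.1 τ'

theorem isGood_cellAct : D.IsGood D.cellAct :=
  ⟨cellAct_ofW, stabilizer_cellAct, monotone_cellAct⟩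

end KMDatum

/-! ### Good action 1, through the closed facets of the Tits cone. -/

namespace KMDatum

open Finset

variable {I V : Type*} [Fintype I] [NormedAddCommGroup V] [NormedSpace ℝ V]
variable {D : KMDatum I V}

/-! ### Good action 1 -/

/-- The closed facet `τ F̄_J` of the Tits cone. -/
def cellSet (D : KMDatum I V) (τ : D.W) (J : Set I) : Set (Module.Dual ℝ V) :=
  D.dact τ '' D.closedFacet J

theorem mem_cellSet {τ : D.W} {J : Set I} {l : Module.Dual ℝ V} :
    l ∈ D.cellSet τ J ↔ D.dact τ⁻¹ l ∈ D.closedFacet J := by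
  constructor
  · rintro ⟨m, hm, rfl⟩
    rwa [dact_inv_dact]
  · exact fun h => ⟨_, h, D.dact_dact_inv τ l⟩

theorem dact_eq_self_of_closedFacet {J : Set I} {l : Module.Dual ℝ V} (hl : l ∈ D.closedFacet J)
    {u : D.W} (hu : u ∈ D.par J) : D.dact u l = l := dact_eq_self hl.1 hu

theorem cellSet_mul (τ : D.W) {u : D.W} {J : Set I} (hu : u ∈ D.par J) :
    D.cellSet (τ * u) J = D.cellSet τ J := by
  refine Set.image_congr fun l hl => ?_
  rw [dact_mul, dact_eq_self_of_closedFacet hl hu]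

theorem coset_le_of_cellSet_subset {τ τ' : D.W} {J J' : Set I}
    (h : D.cellSet τ J ⊆ D.cellSet τ' J') : D.coset τ J ≤ D.coset τ' J' := by
  have h1 := mem_cellSet.1 (h ⟨_, D.gen_mem J, rfl⟩)
  rw [← dact_mul] at h1
  obtain ⟨h2, h3⟩ := dact_eq_of_chamber (closedFacet_subset J (D.gen_mem J))
    (closedFacet_subset J' h1)
  rw [gen_zero] at h3
  rw [h2] at h1
  rw [coset_le_iff]
  refine ⟨fun i hi => ?_, by simpa using inv_mem h3⟩
  rw [← D.gen_zero J]
  exact h1.1 i hi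

theorem cellSet_eq_iff {τ τ' : D.W} {J J' : Set I} :
    D.cellSet τ J = D.cellSet τ' J' ↔ D.coset τ J = D.coset τ' J' := by
  constructor
  · exact fun h => le_antisymm (coset_le_of_cellSet_subset h.subset)
      (coset_le_of_cellSet_subset h.symm.subset)
  · intro h
    obtain ⟨rfl, h'⟩ := coset_eq_iff.1 h
    rw [← cellSet_mul τ h', mul_inv_cancel_left]

theorem cellSet_subset_tits (τ : D.W) (J : Set I) {l : Module.Dual ℝ V}
    (hl : l ∈ D.cellSet τ J) : l ∈ D.tits :=
  (dact_mem_tits τ⁻¹).1 (mem_tits_of_chamber (closedFacet_subset J (mem_cellSet.1 hl)))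

/-- Evaluate at `y m` the antidominant vector that exposes `R(Θ)`. If the value is zero, `m`
vanishes on the support of the vector transported by `y⁻¹`. This support contains `Θ` and, by
minimality, `red y`, so `y` fixes `m`. -/
theorem Rf_inter_cellSet {Θ J : Set I} (hΘ : D.IsSpecial Θ) {y : D.W}
    (hyL : y ∈ D.minL (Θ ∪ D.perp Θ)) {l : Module.Dual ℝ V} :
    l ∈ (D.Rf Θ).1 ∧ l ∈ D.cellSet y J ↔ l ∈ D.closedFacet (Θ ∪ J ∪ D.red y) := by
  constructor
  · rintro ⟨hl, m, hm, rfl⟩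
    obtain ⟨c, hc, rfl⟩ := exists_isAnti hΘ
    obtain ⟨d, hcd, hyd, g, hg, b, hb, hgb⟩ := hc.exists_act y⁻¹
    have h0 := (hc.mem_Rf.1 hl).2
    rw [dact_apply, hyd, apply_hc] at h0
    have hmC := closedFacet_subset J hm
    have hterm : ∀ i, 0 ≤ d i * m (D.h i) := fun i =>
      mul_nonneg ((hc.nonneg i).trans (hcd i)) (hmC i)
    have hzero : ∀ i ∈ {i | 0 < d i}, m (D.h i) = 0 := by
      intro i hi
      have h1 := (sum_eq_zero_iff_of_nonneg fun k _ => hterm k).1 h0 i (mem_univ i)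
      exact (mul_eq_zero.1 h1).resolve_left (ne_of_gt hi)
    have hred : D.red y ⊆ {i | 0 < d i} := by
      have h1 : y⁻¹ ∈ D.minR (D.perp {i | 0 < c i}) :=
        mem_minL_iff_inv.1 (minL_anti Set.subset_union_right hyL)
      have h2 := inv_mem (red_subset_iff.1 (red_subset_of_minR h1 hg hb hgb))
      rw [inv_inv] at h2
      exact red_subset_iff.2 h2
    rw [dact_eq_self hzero (red_subset_iff.1 hred)]
    refine ⟨?_, fun i _ => hmC i⟩
    rintro i ((hi | hi) | hi)
    · exact hzero i (lt_of_lt_of_le hi (hcd i))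
    · exact hm.1 i hi
    · exact hzero i (hred hi)
  · intro hl
    have hlC := closedFacet_subset _ hl
    refine ⟨(mem_Rf hΘ).2 ⟨1, one_mem _, l,
      ⟨fun i hi => hl.1 i (Or.inl (Or.inl hi)), fun i _ => hlC i⟩, (D.dact_one l).symm⟩,
      l, ⟨fun i hi => hl.1 i (Or.inl (Or.inr hi)), fun i _ => hlC i⟩, ?_⟩
    exact dact_eq_self_of_closedFacet hl
      (par_mono Set.subset_union_right (mem_par_red y))

/-- The action of the face monoid on the subsets of the dual space: `σ ε(R)` maps `S` to
`σ (R ∩ S)`. -/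
def setAct (D : KMDatum I V) (m : D.FaceMonoid) (S : Set (Module.Dual ℝ V)) :
    Set (Module.Dual ℝ V) :=
  Con.liftOn m (fun a => D.dact a.w '' {l | l ∈ a.R.1 ∧ l ∈ S}) (by
    rintro a b ⟨h1, h2⟩
    rw [Face.inv_mul_mem_stab] at h2
    rw [← h1]
    exact Set.image_congr fun l hl => (h2 l hl.1).symm)

theorem mem_setAct_wε {σ : D.W} {R : D.Face} {S : Set (Module.Dual ℝ V)} {l : Module.Dual ℝ V} :
    l ∈ D.setAct (D.wε σ R) S ↔ D.dact σ⁻¹ l ∈ R.1 ∧ D.dact σ⁻¹ l ∈ S := by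
  constructor
  · rintro ⟨m, hm, rfl⟩
    change D.dact σ⁻¹ (D.dact σ m) ∈ R.1 ∧ D.dact σ⁻¹ (D.dact σ m) ∈ S
    rwa [dact_inv_dact]
  · exact fun h => ⟨_, h, D.dact_dact_inv σ l⟩

theorem setAct_mul (m n : D.FaceMonoid) (S : Set (Module.Dual ℝ V)) :
    D.setAct (m * n) S = D.setAct m (D.setAct n S) := by
  obtain ⟨σ, R, rfl⟩ := exists_wε m
  obtain ⟨τ, T, rfl⟩ := exists_wε n
  ext l
  rw [wε_mul, mem_setAct_wε, mem_setAct_wε, mem_setAct_wε, Face.mem_inter, Face.mem_smul, inv_inv,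
    mul_inv_rev, dact_mul, dact_dact_inv, and_assoc]

theorem setAct_ofW (σ τ : D.W) (J : Set I) :
    D.setAct (D.ofW σ) (D.cellSet τ J) = D.cellSet (σ * τ) J := by
  ext l
  rw [ofW, mem_setAct_wε, mem_cellSet, mem_cellSet, mul_inv_rev, dact_mul]
  exact ⟨fun h => h.2, fun h => ⟨cellSet_subset_tits τ J (mem_cellSet.2 h), h⟩⟩

theorem Decomp1.setAct_ε {Θ J : Set I} (hΘ : D.IsSpecial Θ) {w a₁ a₂ y c : D.W}
    (h : D.Decomp1 Θ J w a₁ a₂ y c) :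
    D.setAct (D.ε (D.Rf Θ)) (D.cellSet w J) = D.cellSet a₁ (Θ ∪ J ∪ D.red y) := by
  have ha₂ : a₂ ∈ D.par (Θ ∪ J ∪ D.red y) := par_mono (fun i hi => Or.inl (Or.inl hi)) h.a₂_mem
  have hR : (D.Rf Θ).smul (a₁ * a₂) = D.Rf Θ := by
    rw [← Face.smul_smul, Rf_smul_self hΘ h.a₂_mem, Rf_smul_perp hΘ h.a₁_mem]
  rw [h.eq, cellSet_mul _ h.c_mem, ← cellSet_mul a₁ ha₂]
  ext l
  rw [ε, mem_setAct_wε, inv_one, dact_one, mem_cellSet (τ := a₁ * a₂),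
    ← Rf_inter_cellSet hΘ h.y_mem.1, mem_cellSet, mem_cellSet, ← dact_mul, ← mul_inv_rev,
    ← Face.mem_smul, hR]

theorem Decomp1.setAct {Θ J : Set I} (hΘ : D.IsSpecial Θ) {σ₁ σ₂ τ a₁ a₂ y c : D.W}
    (h : D.Decomp1 Θ J (σ₂ * τ) a₁ a₂ y c) :
    D.setAct (D.ofW σ₁ * D.ε (D.Rf Θ) * D.ofW σ₂) (D.cellSet τ J) =
      D.cellSet (σ₁ * a₁) (Θ ∪ J ∪ D.red y) := by
  rw [setAct_mul, setAct_mul, setAct_ofW, h.setAct_ε hΘ, setAct_ofW]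

/-- The closed facet of the Tits cone that belongs to an element of the Coxeter complex. -/
noncomputable def cellOf (x : D.Cox) : Set (Module.Dual ℝ V) :=
  D.cellSet (exists_coset x).choose (exists_coset x).choose_spec.choose

theorem cellOf_coset (τ : D.W) (J : Set I) : cellOf (D.coset τ J) = D.cellSet τ J :=
  cellSet_eq_iff.2 (exists_coset (D.coset τ J)).choose_spec.choose_spec.symm

theorem cellOf_injective : Function.Injective (cellOf (D := D)) := by
  intro x y h
  obtain ⟨τ, J, rfl⟩ := exists_coset x
  obtain ⟨τ', J', rfl⟩ := exists_coset y
  rw [cellOf_coset, cellOf_coset] at h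
  exact cellSet_eq_iff.1 h

theorem exists_cellOf_eq (m : D.FaceMonoid) (x : D.Cox) :
    ∃ y : D.Cox, cellOf y = D.setAct m (cellOf x) := by
  obtain ⟨σ₁, σ₂, Θ, R, hΘ, hR, rfl⟩ := exists_ofW_ε_ofW m
  obtain ⟨τ, J, rfl⟩ := exists_coset x
  obtain ⟨a₁, a₂, y, c, h⟩ := D.exists_decomp1 Θ J (σ₂ * τ)
  exact ⟨D.coset (σ₁ * a₁) (Θ ∪ J ∪ D.red y), by
    rw [cellOf_coset, cellOf_coset, hR.eq_Rf, h.setAct hΘ]⟩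

/-- Good action 1, as the action on the closed facets of the Tits cone. -/
noncomputable def closedCellAct (D : KMDatum I V) : D.FaceMonoid →* Function.End D.Cox where
  toFun m x := (exists_cellOf_eq m x).choose
  map_one' := by
    funext x
    refine cellOf_injective ((exists_cellOf_eq 1 x).choose_spec.trans ?_)
    obtain ⟨τ, J, rfl⟩ := exists_coset x
    change D.setAct (D.ofW 1) _ = cellOf (D.coset τ J)
    rw [cellOf_coset, setAct_ofW, one_mul]
  map_mul' m n := by
    funext x
    refine cellOf_injective ((exists_cellOf_eq (m * n) x).choose_spec.trans ?_)
    rw [setAct_mul, ← (exists_cellOf_eq n x).choose_spec]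
    exact (exists_cellOf_eq m _).choose_spec.symm

theorem isAction1_closedCellAct : D.IsAction1 D.closedCellAct := by
  intro Θ hΘ R hR σ₁ σ₂ τ J a₁ a₂ y c h
  refine cellOf_injective ((exists_cellOf_eq _ _).choose_spec.trans ?_)
  rw [cellOf_coset, cellOf_coset, hR.eq_Rf, h.setAct hΘ]

end KMDatum

/-! ### Comparison of the two actions and a rank three example. -/

namespace KMDatum

open Finset

section

variable {I V : Type*} [Fintype I] [NormedAddCommGroup V] [NormedSpace ℝ V]
variable {D : KMDatum I V}

/-! ### Comparison of the two actions -/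

theorem inf_empty : D.inf ∅ = ∅ := Set.subset_empty_iff.1 (inf_subset ∅)

theorem fin_empty : D.fin ∅ = ∅ := Set.subset_empty_iff.1 (fin_subset ∅)

theorem simpleImage_empty (c : D.W) : D.simpleImage c ∅ = ∅ :=
  Set.eq_empty_of_forall_notMem fun _ ⟨_, hj, _⟩ => hj

theorem s_mem_minL {K : Set I} {i : I} (hi : i ∉ K) : D.s i ∈ D.minL K := by
  refine D.roots.mem_minL_iff.2 fun k hk => ?_
  rw [s_inv]
  exact D.roots.pos_of_mem_par_of_notMem (s_mem_par (Set.mem_singleton i)) fun h : k = i =>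
    hi (h ▸ hk)

theorem mem_minR_empty (w : D.W) : w ∈ D.minR ∅ :=
  D.roots.mem_minR_iff.2 fun _ h => h.elim

theorem one_mem_minL (K : Set I) : (1 : D.W) ∈ D.minL K := fun u _ => by
  rw [len_one]; exact Nat.zero_le _

theorem one_mem_minR (J : Set I) : (1 : D.W) ∈ D.minR J := fun u _ => by
  rw [len_one]; exact Nat.zero_le _

theorem ofW_one_mul_ε_mul_ofW_one (R : D.Face) : D.ofW 1 * D.ε R * D.ofW 1 = D.ε R := by
  rw [ofW_mul_ε, wε_mul_ofW, mul_one, inv_one, Face.smul_one]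
  rfl

theorem IsAction1.ε_s {act : D.FaceMonoid →* Function.End D.Cox} (h : D.IsAction1 act)
    {Θ : Set I} (hΘ : D.IsSpecial Θ) {R : D.Face} (hR : R.IsSpecialFace Θ) {i : I}
    (hi : i ∉ Θ ∪ D.perp Θ) : act (D.ε R) (D.coset (D.s i) ∅) = D.coset 1 (Θ ∪ {i}) := by
  have hd : D.Decomp1 Θ ∅ (1 * D.s i) 1 1 (D.s i) 1 :=
    ⟨by simp, one_mem _, one_mem _, ⟨s_mem_minL hi, mem_minR_empty _⟩, one_mem _⟩
  have h1 := h Θ hΘ R hR 1 1 (D.s i) ∅ 1 1 (D.s i) 1 hd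
  rwa [ofW_one_mul_ε_mul_ofW_one, mul_one, red_s, Set.union_empty] at h1

/-- For `J = ∅` one has `J^∞ = ∅` and `(J^∞)^⊥ = I`, so `s i` can be taken as `c₁` with `x = 1`, and
nothing is added to `Θ`. -/
theorem IsAction2.ε_s {act : D.FaceMonoid →* Function.End D.Cox} (h : D.IsAction2 act)
    {Θ : Set I} (hΘ : D.IsSpecial Θ) {R : D.Face} (hR : R.IsSpecialFace Θ) {i : I}
    (hi : i ∉ Θ ∪ D.perp Θ) : act (D.ε R) (D.coset (D.s i) ∅) = D.coset 1 Θ := by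
  have hd : D.Decomp2 Θ ∅ (1 * D.s i) 1 1 1 (D.s i) 1 := by
    refine ⟨by simp, one_mem _, one_mem _, ⟨one_mem_minL _, one_mem_minR _⟩, ⟨?_, ?_⟩, one_mem _,
      ⟨by rw [one_mul]; exact s_mem_minL hi, mem_minR_empty _⟩⟩
    · rw [inf_empty]
      exact s_mem_par fun _ h => h.elim
    · rw [fin_empty]
      exact mem_minR_empty _
  have h1 := h Θ hΘ R hR 1 1 (D.s i) ∅ 1 1 1 (D.s i) 1 hd
  rwa [ofW_one_mul_ε_mul_ofW_one, mul_one, fin_empty, simpleImage_empty, Set.inter_empty,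
    Set.union_empty, Xi, inf_empty, red_one, Set.union_empty, Set.union_empty] at h1

theorem coset_union_singleton_ne {Θ : Set I} {i : I} (hi : i ∉ Θ) :
    D.coset 1 (Θ ∪ {i}) ≠ D.coset 1 Θ := fun h =>
  hi ((coset_eq_iff.1 h).1.subset (Or.inr rfl))

theorem IsAction1.ne {act₁ act₂ : D.FaceMonoid →* Function.End D.Cox} (h₁ : D.IsAction1 act₁)
    (h₂ : D.IsAction2 act₂) {Θ : Set I} (hΘ : D.IsSpecial Θ) {i : I}
    (hi : i ∉ Θ ∪ D.perp Θ) : act₁ ≠ act₂ := by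
  rintro rfl
  refine coset_union_singleton_ne (D := D) (fun h => hi (Or.inl h)) ?_
  rw [← h₁.ε_s hΘ (Rf_spec hΘ) hi, h₂.ε_s hΘ (Rf_spec hΘ) hi]

/-- Otherwise `Θ` and `Θ^⊥` cover `I`, no edge leaves `Θ`, and a path starting in `Θ` never escapes
from it. -/
theorem IsIndecomposable.exists_notMem (h : D.IsIndecomposable) {Θ : Set I} (h0 : Θ ≠ ∅)
    (h1 : Θ ≠ Set.univ) : ∃ i, i ∉ Θ ∪ D.perp Θ := by
  by_contra! hall
  obtain ⟨a, ha⟩ := Set.nonempty_iff_ne_empty.2 h0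
  refine h1 (Set.eq_univ_of_forall fun j => ?_)
  have hj : j ∈ D.comp Set.univ a := by rw [h.2 a]; trivial
  induction hj with
  | refl => exact ha
  | tail _ hbc hb =>
    rename_i b c _
    rcases hall c with hc | hc
    · exact hc
    · exact absurd (D.zero_symm _ _ (hc b hb)) hbc.2.2

end

/-! ### A generalized Cartan matrix of size three -/

/-- A generalized Cartan matrix with an affine submatrix of size two. -/
def extMatrix : Matrix (Fin 3) (Fin 3) ℤ := !![2, -2, 0; -2, 2, -1; 0, -1, 2]

/-- The linear form given by a column of a matrix. -/
noncomputable def columnForm (A : Matrix (Fin 3) (Fin 3) ℤ) (j : Fin 3) :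
    Module.Dual ℝ (EuclideanSpace ℝ (Fin 3)) where
  toFun v := ∑ i, (A i j : ℝ) * v i
  map_add' v w := by simp [mul_add, sum_add_distrib]
  map_smul' r v := by
    simp only [PiLp.smul_apply, smul_eq_mul, RingHom.id_apply, mul_sum]
    exact sum_congr rfl fun i _ => by ring

theorem columnForm_single (A : Matrix (Fin 3) (Fin 3) ℤ) (i j : Fin 3) :
    columnForm A j (EuclideanSpace.single i 1) = A i j := by
  change ∑ k, (A k j : ℝ) * (EuclideanSpace.single i (1 : ℝ) : EuclideanSpace ℝ (Fin 3)) k = _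
  simp

/-- The free realization of `extMatrix`. -/
noncomputable def extDatum : KMDatum (Fin 3) (EuclideanSpace ℝ (Fin 3)) where
  A := extMatrix
  diag := by decide
  offDiag i j := by fin_cases i <;> fin_cases j <;> simp [extMatrix]
  zero_symm i j := by fin_cases i <;> fin_cases j <;> simp [extMatrix]
  h i := EuclideanSpace.single i 1
  α := columnForm extMatrix
  h_indep := by
    have h1 : (fun i => EuclideanSpace.single i (1 : ℝ)) = EuclideanSpace.basisFun (Fin 3) ℝ :=
      funext fun i => (EuclideanSpace.basisFun_apply _ ℝ i).symm
    rw [h1]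
    exact (EuclideanSpace.basisFun (Fin 3) ℝ).orthonormal.linearIndependent
  -- The matrix has determinant `-2`, so three dimensions suffice, with the standard basis as
  -- coroots.
  α_indep := by
    rw [Fintype.linearIndependent_iff]
    intro g hg
    have h1 : ∀ i, ∑ j, g j * (extMatrix i j : ℝ) = 0 := fun i => by
      have h2 := LinearMap.congr_fun hg (EuclideanSpace.single i 1)
      rw [LinearMap.sum_apply] at h2
      simpa [columnForm_single] using h2
    have h2 := h1 0
    have h3 := h1 1
    have h4 := h1 2
    simp [Fin.sum_univ_three, extMatrix] at h2 h3 h4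
    intro i
    fin_cases i
    · change g 0 = 0
      linarith
    · change g 1 = 0
      linarith
    · change g 2 = 0
      linarith
  pairing i j := columnForm_single extMatrix i j

/-- The vector is the null vector of the affine block on `{0, 1}`, extended by zero; the last column
gives `-1`. Thus `{0, 1}` is special. -/
theorem isAnti_extDatum : extDatum.IsAnti ![1, 1, 0] where
  nonneg i := by fin_cases i <;> simp
  le j := by
    change ∑ i, ![(1 : ℝ), 1, 0] i * (extMatrix i j : ℝ) ≤ 0
    fin_cases j <;> simp [Fin.sum_univ_three, extMatrix]

theorem notMem_extDatum :
    (2 : Fin 3) ∉ {i | 0 < (![1, 1, 0] : Fin 3 → ℝ) i} ∪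
      extDatum.perp {i | 0 < (![1, 1, 0] : Fin 3 → ℝ) i} := by
  rintro (h | h)
  · exact lt_irrefl (0 : ℝ) h
  · have h1 : extMatrix 2 1 = 0 := h 1 (zero_lt_one (α := ℝ))
    exact absurd h1 (by decide)

end KMDatum

theorem mainTheorem3 :
    (∀ (I V : Type*) [Fintype I] [NormedAddCommGroup V] [NormedSpace ℝ V]
      [FiniteDimensional ℝ V] (D : KMDatum I V),
      -- the Tits cone is the union of the translates of the closed chamber
      ((D.tits : Set (Module.Dual ℝ V)) = D.orbit D.chamber) ∧
      -- the sets `R(Θ)` are faces, and every element has the form `σ₁ ε(R(Θ)) σ₂`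
      (∀ Θ, D.IsSpecial Θ → ∃ R : D.Face, R.IsSpecialFace Θ) ∧
      (∀ m : D.FaceMonoid, ∃ (σ₁ σ₂ : D.W) (Θ : Set I) (R : D.Face),
        D.IsSpecial Θ ∧ R.IsSpecialFace Θ ∧ m = D.ofW σ₁ * D.ε R * D.ofW σ₂) ∧
      -- the required decompositions exist
      (∀ Θ J, D.IsSpecial Θ → ∀ w : D.W, ∃ a₁ a₂ x c₁ c₂, D.Decomp2 Θ J w a₁ a₂ x c₁ c₂) ∧
      -- the facets of Looijenga's cone are parametrized by the Coxeter complex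
      D.FacetsPartition ∧
      ∃ act₂ : D.FaceMonoid →* Function.End D.Cox,
        -- the formula defines a faithful good action
        D.IsAction2 act₂ ∧ Function.Injective act₂ ∧ D.IsGood act₂ ∧
        -- which is induced by the action on Looijenga's cone
        (∃ actLoo : D.FaceMonoid →* Function.End D.Loo,
          D.IsLooAction actLoo ∧ D.IsInducedBy act₂ actLoo) ∧
        -- and differs from good action 1
        (∃ act₁ : D.FaceMonoid →* Function.End D.Cox, D.IsAction1 act₁ ∧
          (∀ Θ, D.IsSpecial Θ → ∀ R : D.Face, R.IsSpecialFace Θ → ∀ i ∉ Θ ∪ D.perp Θ,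
            act₁ (D.ε R) (D.coset (D.s i) ∅) = D.coset 1 (Θ ∪ {i}) ∧
            act₂ (D.ε R) (D.coset (D.s i) ∅) = D.coset 1 Θ ∧
            D.coset 1 (Θ ∪ {i}) ≠ D.coset 1 Θ) ∧
          (D.IsIndecomposable → (∃ Θ, D.IsSpecial Θ ∧ Θ ≠ ∅ ∧ Θ ≠ Set.univ) →
            act₁ ≠ act₂))) ∧
    (∃ D : KMDatum (Fin 3) (EuclideanSpace ℝ (Fin 3)),
      ∀ act₁ act₂ : D.FaceMonoid →* Function.End D.Cox,
        D.IsAction1 act₁ → D.IsAction2 act₂ → act₁ ≠ act₂) := by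
  refine ⟨fun I V _ _ _ _ D => ⟨KMDatum.coe_tits, fun Θ hΘ => KMDatum.exists_isSpecialFace hΘ,
    KMDatum.exists_ofW_ε_ofW, fun Θ J _ w => D.exists_decomp2 Θ J w, KMDatum.facetsPartition,
    D.cellAct, KMDatum.isAction2_cellAct, KMDatum.injective_cellAct, KMDatum.isGood_cellAct,
    ⟨D.looAct, KMDatum.isLooAction_looAct, KMDatum.isInducedBy_looAct⟩,
    D.closedCellAct, KMDatum.isAction1_closedCellAct, fun Θ hΘ R hR i hi =>
      ⟨KMDatum.isAction1_closedCellAct.ε_s hΘ hR hi, KMDatum.isAction2_cellAct.ε_s hΘ hR hi,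
        KMDatum.coset_union_singleton_ne fun h => hi (Or.inl h)⟩,
    fun hA ⟨Θ, hΘ, h0, h1⟩ => ?_⟩,
    KMDatum.extDatum, fun act₁ act₂ h₁ h₂ =>
      h₁.ne h₂ KMDatum.isAnti_extDatum.isSpecial KMDatum.notMem_extDatum⟩
  obtain ⟨i, hi⟩ := hA.exists_notMem h0 h1
  exact KMDatum.isAction1_closedCellAct.ne KMDatum.isAction2_cellAct hΘ hi
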